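/- Let $X_0,X_1$ be $\mathbb R^d$-valued random variables and $F$ an $\mathbb R^k$-valued random variable (the latent variable) on a common probability space $(\Omega,\mathcal F,\mathbb P)$, and assume that $X_1-X_0$ is $\mathbb P$-integrable. Put $X_t=(1-t)X_0+tX_1$ for $t\in[0,1]$. Fix a regular conditional law of $(X_0,X_1)$ given $F=f$, and let $\mu^f_t=\mathcal L(X_t\mid F=f)$ be the image of this law under $(x_0,x_1)\mapsto(1-t)x_0+tx_1$. For a Borel field $v=v_{t,f}(x)$ with values in $\mathbb R^d$ (jointly measurable in $(t,f,x)$) and $\beta\ge 0$, let $$\mathcal L_\beta(v)=\mathbb E_{(x_0,x_1)\sim\mathcal L(X_0,X_1)}\Big[\int_0^1\!\!\int \big\|v_{t,f}\big((1-t)x_0+tx_1\big)-(x_1-x_0)\big\|^2\,q(df\mid x_0,x_1)\,dt+\beta\,D_{KL}\big(q(\cdot\mid x_0,x_1)\,\|\,N(0,I)\big)\Big]\in[0,\infty]$$ be the Latent-CFM loss, where the (fixed) encoder $q(\cdot\mid x_0,x_1)$ is the conditional law of $F$ given $(X_0,X_1)=(x_0,x_1)$. Call $v$ a conditional velocity if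 $v_{t,f}(x)=\mathbb E[X_1-X_0\mid X_t=x,\,F=f]$ for almost every $t\in[0,1]$, that is, $v_{t,F}(X_t)=\mathbb E[X_1-X_0\mid X_t,F]$ almost surely. (1) For every $\beta\ge0$, a Borel field $v$ minimizes $\mathcal L_\beta$ among all Borel fields, with a finite minimal value, if and only if $v$ is a conditional velocity and $\mathcal L_\beta(v)<\infty$. (2) Let the Borel field $v^*$ be a conditional velocity (for example, a minimizer as in (1)), and suppose that for $F_\#\mathbb P$-almost every $f$ it is regular in the following sense: for every $T<1$ and every closed ball $B\subset\mathbb R^d$ centred at the origin there is a function $m$, integrable on $(0,T)$, such that for almost every $t\in(0,T)$ one has $\|v^*_{t,f}\|\le m(t)$ on $B$ and $v^*_{t,f}$ is Lipschitz on $B$ with constant $m(t)$. Then for $F_\#\mathbb P$-almost every $f$: - for $\mathcal L(X_0\mid F=f)$-almost every $x$ the equation $\dot\gamma_t=v^*_{t,f}(\gamma_t)$, $\gamma_0=x$, has exactly one absolutely continuous solution on $[0,1]$, denoted $t\mapsto\phi^{v^*,f}_t(x)$; - for all $t\in[0,1]$, the image of $\mathcal L(X_0\mid F=f)$ under $\phi^{v^*,f}_t$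 is $\mu^f_t$; in particular its image under $\phi_1^{v^*,f}$ is $\mathcal L(X_1\mid F=f)$. If moreover $X_0$ is independent of $F$, then for $F_\#\mathbb P$-almost every $f$ one has $\mathcal L(\phi^{v^*,f}_t(X_0))=\mu^f_t$ for all $t\in[0,1]$, and in particular $\mathcal L(\phi^{v^*,f}_1(X_0))=\mathcal L(X_1\mid F=f)$. In all cases (independent or not), $\phi^{v^*,F}_1(X_0)$ has the same law as $X_1$. -/

import Mathlib

open MeasureTheory ProbabilityTheory Set
open scoped NNReal ENNReal

noncomputable section

namespace LatentCFM

/-- The straight line between the two components of `p`, at time `t`: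
`(1 - t) x₀ + t x₁` for `p = (x₀, x₁)`. -/
def interp {E : Type*} [NormedAddCommGroup E] [NormedSpace ℝ E] (t : ℝ) (p : E × E) : E :=
  (1 - t) • p.1 + t • p.2

/-- A vector field on `ℝ^d` depending on time and on a latent value in `ℝ^k`, used as `v t f x`. -/
abbrev Field (d k : ℕ) : Type :=
  ℝ → EuclideanSpace ℝ (Fin k) → EuclideanSpace ℝ (Fin d) → EuclideanSpace ℝ (Fin d)

/-- Joint Borel measurability in (time, latent value, position). -/
def Field.IsMeasurable {d k : ℕ} (v : Field d k) : Prop :=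
  Measurable fun p : ℝ × EuclideanSpace ℝ (Fin k) × EuclideanSpace ℝ (Fin d) =>
    v p.1 p.2.1 p.2.2

section Probability

variable {Ω : Type*} [MeasurableSpace Ω] {d k : ℕ}

/-- The encoder `q(f | x₀, x₁)`: the conditional law of `F` given `(X₀, X₁)`. -/
def encoder (P : Measure Ω) [IsFiniteMeasure P] (X₀ X₁ : Ω → EuclideanSpace ℝ (Fin d))
    (F : Ω → EuclideanSpace ℝ (Fin k)) :
    Kernel (EuclideanSpace ℝ (Fin d) × EuclideanSpace ℝ (Fin d)) (EuclideanSpace ℝ (Fin k)) :=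
  condDistrib F (fun ω => (X₀ ω, X₁ ω)) P

/-- The Latent-CFM loss with weight `β` of the Kullback-Leibler term and standard Gaussian prior:
the expectation over `(x₀, x₁)` of
`E_{t, f} ‖v_{t,f}((1 - t) x₀ + t x₁) - (x₁ - x₀)‖² + β KL(q(f | x₀, x₁) ‖ N(0, I))`,
with `t` uniform on `[0, 1]` and `f` drawn from `q(f | x₀, x₁)`. It may be infinite. -/
def loss (P : Measure Ω) [IsFiniteMeasure P] (X₀ X₁ : Ω → EuclideanSpace ℝ (Fin d))
    (F : Ω → EuclideanSpace ℝ (Fin k)) (β : ℝ≥0) (v : Field d k) : ℝ≥0∞ :=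
  ∫⁻ p, ((∫⁻ t in Icc (0 : ℝ) 1,
        ∫⁻ f, ‖v t f (interp t p) - (p.2 - p.1)‖ₑ ^ 2 ∂(encoder P X₀ X₁ F p))
      + β * InformationTheory.klDiv (encoder P X₀ X₁ F p)
          (stdGaussian (EuclideanSpace ℝ (Fin k))))
    ∂(P.map fun ω => (X₀ ω, X₁ ω))

/-- `v` minimizes the loss, with a finite value, among all measurable fields. -/
def IsLossMinimizer (P : Measure Ω) [IsFiniteMeasure P] (X₀ X₁ : Ω → EuclideanSpace ℝ (Fin d))
    (F : Ω → EuclideanSpace ℝ (Fin k)) (β : ℝ≥0) (v : Field d k) : Prop :=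
  loss P X₀ X₁ F β v < ∞ ∧
    ∀ w : Field d k, w.IsMeasurable → loss P X₀ X₁ F β v ≤ loss P X₀ X₁ F β w

/-- `v_{t,f}(x) = E[X₁ - X₀ | X_t = x, F = f]`: for almost every `t ∈ [0, 1]`, `v_{t,F}(X_t)` is a
version of the conditional expectation of `X₁ - X₀` given the σ-algebra generated by `(X_t, F)`. -/
def IsConditionalVelocity (P : Measure Ω) (X₀ X₁ : Ω → EuclideanSpace ℝ (Fin d))
    (F : Ω → EuclideanSpace ℝ (Fin k)) (v : Field d k) : Prop :=
  ∀ᵐ t ∂(volume.restrict (Icc (0 : ℝ) 1)),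
    (fun ω => v t (F ω) (interp t (X₀ ω, X₁ ω))) =ᵐ[P]
      P[fun ω => X₁ ω - X₀ ω |
        MeasurableSpace.comap (fun ω => (interp t (X₀ ω, X₁ ω), F ω)) inferInstance]

/-- A regular conditional law of the pair `(X₀, X₁)` given `F = f`. -/
def pairLaw (P : Measure Ω) [IsFiniteMeasure P] (X₀ X₁ : Ω → EuclideanSpace ℝ (Fin d))
    (F : Ω → EuclideanSpace ℝ (Fin k)) (f : EuclideanSpace ℝ (Fin k)) :
    Measure (EuclideanSpace ℝ (Fin d) × EuclideanSpace ℝ (Fin d)) :=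
  condDistrib (fun ω => (X₀ ω, X₁ ω)) F P f

/-- The `F`-conditional marginal path `μ^f_t = L(X_t | F = f)`. All times use one and the same
regular conditional law of `(X₀, X₁)`, so that the path is well defined for almost every `f`. -/
def marginalPath (P : Measure Ω) [IsFiniteMeasure P] (X₀ X₁ : Ω → EuclideanSpace ℝ (Fin d))
    (F : Ω → EuclideanSpace ℝ (Fin k)) (f : EuclideanSpace ℝ (Fin k)) (t : ℝ) :
    Measure (EuclideanSpace ℝ (Fin d)) :=
  (pairLaw P X₀ X₁ F f).map (interp t)

end Probability

section ODE

variable {E : Type*} [NormedAddCommGroup E] [NormedSpace ℝ E]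

/-- Local regularity of a time-dependent vector field on `[0, 1)`: for every `T < 1` and every
ball `B`, the sum `sup_B ‖w_t‖ + Lip(w_t, B)` is bounded by a function of `t` that is integrable
on `(0, T)`. -/
def IsLocallyRegular (w : ℝ → E → E) : Prop :=
  ∀ T : ℝ, T < 1 → ∀ R : ℝ, ∃ m : ℝ → ℝ, IntegrableOn m (Ioo 0 T) ∧
    ∀ᵐ t ∂(volume.restrict (Ioo (0 : ℝ) T)),
      (∀ x ∈ Metric.closedBall (0 : E) R, ‖w t x‖ ≤ m t) ∧
      (∀ x ∈ Metric.closedBall (0 : E) R, ∀ y ∈ Metric.closedBall (0 : E) R,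
        ‖w t x - w t y‖ ≤ m t * ‖x - y‖)

/-- `γ` is an absolutely continuous solution on `[0, 1]` of `γ' = w_t(γ)`, `γ(0) = x`,
in integral form. -/
def IsSolution (w : ℝ → E → E) (x : E) (γ : ℝ → E) : Prop :=
  ContinuousOn γ (Icc 0 1) ∧
  IntervalIntegrable (fun s => w s (γ s)) volume 0 1 ∧
  ∀ t ∈ Icc (0 : ℝ) 1, γ t = x + ∫ s in (0 : ℝ)..t, w s (γ s)

open Classical in
/-- The flow `φ_t^w(x)`: the value at time `t` of the solution on `[0, 1]` that starts at `x`
(with the value `x` where there is no such solution). -/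
def flow (w : ℝ → E → E) (t : ℝ) (x : E) : E :=
  if h : ∃ γ, IsSolution w x γ then h.choose t else x

/-- There is exactly one solution on `[0, 1]` that starts at `x`, and it is the flow line. -/
def FlowWellDefinedAt (w : ℝ → E → E) (x : E) : Prop :=
  IsSolution w x (fun t => flow w t x) ∧
    ∀ γ, IsSolution w x γ → ∀ t ∈ Icc (0 : ℝ) 1, γ t = flow w t x

end ODE

end LatentCFM

end

set_option linter.unusedSectionVars false

noncomputable section

namespace LatentCFM

open Filter Topology

/-! Part (1) is an L² projection. The encoder and the law of (X₀, X₁) recombine to the joint law of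
(X₀, X₁, F), so the loss is the squared L² norm over P × dt of the residual v_{t,F}(X_t) - (X₁ -
X₀), plus a Kullback-Leibler term free of v (`loss_eq`). For a conditional velocity the residual
integrates to zero over every event of (F, t, X_t). Pythagoras then gives minimality, and perturbing
a minimizer by a constant on one such event gives the converse.

For part (2), disintegration along F (`ae_isVelocity`) reduces the problem to one field v and one
law ρ of the pair. With Φ the flow and u_s = ψ ∘ Φ_{s,T}, formally d/ds E[u_s(X_s)] = E[∂_s u + ∇u ·
(X₁ - X₀)] = E[(∂_s u + ∇u · v)(X_s)] = 0, the last step because u is constant along the flow. Hence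
E ψ(X_T) = E ψ(Φ_{0,T}(X₀)). Since v is regular only locally and before time 1, Φ is the flow of a
truncated field and a cutoff of radius R is inserted. The gradient of the cutoff, of size c/R, costs
at most (c/R) E‖X₁ - X₀‖ by conditional Jensen (`abs_transport_le`). Since u is only Lipschitz in
space and the coefficients are only integrable in time, u is mollified and the derivative is
replaced by increments over short intervals.

Explosion is excluded by the same estimate. Letting R → ∞ shows that the truncated flow, before it
leaves a ball, carries the law of X₀ to a measure dominated by the law of X_s
(`map_truncFlow_restrict_le`). The expected length of an integral curve is therefore at most E‖X₁ -
X₀‖, so almost every curve has finite length (`ae_totalLength_ne_top`). Such a curve stays bounded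
and extends to time 1, and local Lipschitz bounds before time 1 plus continuity give uniqueness.
Dominated convergence in the transport estimate yields `map_flow_eq`. The law of the endpoint for
random F follows by integrating over F, which needs joint measurability of the flow. -/

/-! ### Grönwall's inequality with an integrable coefficient -/

/-- An increment inequality valid on all short subintervals holds on the whole interval. -/
lemma sub_le_sub_of_forall_short {f g : ℝ → ℝ} {a b h : ℝ} (hab : a ≤ b) (hh : 0 < h)
    (H : ∀ s ∈ Icc a b, ∀ t ∈ Icc a b, s ≤ t → t - s < h → f t - f s ≤ g t - g s) :
    f b - f a ≤ g b - g a := by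
  obtain ⟨n, hn⟩ := exists_nat_gt ((b - a) / h)
  have hn0 : (0 : ℝ) < n := lt_of_le_of_lt (div_nonneg (by linarith) hh.le) hn
  set p : ℕ → ℝ := fun i => a + i * ((b - a) / n) with hp
  have hstep : 0 ≤ (b - a) / n := div_nonneg (by linarith) hn0.le
  have hshort : (b - a) / n < h := by
    rw [div_lt_iff₀ hh] at hn
    rw [div_lt_iff₀ hn0]
    linarith
  have hmem : ∀ i : ℕ, i ≤ n → p i ∈ Icc a b := by
    intro i hi
    refine ⟨by simp only [hp]; nlinarith [mul_nonneg (Nat.cast_nonneg (α := ℝ) i) hstep], ?_⟩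
    have h1 : (i : ℝ) * ((b - a) / n) ≤ n * ((b - a) / n) := by
      have : (i : ℝ) ≤ n := by exact_mod_cast hi
      gcongr
    have h2 : (n : ℝ) * ((b - a) / n) = b - a := by field_simp
    simp only [hp]
    linarith
  have key : ∀ i : ℕ, i ≤ n → f (p i) - f a ≤ g (p i) - g a := by
    intro i
    induction i with
    | zero => intro _; simp [hp]
    | succ i ih =>
      intro hi
      have h1 := ih (by omega)
      have h2 : p (i + 1) - p i = (b - a) / n := by simp only [hp]; push_cast; ring
      have h3 := H (p i) (hmem i (by omega)) (p (i + 1)) (hmem _ hi) (by linarith) (by linarith)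
      linarith
  have := key n le_rfl
  have hpn : p n = b := by simp only [hp]; field_simp; ring
  rwa [hpn] at this

/-- Weighted integral bound behind Grönwall's inequality with an integrable coefficient. -/
lemma integral_mul_exp_primitive_le {m : ℝ → ℝ} (hm : Integrable m) (h0 : ∀ t, 0 ≤ m t)
    {a b : ℝ} (hab : a ≤ b) :
    ∫ r in a..b, m r * Real.exp (2 * ∫ s in a..r, m s) ≤
      (Real.exp (2 * ∫ s in a..b, m s) - 1) / 2 := by
  set M : ℝ → ℝ := fun r => ∫ s in a..r, m s with hM
  have hMc : Continuous M := intervalIntegral.continuous_primitive (fun _ _ => hm.intervalIntegrable) a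
  set G : ℝ → ℝ := fun r => Real.exp (2 * M r) with hG
  have hGc : Continuous G := by fun_prop
  have hMadd : ∀ s t, M t - M s = ∫ r in s..t, m r := fun s t =>
    intervalIntegral.integral_interval_sub_left hm.intervalIntegrable hm.intervalIntegrable
  have hMmono : Monotone M := fun s t hst => by
    have := hMadd s t
    have h2 := intervalIntegral.integral_nonneg hst (fun u _ => h0 u) (μ := volume)
    linarith
  have hGmono : Monotone G := fun s t hst => Real.exp_le_exp.2 (by linarith [hMmono hst])
  have hmG : ∀ s t, IntervalIntegrable (fun r => m r * G r) volume s t := fun s t =>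
    hm.intervalIntegrable.mul_continuousOn hGc.continuousOn
  have hGb : 0 < G b := Real.exp_pos _
  -- Formally m G = G'/2. Differentiating the primitive M is avoided: on intervals where M grows by
  -- less than δ, replacing G by its right end value costs at most δ times the increment of G, and
  -- these errors telescope.
  suffices ∀ δ > 0, (∫ r in a..b, m r * G r) ≤ (G b - 1) / 2 + δ * (G b - 1) by
    refine le_of_forall_pos_le_add fun ε hε => ?_
    have hGb1 : 1 ≤ G b := by
      have := hGmono hab
      simpa [hG, hM] using this
    refine (this (ε / G b) (by positivity)).trans ?_
    have : ε / G b * (G b - 1) ≤ ε / G b * G b := by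
      gcongr; linarith
    rw [div_mul_cancel₀ _ hGb.ne'] at this
    simp only [hG, hM] at this ⊢
    linarith
  intro δ hδ
  have huc : UniformContinuousOn M (Icc a b) :=
    isCompact_Icc.uniformContinuousOn_of_continuous hMc.continuousOn
  obtain ⟨h, hh, H⟩ := Metric.uniformContinuousOn_iff.1 huc δ hδ
  have := sub_le_sub_of_forall_short (f := fun t => ∫ r in a..t, m r * G r)
    (g := fun t => (1 / 2 + δ) * G t) hab hh ?_
  · simp only [intervalIntegral.integral_same, sub_zero] at this
    have hGa : G a = 1 := by simp [hG, hM]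
    rw [hGa] at this
    linarith
  · intro s hs t ht hst hsth
    have hMst : M t - M s < δ := by
      have := H t ht s hs (by rw [Real.dist_eq, abs_of_nonneg (by linarith)]; exact hsth)
      rw [Real.dist_eq] at this
      exact (le_abs_self _).trans_lt this
    have h1 : (∫ r in a..t, m r * G r) - (∫ r in a..s, m r * G r) = ∫ r in s..t, m r * G r :=
      intervalIntegral.integral_interval_sub_left (hmG _ _) (hmG _ _)
    have h2 : (∫ r in s..t, m r * G r) ≤ ∫ r in s..t, m r * G t := by
      refine intervalIntegral.integral_mono_on hst (hmG _ _)
        (hm.intervalIntegrable.mul_const _) fun r hr => ?_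
      exact mul_le_mul_of_nonneg_left (hGmono hr.2) (h0 r)
    rw [intervalIntegral.integral_mul_const, ← hMadd] at h2
    have h3 : G s * (2 * (M t - M s)) ≤ G t - G s := by
      have e : G t = G s * Real.exp (2 * (M t - M s)) := by
        simp only [hG]; rw [← Real.exp_add]; congr 1; ring
      have := Real.add_one_le_exp (2 * (M t - M s))
      have hp : 0 < G s := Real.exp_pos _
      rw [e]
      nlinarith
    have hmm : 0 ≤ M t - M s := by linarith [hMmono hst]
    have hgg : 0 ≤ G t - G s := by linarith [hGmono hst]
    rw [h1]
    nlinarith [mul_le_mul_of_nonneg_left hMst.le hgg]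

/-- Grönwall's inequality in integral form with an integrable coefficient. -/
lemma gronwall_integrable {m : ℝ → ℝ} (hm : Integrable m) (h0 : ∀ t, 0 ≤ m t)
    {a b c : ℝ} {u : ℝ → ℝ} (hu : ContinuousOn u (Icc a b))
    (hu0 : ∀ t ∈ Icc a b, 0 ≤ u t) (hc : 0 ≤ c)
    (H : ∀ t ∈ Icc a b, u t ≤ c + ∫ r in a..t, m r * u r) {t : ℝ} (ht : t ∈ Icc a b) :
    u t ≤ 2 * c * Real.exp (2 * ∫ s, m s) := by
  set M : ℝ → ℝ := fun r => ∫ s in a..r, m s with hM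
  have hMc : Continuous M := intervalIntegral.continuous_primitive (fun _ _ => hm.intervalIntegrable) a
  set G : ℝ → ℝ := fun r => Real.exp (2 * M r) with hG
  have hGc : Continuous G := by fun_prop
  have hGp : ∀ t, 0 < G t := fun _ => Real.exp_pos _
  -- At a maximum point of u / G, with maximum S, the hypothesis gives S G ≤ c + S (G - 1) / 2. Half
  -- of the left side absorbs the integral, which is why the weight is exp (2 M) and the final
  -- factor is 2.
  obtain ⟨t0, ht0, hmax⟩ := isCompact_Icc.exists_isMaxOn ⟨t, ht⟩
    (hu.div hGc.continuousOn (fun x _ => (hGp x).ne'))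
  set S := u t0 / G t0 with hS
  have hS0 : 0 ≤ S := div_nonneg (hu0 _ ht0) (hGp _).le
  have hle : ∀ r ∈ Icc a b, u r ≤ S * G r := fun r hr => by
    have : u r / G r ≤ S := hmax hr
    rwa [div_le_iff₀ (hGp r)] at this
  have h1 := H t0 ht0
  have hu1 : ContinuousOn u (uIcc a t0) := by
    rw [uIcc_of_le ht0.1]
    exact hu.mono (Icc_subset_Icc le_rfl ht0.2)
  have h2 : (∫ r in a..t0, m r * u r) ≤ ∫ r in a..t0, S * (m r * G r) := by
    refine intervalIntegral.integral_mono_on ht0.1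
      (hm.intervalIntegrable.mul_continuousOn hu1)
      ((hm.intervalIntegrable.mul_continuousOn hGc.continuousOn).const_mul _) fun r hr => ?_
    have := mul_le_mul_of_nonneg_left (hle r ⟨hr.1, hr.2.trans ht0.2⟩) (h0 r)
    linarith
  rw [intervalIntegral.integral_const_mul] at h2
  have h3 := mul_le_mul_of_nonneg_left (integral_mul_exp_primitive_le hm h0 ht0.1) hS0
  have h4 : u t0 = S * G t0 := by rw [hS, div_mul_cancel₀ _ (hGp t0).ne']
  have hG1 : 1 ≤ G t0 := by
    have : 0 ≤ M t0 := intervalIntegral.integral_nonneg ht0.1 (fun u _ => h0 u)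
    exact Real.one_le_exp (by linarith)
  have h5 : S * G t0 ≤ 2 * c := by
    change S * _ ≤ S * ((G t0 - 1) / 2) at h3
    change _ ≤ S * (∫ r in a..t0, m r * G r) at h2
    change S * (∫ r in a..t0, m r * G r) ≤ _ at h3
    nlinarith
  have hS2 : S ≤ 2 * c := by nlinarith
  have hGle : G t ≤ Real.exp (2 * ∫ s, m s) := by
    refine Real.exp_le_exp.2 ?_
    have : M t ≤ ∫ s, m s := by
      simp only [hM]
      rw [intervalIntegral.integral_of_le ht.1]
      exact setIntegral_le_integral hm (Eventually.of_forall h0)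
    linarith
  calc u t ≤ S * G t := hle t ht
    _ ≤ 2 * c * Real.exp (2 * ∫ s, m s) := by
      gcongr

/-! ### Carathéodory flows by Picard iteration -/

section Caratheodory

variable {E : Type*} [NormedAddCommGroup E] [NormedSpace ℝ E] [CompleteSpace E]
  [MeasurableSpace E] [BorelSpace E] [SecondCountableTopology E]

/-- A time-dependent field with an integrable bound, which is also a global Lipschitz constant. -/
structure IsCaratheodory (w : ℝ → E → E) (m : ℝ → ℝ) : Prop where
  measurable : Measurable (Function.uncurry w)
  integrable : Integrable m
  bound : ∀ t x, ‖w t x‖ ≤ m t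
  lip : ∀ t x y, ‖w t x - w t y‖ ≤ m t * ‖x - y‖

/-- Picard iterates for the initial value `x` at time `a`, frozen before time `a`. -/
def picard (w : ℝ → E → E) (a : ℝ) (x : E) : ℕ → ℝ → E
  | 0 => fun _ => x
  | k + 1 => fun t => x + ∫ r in a..max a t, w r (picard w a x k r)

/-- The limit of the Picard iterates. -/
def carFlow (w : ℝ → E → E) (a t : ℝ) (x : E) : E :=
  limUnder atTop fun k => picard w a x k t

/-- The field enters only under a time integral, so a null set of times is invisible. This lets a
truncated field be replaced by a version whose bounds hold at every time. -/
lemma picard_congr {w w' : ℝ → E → E} (h : ∀ᵐ t, w t = w' t) (a : ℝ) (x : E) (k : ℕ) :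
    picard w a x k = picard w' a x k := by
  induction k with
  | zero => rfl
  | succ k ih =>
    funext t
    simp only [picard, ih]
    congr 1
    refine intervalIntegral.integral_congr_ae ?_
    filter_upwards [h] with r hr _
    rw [hr]

lemma carFlow_congr {w w' : ℝ → E → E} (h : ∀ᵐ t, w t = w' t) : carFlow w = carFlow w' := by
  funext a t x
  simp only [carFlow, picard_congr h]

namespace IsCaratheodory

variable {w : ℝ → E → E} {m : ℝ → ℝ}

lemma nonneg (hw : IsCaratheodory w m) (t : ℝ) : 0 ≤ m t := (norm_nonneg _).trans (hw.bound t 0)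

lemma integrable_comp_of_aestronglyMeasurable (hw : IsCaratheodory w m) {γ : ℝ → E} {s : Set ℝ}
    (hγ : AEMeasurable γ (volume.restrict s)) : IntegrableOn (fun r => w r (γ r)) s := by
  refine Integrable.mono' hw.integrable.integrableOn ?_ (Eventually.of_forall fun r => hw.bound r _)
  exact (hw.measurable.comp_aemeasurable (aemeasurable_id.prodMk hγ)).aestronglyMeasurable

lemma intervalIntegrable_comp (hw : IsCaratheodory w m) {γ : ℝ → E} (hγ : Measurable γ)
    (a b : ℝ) : IntervalIntegrable (fun r => w r (γ r)) volume a b :=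
  ⟨hw.integrable_comp_of_aestronglyMeasurable hγ.aemeasurable,
    hw.integrable_comp_of_aestronglyMeasurable hγ.aemeasurable⟩

lemma intervalIntegrable_comp_of_continuousOn (hw : IsCaratheodory w m) {γ : ℝ → E} {a b : ℝ}
    (hγ : ContinuousOn γ (Icc a b)) (hab : a ≤ b) :
    IntervalIntegrable (fun r => w r (γ r)) volume a b := by
  rw [intervalIntegrable_iff_integrableOn_Icc_of_le hab]
  exact hw.integrable_comp_of_aestronglyMeasurable (hγ.aemeasurable measurableSet_Icc)

lemma continuous_picard (hw : IsCaratheodory w m) (a : ℝ) (x : E) (k : ℕ) :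
    Continuous (picard w a x k) := by
  induction k with
  | zero => exact continuous_const
  | succ k ih =>
    have := intervalIntegral.continuous_primitive
      (fun a b => hw.intervalIntegrable_comp ih.measurable a b) a
    exact continuous_const.add (this.comp (continuous_const.max continuous_id))

/-- In the sup norm weighted by exp (-2 ∫ m) the Picard map contracts by 1/2, by
`integral_mul_exp_primitive_le`. The first increment is at most the total mass of m. No smallness of
the time interval is needed. -/
lemma norm_picard_succ_sub_le (hw : IsCaratheodory w m) (a t : ℝ) (x : E) (k : ℕ) :
    ‖picard w a x (k + 1) t - picard w a x k t‖ ≤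
      (∫ s, m s) * (1 / 2) ^ k * Real.exp (2 * ∫ s in a..max a t, m s) := by
  have hC : 0 ≤ ∫ s, m s := integral_nonneg hw.nonneg
  have hW1 : ∀ t, 1 ≤ Real.exp (2 * ∫ s in a..max a t, m s) := fun t => by
    have : 0 ≤ ∫ s in a..max a t, m s :=
      intervalIntegral.integral_nonneg (le_max_left _ _) (fun u _ => hw.nonneg u)
    exact Real.one_le_exp (by linarith)
  induction k generalizing t with
  | zero =>
    simp only [picard, add_sub_cancel_left, pow_zero, mul_one]
    have h1 : ‖∫ r in a..max a t, w r x‖ ≤ ∫ r in a..max a t, m r :=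
      intervalIntegral.norm_integral_le_of_norm_le (le_max_left _ _)
        (Eventually.of_forall fun r _ => hw.bound r x) hw.integrable.intervalIntegrable
    have h2 : ∫ r in a..max a t, m r ≤ ∫ s, m s := by
      rw [intervalIntegral.integral_of_le (le_max_left _ _)]
      exact setIntegral_le_integral hw.integrable (Eventually.of_forall hw.nonneg)
    nlinarith [hW1 t]
  | succ k ih =>
    have e : picard w a x (k + 1 + 1) t - picard w a x (k + 1) t =
        ∫ r in a..max a t, (w r (picard w a x (k + 1) r) - w r (picard w a x k r)) := by
      rw [intervalIntegral.integral_sub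
        (hw.intervalIntegrable_comp (hw.continuous_picard a x (k + 1)).measurable _ _)
        (hw.intervalIntegrable_comp (hw.continuous_picard a x k).measurable _ _)]
      simp only [picard]
      abel
    rw [e]
    have hMc : Continuous fun r => ∫ s in a..r, m s :=
      intervalIntegral.continuous_primitive (fun _ _ => hw.integrable.intervalIntegrable) a
    have h1 : ‖∫ r in a..max a t, (w r (picard w a x (k + 1) r) - w r (picard w a x k r))‖ ≤
        ∫ r in a..max a t,
          (∫ s, m s) * (1 / 2) ^ k * (m r * Real.exp (2 * ∫ s in a..r, m s)) := by
      refine intervalIntegral.norm_integral_le_of_norm_le (le_max_left _ _)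
        (Eventually.of_forall fun r hr => ?_) ?_
      · have h2 := ih r
        rw [max_eq_right hr.1.le] at h2
        calc _ ≤ m r * ‖picard w a x (k + 1) r - picard w a x k r‖ := hw.lip _ _ _
          _ ≤ m r * ((∫ s, m s) * (1 / 2) ^ k * Real.exp (2 * ∫ s in a..r, m s)) :=
            mul_le_mul_of_nonneg_left h2 (hw.nonneg r)
          _ = _ := by ring
      · refine (hw.integrable.intervalIntegrable.mul_continuousOn ?_).const_mul _
        fun_prop
    rw [intervalIntegral.integral_const_mul] at h1
    refine h1.trans ?_
    have h3 := integral_mul_exp_primitive_le hw.integrable hw.nonneg (le_max_left a t)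
    have h4 : 0 ≤ (∫ s, m s) * (1 / 2 : ℝ) ^ k := by positivity
    have h5 := mul_le_mul_of_nonneg_left h3 h4
    refine h5.trans ?_
    rw [pow_succ]
    nlinarith

lemma tendsto_picard (hw : IsCaratheodory w m) (a t : ℝ) (x : E) :
    Tendsto (fun k => picard w a x k t) atTop (𝓝 (carFlow w a t x)) := by
  refine CauchySeq.tendsto_limUnder ?_
  refine cauchySeq_of_le_geometric (1 / 2)
    ((∫ s, m s) * Real.exp (2 * ∫ s in a..max a t, m s)) (by norm_num) fun k => ?_
  rw [dist_comm, dist_eq_norm]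
  refine (hw.norm_picard_succ_sub_le a t x k).trans_eq (by ring)

lemma measurable_carFlow_time (hw : IsCaratheodory w m) (a : ℝ) (x : E) :
    Measurable fun t => carFlow w a t x :=
  measurable_of_tendsto_metrizable (fun k => (hw.continuous_picard a x k).measurable)
    (tendsto_pi_nhds.2 fun t => hw.tendsto_picard a t x)

lemma carFlow_eq_max (hw : IsCaratheodory w m) (a t : ℝ) (x : E) :
    carFlow w a t x = x + ∫ r in a..max a t, w r (carFlow w a r x) := by
  have h1 := (hw.tendsto_picard a t x).comp (tendsto_add_atTop_nat 1)
  refine tendsto_nhds_unique h1 ?_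
  refine Tendsto.const_add x ?_
  refine intervalIntegral.tendsto_integral_filter_of_dominated_convergence m
    (Eventually.of_forall fun k => ?_) (Eventually.of_forall fun k => ?_)
    hw.integrable.intervalIntegrable (Eventually.of_forall fun r _ => ?_)
  · exact (intervalIntegrable_iff.1 (hw.intervalIntegrable_comp
      (hw.continuous_picard a x k).measurable _ _)).aestronglyMeasurable
  · exact Eventually.of_forall fun r _ => hw.bound _ _
  · have hc : Continuous (w r) := by
      refine (LipschitzWith.of_dist_le_mul (K := ⟨m r, hw.nonneg r⟩) fun x y => ?_).continuous
      rw [dist_eq_norm, dist_eq_norm]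
      exact hw.lip r x y
    exact (hc.tendsto _).comp (hw.tendsto_picard a r x)

lemma carFlow_eq (hw : IsCaratheodory w m) {a t : ℝ} (hat : a ≤ t) (x : E) :
    carFlow w a t x = x + ∫ r in a..t, w r (carFlow w a r x) := by
  have := hw.carFlow_eq_max a t x
  rwa [max_eq_right hat] at this

lemma carFlow_self (hw : IsCaratheodory w m) (a : ℝ) (x : E) : carFlow w a a x = x := by
  rw [hw.carFlow_eq le_rfl]; simp

lemma continuous_carFlow_time (hw : IsCaratheodory w m) (a : ℝ) (x : E) :
    Continuous fun t => carFlow w a t x := by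
  have h := intervalIntegral.continuous_primitive
    (fun s t => hw.intervalIntegrable_comp (hw.measurable_carFlow_time a x) s t) a
  have h2 := (continuous_const (y := x)).add (h.comp ((continuous_const (y := a)).max continuous_id))
  refine h2.congr fun t => ?_
  exact (hw.carFlow_eq_max a t x).symm

/-- Two integral curves stay at a distance controlled by the distance of their initial values. -/
lemma norm_sub_le_of_eq (hw : IsCaratheodory w m) {a b : ℝ} {γ γ' : ℝ → E} {x x' : E}
    (hγ : ContinuousOn γ (Icc a b)) (hγ' : ContinuousOn γ' (Icc a b))
    (h : ∀ t ∈ Icc a b, γ t = x + ∫ r in a..t, w r (γ r))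
    (h' : ∀ t ∈ Icc a b, γ' t = x' + ∫ r in a..t, w r (γ' r)) {t : ℝ} (ht : t ∈ Icc a b) :
    ‖γ t - γ' t‖ ≤ 2 * ‖x - x'‖ * Real.exp (2 * ∫ s, m s) := by
  refine gronwall_integrable (u := fun t => ‖γ t - γ' t‖) hw.integrable hw.nonneg
    (hγ.sub hγ').norm (fun _ _ => norm_nonneg _) (norm_nonneg _) (fun s hs => ?_) ht
  have hsub : Icc a s ⊆ Icc a b := Icc_subset_Icc le_rfl hs.2
  have e : γ s - γ' s = (x - x') + ∫ r in a..s, (w r (γ r) - w r (γ' r)) := by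
    rw [h s hs, h' s hs, intervalIntegral.integral_sub
      (hw.intervalIntegrable_comp_of_continuousOn (hγ.mono hsub) hs.1)
      (hw.intervalIntegrable_comp_of_continuousOn (hγ'.mono hsub) hs.1)]
    abel
  rw [e]
  refine (norm_add_le _ _).trans ?_
  gcongr
  refine intervalIntegral.norm_integral_le_of_norm_le hs.1
    (Eventually.of_forall fun r hr => hw.lip _ _ _) ?_
  refine hw.integrable.intervalIntegrable.mul_continuousOn ?_
  rw [uIcc_of_le hs.1]
  exact ((hγ.sub hγ').norm).mono hsub

/-- Uniqueness is the stability estimate with equal initial values. -/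
lemma eq_carFlow (hw : IsCaratheodory w m) {a b : ℝ} {γ : ℝ → E} {x : E}
    (hγ : ContinuousOn γ (Icc a b))
    (h : ∀ t ∈ Icc a b, γ t = x + ∫ r in a..t, w r (γ r)) {t : ℝ} (ht : t ∈ Icc a b) :
    γ t = carFlow w a t x := by
  have := hw.norm_sub_le_of_eq hγ (hw.continuous_carFlow_time a x).continuousOn h
    (fun t ht => hw.carFlow_eq ht.1 x) ht
  rw [sub_self, norm_zero, mul_zero, zero_mul] at this
  exact sub_eq_zero.1 (norm_le_zero_iff.1 this)

lemma norm_carFlow_sub_le (hw : IsCaratheodory w m) {a t : ℝ} (hat : a ≤ t) (x x' : E) :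
    ‖carFlow w a t x - carFlow w a t x'‖ ≤ 2 * Real.exp (2 * ∫ s, m s) * ‖x - x'‖ := by
  refine (hw.norm_sub_le_of_eq (b := t) (hw.continuous_carFlow_time a x).continuousOn
    (hw.continuous_carFlow_time a x').continuousOn (fun t ht => hw.carFlow_eq ht.1 x)
    (fun t ht => hw.carFlow_eq ht.1 x') ⟨hat, le_rfl⟩).trans_eq (by ring)

lemma carFlow_carFlow (hw : IsCaratheodory w m) {a b c : ℝ} (hab : a ≤ b) (hbc : b ≤ c) (x : E) :
    carFlow w a c x = carFlow w b c (carFlow w a b x) := by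
  refine hw.eq_carFlow (b := c) (γ := fun t => carFlow w a t x)
    (hw.continuous_carFlow_time a x).continuousOn (fun t ht => ?_) ⟨hbc, le_rfl⟩
  have hi := hw.intervalIntegrable_comp (hw.measurable_carFlow_time a x)
  rw [hw.carFlow_eq (hab.trans ht.1), hw.carFlow_eq hab, add_assoc,
    intervalIntegral.integral_add_adjacent_intervals (hi _ _) (hi _ _)]

lemma norm_carFlow_sub_self_le (hw : IsCaratheodory w m) {a t : ℝ} (hat : a ≤ t) (x : E) :
    ‖carFlow w a t x - x‖ ≤ ∫ r in a..t, m r := by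
  rw [hw.carFlow_eq hat, add_sub_cancel_left]
  exact intervalIntegral.norm_integral_le_of_norm_le hat
        (Eventually.of_forall fun r _ => hw.bound r _) hw.integrable.intervalIntegrable

/-- Second order comparison of the flow with the field frozen at a nearby point. -/
lemma norm_carFlow_sub_integral_le (hw : IsCaratheodory w m) {a t : ℝ} (hat : a ≤ t) (x y : E) :
    ‖carFlow w a t y - y - ∫ r in a..t, w r x‖ ≤
      (∫ r in a..t, m r) * ((∫ r in a..t, m r) + ‖y - x‖) := by
  have hi := hw.intervalIntegrable_comp (hw.measurable_carFlow_time a y) a t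
  have hi' := hw.intervalIntegrable_comp (measurable_const (a := x)) a t
  have e : carFlow w a t y - y - ∫ r in a..t, w r x =
      ∫ r in a..t, (w r (carFlow w a r y) - w r x) := by
    rw [hw.carFlow_eq hat, intervalIntegral.integral_sub hi hi', add_sub_cancel_left]
  rw [e, ← intervalIntegral.integral_mul_const]
  refine intervalIntegral.norm_integral_le_of_norm_le hat
    (Eventually.of_forall fun r hr => ?_) (hw.integrable.intervalIntegrable.mul_const _)
  refine (hw.lip _ _ _).trans (mul_le_mul_of_nonneg_left ?_ (hw.nonneg r))
  have h1 := hw.norm_carFlow_sub_self_le hr.1.le y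
  have h2 : ∫ s in a..r, m s ≤ ∫ s in a..t, m s :=
    intervalIntegral.integral_mono_interval le_rfl hr.1.le hr.2
      (Eventually.of_forall hw.nonneg) hw.integrable.intervalIntegrable
  calc ‖carFlow w a r y - x‖ = ‖(carFlow w a r y - y) + (y - x)‖ := by congr 1; abel
    _ ≤ ‖carFlow w a r y - y‖ + ‖y - x‖ := norm_add_le _ _
    _ ≤ _ := by linarith

end IsCaratheodory

end Caratheodory

/-! ### Mollification of Lipschitz functions -/

section Mollify

variable {E : Type*} [NormedAddCommGroup E] [NormedSpace ℝ E] [FiniteDimensional ℝ E]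
  [HasContDiffBump E] [MeasurableSpace E] [BorelSpace E]

/-- Convolution with a normalized bump function. -/
def mollify (φ : ContDiffBump (0 : E)) (U : E → ℝ) (x : E) : ℝ :=
  ∫ z, φ.normed Measure.addHaar z * U (x - z) ∂(Measure.addHaar : Measure E)

variable {φ : ContDiffBump (0 : E)} {U : E → ℝ} {L : ℝ≥0}

lemma integrable_normed_mul (hU : Continuous U) (x : E) :
    Integrable (fun z => φ.normed Measure.addHaar z * U (x - z)) (Measure.addHaar : Measure E) := by
  refine Continuous.integrable_of_hasCompactSupport ?_ ?_
  · exact φ.continuous_normed.mul (hU.comp (continuous_const.sub continuous_id))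
  · exact φ.hasCompactSupport_normed.mul_right

/-- Averages of two functions against the same bump function are close if the functions are. -/
lemma abs_mollify_sub_le {U' : E → ℝ} (hU : Continuous U) (hU' : Continuous U') {x y : E} {δ : ℝ}
    (h : ∀ z, ‖z‖ ≤ φ.rOut → |U (x - z) - U' (y - z)| ≤ δ) :
    |mollify φ U x - mollify φ U' y| ≤ δ := by
  have e : mollify φ U x - mollify φ U' y =
      ∫ z, φ.normed Measure.addHaar z * (U (x - z) - U' (y - z)) ∂(Measure.addHaar : Measure E) := by
    rw [mollify, mollify, ← integral_sub (integrable_normed_mul hU x) (integrable_normed_mul hU' y)]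
    simp_rw [mul_sub]
  rw [e, ← Real.norm_eq_abs]
  refine (norm_integral_le_of_norm_le (g := fun z => φ.normed Measure.addHaar z * δ)
    (φ.integrable_normed.mul_const δ) (Eventually.of_forall fun z => ?_)).trans_eq ?_
  · rw [norm_mul, Real.norm_of_nonneg (φ.nonneg_normed z)]
    by_cases hz : ‖z‖ ≤ φ.rOut
    · exact mul_le_mul_of_nonneg_left (h z hz) (φ.nonneg_normed z)
    · have : φ.normed (Measure.addHaar : Measure E) z = 0 := by
        have h2 : z ∉ Function.support (φ.normed (Measure.addHaar : Measure E)) := by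
          rw [φ.support_normed_eq, mem_ball_zero_iff]
          exact fun h => hz h.le
        simpa using h2
      simp [this]
  · rw [integral_mul_const, φ.integral_normed, one_mul]

lemma abs_mollify_le (hU : Continuous U) (h1 : ∀ x, |U x| ≤ 1) (x : E) : |mollify φ U x| ≤ 1 := by
  have := abs_mollify_sub_le (φ := φ) (U := U) (U' := fun _ => 0) hU continuous_const (x := x)
    (y := x) (δ := 1) (fun z _ => by simpa using h1 (x - z))
  simpa [mollify] using this

lemma abs_mollify_sub_self_le (hU : LipschitzWith L U) (x : E) :
    |mollify φ U x - U x| ≤ L * φ.rOut := by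
  have := abs_mollify_sub_le (φ := φ) (U := U) (U' := fun _ => U x) hU.continuous continuous_const
    (x := x) (y := x) (δ := L * φ.rOut) (fun z hz => by
      have h := hU.dist_le_mul (x - z) x
      rw [Real.dist_eq, dist_eq_norm, sub_sub_cancel_left, norm_neg] at h
      exact h.trans (by gcongr))
  have e : mollify φ (fun _ => U x) x = U x := by
    rw [mollify, integral_mul_const, φ.integral_normed, one_mul]
  rwa [e] at this

lemma lipschitzWith_mollify (hU : LipschitzWith L U) : LipschitzWith L (mollify φ U) := by
  refine LipschitzWith.of_dist_le_mul fun x y => ?_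
  rw [Real.dist_eq]
  refine abs_mollify_sub_le hU.continuous hU.continuous fun z _ => ?_
  have := hU.dist_le_mul (x - z) (y - z)
  rwa [Real.dist_eq, dist_sub_right] at this

lemma contDiff_mollify (hU : Continuous U) : ContDiff ℝ 1 (mollify φ U) :=
  φ.hasCompactSupport_normed.contDiff_convolution_left (n := 1) (ContinuousLinearMap.lsmul ℝ ℝ)
    φ.contDiff_normed (hU.locallyIntegrable (μ := (Measure.addHaar : Measure E)))

/-- The derivative is put on the bump, so that U itself need not be differentiable and the Lipschitz
bound of U passes to the gradient. -/
lemma fderiv_mollify (hU : Continuous U) (x : E) :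
    fderiv ℝ (mollify φ U) x =
      ∫ z, U (x - z) • fderiv ℝ (φ.normed (Measure.addHaar : Measure E)) z ∂Measure.addHaar := by
  have h : HasFDerivAt (mollify φ U) _ x :=
    φ.hasCompactSupport_normed.hasFDerivAt_convolution_left
      (ContinuousLinearMap.lsmul ℝ ℝ) (φ.contDiff_normed (n := 1))
      (hU.locallyIntegrable (μ := (Measure.addHaar : Measure E))) x
  rw [h.fderiv]
  refine integral_congr_ae (Eventually.of_forall fun z => ?_)
  ext e
  simp [ContinuousLinearMap.precompL_apply, mul_comm]

lemma norm_integral_smul_sub_le {D : E → E →L[ℝ] ℝ} (hU : LipschitzWith L U) (hc : Continuous D)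
    (hs : HasCompactSupport D) (x y : E) :
    ‖(∫ z, U (x - z) • D z ∂(Measure.addHaar : Measure E)) - ∫ z, U (y - z) • D z ∂Measure.addHaar‖
      ≤ L * (∫ z, ‖D z‖ ∂(Measure.addHaar : Measure E)) * ‖x - y‖ := by
  have hi : ∀ x, Integrable (fun z => U (x - z) • D z) (Measure.addHaar : Measure E) :=
    fun x => Continuous.integrable_of_hasCompactSupport
      ((hU.continuous.comp (continuous_const.sub continuous_id)).smul hc)
      (hs.mono fun z hz hD => hz (by simp [hD]))
  rw [← integral_sub (hi x) (hi y)]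
  refine (norm_integral_le_of_norm_le (g := fun z => L * ‖x - y‖ * ‖D z‖)
    ((hc.integrable_of_hasCompactSupport hs).norm.const_mul _)
    (Eventually.of_forall fun z => ?_)).trans_eq ?_
  · rw [← sub_smul (U (x - z)) (U (y - z)) (D z), norm_smul]
    refine mul_le_mul_of_nonneg_right ?_ (norm_nonneg _)
    have := hU.dist_le_mul (x - z) (y - z)
    rwa [dist_sub_right, dist_eq_norm, dist_eq_norm] at this
  · rw [integral_const_mul]; ring

/-- The constant depends on the bump and is not controlled as the bump shrinks. This is harmless: it
will only multiply terms of second order in the time step, and the step tends to zero while the bump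
is fixed. -/
lemma norm_fderiv_mollify_sub_le (hU : LipschitzWith L U) (x y : E) :
    ‖fderiv ℝ (mollify φ U) x - fderiv ℝ (mollify φ U) y‖ ≤
      L * (∫ z, ‖fderiv ℝ (φ.normed (Measure.addHaar : Measure E)) z‖ ∂(Measure.addHaar : Measure E))
        * ‖x - y‖ := by
  have hc : Continuous (fderiv ℝ (φ.normed (Measure.addHaar : Measure E))) :=
    (φ.contDiff_normed (n := 1)).continuous_fderiv (by simp)
  have hs : HasCompactSupport (fderiv ℝ (φ.normed (Measure.addHaar : Measure E))) :=
    φ.hasCompactSupport_normed.fderiv ℝ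
  rw [fderiv_mollify hU.continuous, fderiv_mollify hU.continuous]
  exact norm_integral_smul_sub_le hU hc hs x y

lemma abs_taylor_le {f : E → ℝ} {K : ℝ} (hK : 0 ≤ K) (hf : Differentiable ℝ f)
    (h : ∀ x y, ‖fderiv ℝ f x - fderiv ℝ f y‖ ≤ K * ‖x - y‖) (x δ : E) :
    |f (x + δ) - f x - fderiv ℝ f x δ| ≤ K * ‖δ‖ ^ 2 := by
  have := (convex_closedBall x ‖δ‖).norm_image_sub_le_of_norm_fderiv_le' (f := f)
    (φ := fderiv ℝ f x) (C := K * ‖δ‖) (x := x) (y := x + δ) (fun z _ => hf z) (fun z hz => ?_)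
    (Metric.mem_closedBall_self (norm_nonneg _)) (by simp)
  · rw [add_sub_cancel_left, Real.norm_eq_abs] at this
    linarith [sq ‖δ‖]
  · refine (h z x).trans ?_
    rw [mem_closedBall_iff_norm] at hz
    gcongr

end Mollify

/-! ### Velocities for a single law of the pair -/

section Velocity

variable {E : Type*} [NormedAddCommGroup E] [NormedSpace ℝ E] [FiniteDimensional ℝ E]
  [MeasurableSpace E] [BorelSpace E]

/-- The field `v` gives, for almost every time, the conditional expectation of `x₁ - x₀` given
the position on the line, when the pair `(x₀, x₁)` has law `ρ`. -/
structure IsVelocity (ρ : Measure (E × E)) (v : ℝ → E → E) : Prop where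
  measurable : Measurable (Function.uncurry v)
  integrable : Integrable (fun p : E × E => p.2 - p.1) ρ
  setIntegral_eq : ∀ᵐ t ∂(volume.restrict (Icc (0 : ℝ) 1)),
    Integrable (fun p => v t (interp t p)) ρ ∧ ∀ A : Set E, MeasurableSet A →
      ∫ p in interp t ⁻¹' A, v t (interp t p) ∂ρ = ∫ p in interp t ⁻¹' A, (p.2 - p.1) ∂ρ

lemma continuous_interp_uncurry : Continuous fun q : ℝ × E × E => interp q.1 q.2 := by
  unfold interp; fun_prop

lemma continuous_interp (t : ℝ) : Continuous (interp t : E × E → E) := by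
  unfold interp; fun_prop

lemma hasDerivAt_interp (p : E × E) (t : ℝ) :
    HasDerivAt (fun s => interp s p) (p.2 - p.1) t := by
  have h1 : HasDerivAt (fun s : ℝ => (1 - s) • p.1) ((-1 : ℝ) • p.1) t :=
    ((hasDerivAt_id t).const_sub 1).smul_const p.1
  have h2 : HasDerivAt (fun s : ℝ => s • p.2) ((1 : ℝ) • p.2) t :=
    (hasDerivAt_id t).smul_const p.2
  refine (h1.add h2).congr_deriv ?_
  rw [neg_one_smul, one_smul]; abel

lemma interp_sub_interp (s t : ℝ) (p : E × E) :
    interp s p - interp t p = (s - t) • (p.2 - p.1) := by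
  unfold interp; module

namespace IsVelocity

variable {ρ : Measure (E × E)} [IsFiniteMeasure ρ] {v : ℝ → E → E}

lemma ae_eq_condExp (hv : IsVelocity ρ v) : ∀ᵐ t ∂(volume.restrict (Icc (0 : ℝ) 1)),
    (fun p => v t (interp t p)) =ᵐ[ρ] ρ[fun p => p.2 - p.1 | MeasurableSpace.comap (interp t)
      inferInstance] := by
  filter_upwards [hv.setIntegral_eq] with t ht
  have hm : MeasurableSpace.comap (interp t : E × E → E) inferInstance ≤
      (inferInstance : MeasurableSpace (E × E)) := (continuous_interp t).measurable.comap_le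
  refine ae_eq_condExp_of_forall_setIntegral_eq hm hv.integrable
    (fun s _ _ => ht.1.integrableOn) ?_ ?_
  · rintro s ⟨A, hA, rfl⟩ _
    exact ht.2 A hA
  · refine StronglyMeasurable.aestronglyMeasurable ?_
    refine Measurable.stronglyMeasurable ?_
    exact (hv.measurable.comp measurable_prodMk_left).comp (comap_measurable _)

/-- Conditional Jensen: a conditional expectation has no larger L¹ norm. The bound is uniform in
time and is the only integrability used about the velocity along the interpolation. -/
lemma integral_norm_le (hv : IsVelocity ρ v) : ∀ᵐ t ∂(volume.restrict (Icc (0 : ℝ) 1)),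
    Integrable (fun p => v t (interp t p)) ρ ∧
      ∫ p, ‖v t (interp t p)‖ ∂ρ ≤ ∫ p, ‖p.2 - p.1‖ ∂ρ := by
  filter_upwards [hv.setIntegral_eq, hv.ae_eq_condExp] with t ht h
  refine ⟨ht.1, ?_⟩
  rw [integral_congr_ae (h.mono fun p hp => congrArg norm hp)]
  exact integral_norm_condExp_le _

/-- Pull-out and tower property: a bounded covector depending only on the position on the line does
not distinguish the displacement from its conditional expectation. -/
lemma integral_clm_eq (hv : IsVelocity ρ v) : ∀ᵐ t ∂(volume.restrict (Icc (0 : ℝ) 1)),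
    ∀ g : E → E →L[ℝ] ℝ, Measurable g → ∀ C : ℝ, (∀ x, ‖g x‖ ≤ C) →
      ∫ p, g (interp t p) (p.2 - p.1) ∂ρ = ∫ p, g (interp t p) (v t (interp t p)) ∂ρ := by
  filter_upwards [hv.ae_eq_condExp] with t ht g hg C hC
  have hm : MeasurableSpace.comap (interp t : E × E → E) inferInstance ≤
      (inferInstance : MeasurableSpace (E × E)) := (continuous_interp t).measurable.comap_le
  have hgm : StronglyMeasurable[MeasurableSpace.comap (interp t : E × E → E) inferInstance]
      (fun p => g (interp t p)) := (hg.comp (comap_measurable _)).stronglyMeasurable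
  have h := condExp_bilin_of_stronglyMeasurable_left (μ := ρ)
    (ContinuousLinearMap.id ℝ (E →L[ℝ] ℝ)) (f := fun p => g (interp t p))
    (g := fun p : E × E => p.2 - p.1) hgm ?_ hv.integrable
  · rw [← integral_condExp hm]
    refine (integral_congr_ae h).trans ?_
    refine integral_congr_ae ?_
    filter_upwards [ht] with p hp
    simp only [hp, ContinuousLinearMap.id_apply]
  · refine Integrable.mono' (hv.integrable.norm.const_mul C) ?_ (Eventually.of_forall fun p => ?_)
    · have h1 : AEStronglyMeasurable (fun p => g (interp t p)) ρ := (hgm.mono hm).aestronglyMeasurable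
      exact (ContinuousLinearMap.id ℝ (E →L[ℝ] ℝ)).aestronglyMeasurable_comp₂ h1 hv.integrable.1
    · exact (ContinuousLinearMap.le_opNorm _ _).trans (by
        gcongr; exact hC _)

end IsVelocity

end Velocity

/-! ### The transport estimate with a cutoff -/

section Transport

variable {E : Type*} [NormedAddCommGroup E] [NormedSpace ℝ E] [FiniteDimensional ℝ E]
  [MeasurableSpace E] [BorelSpace E]
  {ρ : Measure (E × E)} [IsProbabilityMeasure ρ] {v w : ℝ → E → E} {m : ℝ → ℝ} {χ : E → ℝ} {c : ℝ}

lemma abs_mul_clm_sub_le {χ : E → ℝ} {D : E → E →L[ℝ] ℝ} {g : E → E} {c L K M : ℝ}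
    (hχ1 : ∀ x, |χ x| ≤ 1) (hχc : ∀ x y, |χ x - χ y| ≤ c * ‖x - y‖) (hL : ∀ x, ‖D x‖ ≤ L)
    (hK : ∀ x y, ‖D x - D y‖ ≤ K * ‖x - y‖) (hg : ∀ x, ‖g x‖ ≤ M)
    (hgl : ∀ x y, ‖g x - g y‖ ≤ M * ‖x - y‖) (x y : E) :
    |χ x * D x (g x) - χ y * D y (g y)| ≤ (c * L + K + L) * M * ‖x - y‖ := by
  have hL0 : 0 ≤ L := (norm_nonneg _).trans (hL x)
  have hM0 : 0 ≤ M := (norm_nonneg _).trans (hg x)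
  have e : χ x * D x (g x) - χ y * D y (g y) =
      (χ x - χ y) * D x (g x) + χ y * (D x - D y) (g x) + χ y * D y (g x - g y) := by
    simp only [sub_apply, map_sub]; ring
  have b1 : |(χ x - χ y) * D x (g x)| ≤ c * ‖x - y‖ * (L * M) := by
    rw [abs_mul]
    refine mul_le_mul (hχc x y) ?_ (abs_nonneg _) ((abs_nonneg _).trans (hχc x y))
    exact ((D x).le_opNorm _).trans (mul_le_mul (hL x) (hg x) (norm_nonneg _) hL0)
  have b2 : |χ y * (D x - D y) (g x)| ≤ 1 * (K * ‖x - y‖ * M) := by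
    rw [abs_mul]
    refine mul_le_mul (hχ1 y) ?_ (abs_nonneg _) zero_le_one
    exact ((D x - D y).le_opNorm _).trans
      (mul_le_mul (hK x y) (hg x) (norm_nonneg _) ((norm_nonneg _).trans (hK x y)))
  have b3 : |χ y * D y (g x - g y)| ≤ 1 * (L * (M * ‖x - y‖)) := by
    rw [abs_mul]
    refine mul_le_mul (hχ1 y) ?_ (abs_nonneg _) zero_le_one
    exact ((D y).le_opNorm _).trans (mul_le_mul (hL y) (hgl x y) (norm_nonneg _) hL0)
  rw [e]
  refine (abs_add_le _ _).trans ((add_le_add (abs_add_le _ _) le_rfl).trans ?_)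
  nlinarith

/-- Fundamental theorem of calculus along each straight line, then Fubini. The bound C ‖x₁ - x₀‖
gives the integrability, which is returned because the increment estimate splits the same integral
again. -/
lemma integral_comp_interp_sub_eq (hint : Integrable (fun p : E × E => p.2 - p.1) ρ) {f : E → ℝ}
    (hf : ContDiff ℝ 1 f) {C : ℝ} (hC : ∀ x, ‖fderiv ℝ f x‖ ≤ C) {a b : ℝ} (hab : a ≤ b) :
    Integrable (fun q : ℝ × E × E => fderiv ℝ f (interp q.1 q.2) (q.2.2 - q.2.1))
      ((volume.restrict (Ioc a b)).prod ρ) ∧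
    ∫ p, (f (interp b p) - f (interp a p)) ∂ρ =
      ∫ r in Ioc a b, ∫ p, fderiv ℝ f (interp r p) (p.2 - p.1) ∂ρ := by
  have hfd : Continuous (fderiv ℝ f) := hf.continuous_fderiv (by simp)
  have hcont : Continuous fun q : ℝ × E × E => fderiv ℝ f (interp q.1 q.2) (q.2.2 - q.2.1) :=
    (hfd.comp continuous_interp_uncurry).clm_apply (by fun_prop)
  have hI : Integrable (fun q : ℝ × E × E => fderiv ℝ f (interp q.1 q.2) (q.2.2 - q.2.1))
      ((volume.restrict (Ioc a b)).prod ρ) := by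
    refine Integrable.mono' (g := fun q => C * ‖q.2.2 - q.2.1‖)
      ((hint.norm.comp_snd _).const_mul C) ?_ (Eventually.of_forall fun q => ?_)
    · exact hcont.aestronglyMeasurable
    · exact (ContinuousLinearMap.le_opNorm _ _).trans (by gcongr; exact hC _)
  refine ⟨hI, ?_⟩
  have e1 : ∀ p : E × E, f (interp b p) - f (interp a p) =
      ∫ r in Ioc a b, fderiv ℝ f (interp r p) (p.2 - p.1) := by
    intro p
    rw [← intervalIntegral.integral_of_le hab]
    symm
    refine intervalIntegral.integral_eq_sub_of_hasDerivAt (f := fun r => f (interp r p))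
      (fun r _ => ?_) ?_
    · exact ((hf.differentiable (by simp)) _).hasFDerivAt.comp_hasDerivAt r (hasDerivAt_interp p r)
    · exact Continuous.intervalIntegrable
        (hcont.comp (Continuous.prodMk continuous_id continuous_const)) _ _
  simp_rw [e1]
  exact integral_integral_swap hI.swap

/-- Increment of the mean of `χ u` along the interpolation over a short time interval, when
`uₐ` is close to `u_b` transported by the field `w`. -/
lemma abs_increment_le (hv : IsVelocity ρ v) (hw : IsCaratheodory w m) (hχ : ContDiff ℝ 1 χ)
    (hχ1 : ∀ x, |χ x| ≤ 1) (hc : ∀ x, ‖fderiv ℝ χ x‖ ≤ c) {a b : ℝ} (h0 : 0 ≤ a) (hab : a ≤ b)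
    (hb1 : b ≤ 1)
    (hwv : ∀ᵐ t ∂(volume.restrict (Ioc a b)), ∀ x, χ x ≠ 0 → w t x = v t x)
    {ua ub : E → ℝ} {L K κ : ℝ} (hK0 : 0 ≤ K) (hua : Continuous ua) (hua1 : ∀ x, |ua x| ≤ 1)
    (hub : ContDiff ℝ 1 ub) (hub1 : ∀ x, |ub x| ≤ 1) (hL : ∀ x, ‖fderiv ℝ ub x‖ ≤ L)
    (hK : ∀ x y, ‖fderiv ℝ ub x - fderiv ℝ ub y‖ ≤ K * ‖x - y‖)
    (hκ : ∀ x, |ub x - ua x + fderiv ℝ ub x (∫ r in a..b, w r x)| ≤ κ) :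
    |∫ p, χ (interp b p) * ub (interp b p) ∂ρ - ∫ p, χ (interp a p) * ua (interp a p) ∂ρ| ≤
      c * (∫ p, ‖p.2 - p.1‖ ∂ρ) * (b - a) +
        (c * L + K + L) * (∫ p, ‖p.2 - p.1‖ ∂ρ) * (b - a) * (∫ r in a..b, m r) + κ := by
  set Y := ∫ p, ‖p.2 - p.1‖ ∂ρ with hY
  have hc0 : 0 ≤ c := (norm_nonneg _).trans (hc 0)
  have hL0 : 0 ≤ L := (norm_nonneg _).trans (hL 0)
  have hχc : ∀ x y, |χ x - χ y| ≤ c * ‖x - y‖ := fun x y =>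
    Convex.norm_image_sub_le_of_norm_fderiv_le (fun z _ => hχ.differentiable (by simp) z)
      (fun z _ => hc z) convex_univ (mem_univ y) (mem_univ x)
  have hDub : Continuous (fderiv ℝ ub) := hub.continuous_fderiv (by simp)
  set f : E → ℝ := fun x => χ x * ub x with hf
  have hfC : ContDiff ℝ 1 f := hχ.mul hub
  have hfd : ∀ x, fderiv ℝ f x = χ x • fderiv ℝ ub x + ub x • fderiv ℝ χ x := fun x =>
    fderiv_mul (hχ.differentiable (by simp) x) (hub.differentiable (by simp) x)
  have hfb : ∀ x, ‖fderiv ℝ f x‖ ≤ L + c := fun x => by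
    rw [hfd]
    refine (norm_add_le _ _).trans ?_
    rw [norm_smul, norm_smul]
    have h1 : ‖χ x‖ * ‖fderiv ℝ ub x‖ ≤ 1 * L :=
      mul_le_mul (hχ1 x) (hL x) (norm_nonneg _) zero_le_one
    have h2 : ‖ub x‖ * ‖fderiv ℝ χ x‖ ≤ 1 * c :=
      mul_le_mul (hub1 x) (hc x) (norm_nonneg _) zero_le_one
    linarith
  obtain ⟨hI1, hinc⟩ := integral_comp_interp_sub_eq hv.integrable hfC hfb hab
  set q : ℝ → E → ℝ := fun r x => χ x * fderiv ℝ ub x (w r x) with hq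
  have hqm : Measurable (Function.uncurry q) := by
    refine (hχ.continuous.measurable.comp measurable_snd).mul ?_
    refine StronglyMeasurable.measurable ?_
    have h1 : StronglyMeasurable fun z : ℝ × E => fderiv ℝ ub z.2 :=
      (hDub.comp continuous_snd).stronglyMeasurable
    exact (ContinuousLinearMap.id ℝ (E →L[ℝ] ℝ)).continuous₂.comp_stronglyMeasurable
      (h1.prodMk hw.measurable.stronglyMeasurable)
  have hqb : ∀ r x, |q r x| ≤ L * m r := fun r x => by
    simp only [hq]
    rw [abs_mul]
    calc |χ x| * |fderiv ℝ ub x (w r x)| ≤ 1 * (L * m r) := by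
          refine mul_le_mul (hχ1 x) ?_ (abs_nonneg _) zero_le_one
          exact ((fderiv ℝ ub x).le_opNorm _).trans
            (mul_le_mul (hL x) (hw.bound r x) (norm_nonneg _) hL0)
      _ = L * m r := one_mul _
  have hI2 : Integrable (fun z : ℝ × E × E => q z.1 (interp a z.2))
      ((volume.restrict (Ioc a b)).prod ρ) := by
    refine Integrable.mono' (g := fun z => L * m z.1)
      ((hw.integrable.integrableOn.comp_fst _).const_mul L) ?_ (Eventually.of_forall fun z => hqb _ _)
    exact (hqm.comp (measurable_fst.prodMk
      ((continuous_interp a).measurable.comp measurable_snd))).aestronglyMeasurable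
  have hbd : ∀ {g : E → ℝ} (t : ℝ), Continuous g → (∀ x, |g x| ≤ 1) →
      Integrable (fun p => χ (interp t p) * g (interp t p)) ρ := fun {g} t hg hg1 => by
    refine Integrable.mono' (g := fun _ => 1) (integrable_const 1) ?_ (Eventually.of_forall fun p => ?_)
    · exact ((hχ.continuous.mul hg).comp (continuous_interp t)).aestronglyMeasurable
    · rw [Real.norm_eq_abs, abs_mul]
      calc _ ≤ (1 : ℝ) * 1 := mul_le_mul (hχ1 _) (hg1 _) (abs_nonneg _) zero_le_one
        _ = 1 := one_mul 1
  have hwr : ∀ x, ∫ r in Ioc a b, q r x = χ x * fderiv ℝ ub x (∫ r in a..b, w r x) := fun x => by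
    simp only [hq]
    rw [integral_const_mul, intervalIntegral.integral_of_le hab,
      ContinuousLinearMap.integral_comp_comm]
    exact (hw.intervalIntegrable_comp (measurable_const (a := x)) a b).1
  have hI3 : Integrable (fun p => χ (interp a p) * fderiv ℝ ub (interp a p)
      (∫ r in a..b, w r (interp a p))) ρ := by
    refine hI2.integral_prod_right.congr (Eventually.of_forall fun p => hwr (interp a p))
  -- Add and subtract the transport term q, frozen at the position at time a. The time integral then
  -- compares the true increment of χ u_b with the frozen one, and the last integral is the
  -- transport defect bounded by κ.
  have hdec : (∫ p, χ (interp b p) * ub (interp b p) ∂ρ) - ∫ p, χ (interp a p) * ua (interp a p) ∂ρ =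
      (∫ r in Ioc a b, ((∫ p, fderiv ℝ f (interp r p) (p.2 - p.1) ∂ρ) - ∫ p, q r (interp a p) ∂ρ)) +
      ∫ p, χ (interp a p) * (ub (interp a p) - ua (interp a p) +
        fderiv ℝ ub (interp a p) (∫ r in a..b, w r (interp a p))) ∂ρ := by
    rw [integral_sub hI1.integral_prod_left hI2.integral_prod_left, ← hinc,
      integral_integral_swap hI2]
    simp_rw [hwr, mul_add, mul_sub]
    have i1 := hbd b hub.continuous hub1
    have i2 := hbd a hub.continuous hub1
    have i3 := hbd a hua hua1
    have i23 : Integrable (fun p => χ (interp a p) * ub (interp a p) -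
      χ (interp a p) * ua (interp a p)) ρ := i2.sub i3
    rw [integral_add i23 hI3, integral_sub i2 i3, integral_sub i1 i2]
    ring
  rw [hdec]
  refine (abs_add_le _ _).trans (add_le_add ?_ ?_)
  · rw [← Real.norm_eq_abs]
    have hsub : Ioc a b ⊆ Icc (0 : ℝ) 1 := fun r hr => ⟨h0.trans hr.1.le, hr.2.trans hb1⟩
    refine (norm_integral_le_of_norm_le (g := fun r => c * Y + (c * L + K + L) * Y * (b - a) * m r)
      ((integrable_const _).add ((hw.integrable.integrableOn).const_mul _)) ?_).trans_eq ?_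
    · filter_upwards [ae_restrict_of_ae_restrict_of_subset hsub hv.integral_clm_eq,
        ae_restrict_of_ae_restrict_of_subset hsub hv.integral_norm_le, hwv,
        ae_restrict_mem measurableSet_Ioc] with r hr1 hr2 hr3 hr4
      -- Here the displacement is replaced by v. By the product rule the gradient of χ leaves a term
      -- of size c ‖v‖, while the gradient of u_b gives q at the current position, whose distance to
      -- the frozen q is a Lipschitz error.
      rw [hr1 _ (hfC.continuous_fderiv (by simp)).measurable _ hfb]
      have j1 : Integrable (fun p => fderiv ℝ f (interp r p) (v r (interp r p))) ρ := by
        refine Integrable.mono' (hr2.1.norm.const_mul (L + c)) ?_ (Eventually.of_forall fun p => ?_)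
        · exact (ContinuousLinearMap.id ℝ (E →L[ℝ] ℝ)).aestronglyMeasurable_comp₂
            ((hfC.continuous_fderiv (by simp)).comp (continuous_interp r)).aestronglyMeasurable
            hr2.1.1
        · exact (ContinuousLinearMap.le_opNorm _ _).trans (by gcongr; exact hfb _)
      have j2 : Integrable (fun p => q r (interp a p)) ρ := by
        refine Integrable.mono' (integrable_const (L * m r)) ?_ (Eventually.of_forall fun p => hqb _ _)
        exact (hqm.comp (measurable_const.prodMk (continuous_interp a).measurable)).aestronglyMeasurable
      rw [← integral_sub j1 j2]
      have hmr := hw.nonneg r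
      refine (norm_integral_le_of_norm_le (g := fun p => c * ‖v r (interp r p)‖ +
        (c * L + K + L) * (b - a) * m r * ‖p.2 - p.1‖)
        ((hr2.1.norm.const_mul c).add (hv.integrable.norm.const_mul _))
        (Eventually.of_forall fun p => ?_)).trans ?_
      · have e1 : fderiv ℝ f (interp r p) (v r (interp r p)) - q r (interp a p) =
            ub (interp r p) * fderiv ℝ χ (interp r p) (v r (interp r p)) +
              (q r (interp r p) - q r (interp a p)) := by
          have e2 : q r (interp r p) =
              χ (interp r p) * fderiv ℝ ub (interp r p) (v r (interp r p)) := by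
            simp only [hq]
            -- The fields w and v need not agree where χ vanishes, but there both sides are zero.
            by_cases h : χ (interp r p) = 0
            · simp [h]
            · rw [hr3 _ h]
          rw [hfd, e2]
          simp only [add_apply, smul_apply, smul_eq_mul]
          ring
        rw [e1]
        refine (norm_add_le _ _).trans (add_le_add ?_ ?_)
        · rw [norm_mul]
          calc ‖ub (interp r p)‖ * ‖fderiv ℝ χ (interp r p) (v r (interp r p))‖
              ≤ 1 * (c * ‖v r (interp r p)‖) := by
                refine mul_le_mul (hub1 _) ?_ (norm_nonneg _) zero_le_one
                exact (ContinuousLinearMap.le_opNorm _ _).trans (by gcongr; exact hc _)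
            _ = _ := one_mul _
        · refine (abs_mul_clm_sub_le hχ1 hχc hL hK (hw.bound r) (hw.lip r) _ _).trans ?_
          rw [interp_sub_interp, norm_smul, Real.norm_of_nonneg (by linarith [hr4.1])]
          have : (r - a) * ‖p.2 - p.1‖ ≤ (b - a) * ‖p.2 - p.1‖ := by
            gcongr; exact hr4.2
          calc _ ≤ (c * L + K + L) * m r * ((b - a) * ‖p.2 - p.1‖) := by gcongr
            _ = _ := by ring
      · rw [integral_add (hr2.1.norm.const_mul c) (hv.integrable.norm.const_mul _),
          integral_const_mul, integral_const_mul]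
        have := mul_le_mul_of_nonneg_left hr2.2 hc0
        change _ ≤ c * Y + (c * L + K + L) * Y * (b - a) * m r
        nlinarith
    · rw [integral_add (integrable_const _) ((hw.integrable.integrableOn).const_mul _),
        integral_const, integral_const_mul, intervalIntegral.integral_of_le hab]
      rw [measureReal_restrict_apply_univ, Real.volume_real_Ioc_of_le hab, smul_eq_mul]
      ring
  · rw [← Real.norm_eq_abs]
    refine (norm_integral_le_of_norm_le (g := fun _ => κ) (integrable_const _)
      (Eventually.of_forall fun p => ?_)).trans_eq (by simp)
    rw [norm_mul]
    calc _ ≤ 1 * κ := mul_le_mul (hχ1 _) (hκ _) (abs_nonneg _) zero_le_one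
      _ = κ := one_mul κ

variable [HasContDiffBump E]

lemma continuous_integral_primitive (hw : IsCaratheodory w m) (a : ℝ) :
    Continuous fun t => ∫ r in a..t, m r :=
  intervalIntegral.continuous_primitive (fun _ _ => hw.integrable.intervalIntegrable) a

lemma lipschitzWith_comp_carFlow (hw : IsCaratheodory w m) {ψ : E → ℝ} {L : ℝ≥0}
    (hψ : LipschitzWith L ψ) {s T : ℝ} (hs : s ≤ T) :
    LipschitzWith (L * (2 * Real.exp (2 * ∫ s, m s)).toNNReal) fun x => ψ (carFlow w s T x) := by
  have : LipschitzWith (2 * Real.exp (2 * ∫ s, m s)).toNNReal (carFlow w s T) := by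
    refine LipschitzWith.of_dist_le_mul fun x y => ?_
    rw [dist_eq_norm, dist_eq_norm, Real.coe_toNNReal _ (by positivity)]
    exact hw.norm_carFlow_sub_le hs x y
  exact hψ.comp this

/-- The mean of `χ u_s` along the interpolation, for `u_s` a mollification of `ψ ∘ Φ_{s,T}`, is
almost conserved, up to an error from the gradient of the cutoff. -/
lemma abs_mollified_transport_le (hv : IsVelocity ρ v) (hw : IsCaratheodory w m)
    (hχ : ContDiff ℝ 1 χ) (hχ1 : ∀ x, |χ x| ≤ 1) (hc : ∀ x, ‖fderiv ℝ χ x‖ ≤ c) {T : ℝ}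
    (hT0 : 0 ≤ T) (hT1 : T ≤ 1)
    (hwv : ∀ᵐ t ∂(volume.restrict (Ioc 0 T)), ∀ x, χ x ≠ 0 → w t x = v t x)
    {ψ : E → ℝ} {L₀ L : ℝ≥0} (hψ : LipschitzWith L₀ ψ) (hψ1 : ∀ x, |ψ x| ≤ 1)
    (hLdef : L = L₀ * (2 * Real.exp (2 * ∫ s, m s)).toNNReal)
    (φ : ContDiffBump (0 : E)) {δ : ℝ} (hδ : 0 < δ) :
    |∫ p, χ (interp T p) * mollify φ (fun x => ψ (carFlow w T T x)) (interp T p) ∂ρ -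
      ∫ p, χ (interp 0 p) * mollify φ (fun x => ψ (carFlow w 0 T x)) (interp 0 p) ∂ρ| ≤
      c * (∫ p, ‖p.2 - p.1‖ ∂ρ) * T + (L * φ.rOut + δ) * ∫ r in (0 : ℝ)..T, m r := by
  set Y := ∫ p, ‖p.2 - p.1‖ ∂ρ with hY
  set M : ℝ → ℝ := fun t => ∫ r in (0 : ℝ)..t, m r with hM
  set U : ℝ → E → ℝ := fun s x => ψ (carFlow w s T x) with hU
  have hUL : ∀ s ≤ T, LipschitzWith L (U s) := fun s hs =>
    hLdef ▸ lipschitzWith_comp_carFlow hw hψ hs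
  have hU1 : ∀ s x, |U s x| ≤ 1 := fun s x => hψ1 _
  set K : ℝ := L * (∫ z, ‖fderiv ℝ (φ.normed (Measure.addHaar : Measure E)) z‖
    ∂(Measure.addHaar : Measure E)) with hK
  have hK0 : 0 ≤ K := by positivity
  set G : ℝ → ℝ := fun s => ∫ p, χ (interp s p) * mollify φ (U s) (interp s p) ∂ρ with hG
  have hMc : Continuous M := continuous_integral_primitive hw 0
  have hMadd : ∀ s t, M t - M s = ∫ r in s..t, m r := fun s t =>
    intervalIntegral.integral_interval_sub_left hw.integrable.intervalIntegrable
      hw.integrable.intervalIntegrable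
  have hMnn : ∀ s t, s ≤ t → 0 ≤ ∫ r in s..t, m r := fun s t hst =>
    intervalIntegral.integral_nonneg hst (fun u _ => hw.nonneg u)
  -- Only c Y (b - a) and L rOut ∫ m are of first order in the step. All other errors are products
  -- of two small increments and disappear when summed over fine subdivisions.
  have hstep : ∀ a ∈ Icc 0 T, ∀ b ∈ Icc 0 T, a ≤ b → |G b - G a| ≤
      c * Y * (b - a) + (c * L + K + L) * Y * (b - a) * (∫ r in a..b, m r) +
        ((L + K) * (∫ r in a..b, m r) + L * φ.rOut) * ∫ r in a..b, m r := by
    intro a ha b hb hab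
    refine abs_increment_le hv hw hχ hχ1 hc ha.1 hab (hb.2.trans hT1)
      (ae_restrict_of_ae_restrict_of_subset (Ioc_subset_Ioc ha.1 hb.2) hwv) hK0
      (lipschitzWith_mollify (hUL a ha.2)).continuous
      (abs_mollify_le (hUL a ha.2).continuous (hU1 a)) (contDiff_mollify (hUL b hb.2).continuous)
      (abs_mollify_le (hUL b hb.2).continuous (hU1 b))
      (fun x => norm_fderiv_le_of_lipschitz ℝ (lipschitzWith_mollify (hUL b hb.2)))
      (norm_fderiv_mollify_sub_le (hUL b hb.2)) fun x => ?_
    set d := ∫ r in a..b, w r x with hd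
    have hdn : ‖d‖ ≤ ∫ r in a..b, m r := intervalIntegral.norm_integral_le_of_norm_le hab
      (Eventually.of_forall fun r _ => hw.bound r x) hw.integrable.intervalIntegrable
    have h1 := abs_taylor_le hK0 ((contDiff_mollify (φ := φ) (hUL b hb.2).continuous).differentiable
      (by simp)) (norm_fderiv_mollify_sub_le (hUL b hb.2)) x d
    have h2 : |mollify φ (U b) (x + d) - mollify φ (U a) x| ≤
        L * ((∫ r in a..b, m r) * ((∫ r in a..b, m r) + φ.rOut)) := by
      refine abs_mollify_sub_le (hUL b hb.2).continuous (hUL a ha.2).continuous fun z hz => ?_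
      -- By the flow property u_a is u_b composed with the flow from a to b. That flow is close to
      -- the translation by d, uniformly over the points x - z met by the bump, so averaging against
      -- the bump compares u_a(x) with u_b(x + d).
      have e : U a (x - z) = U b (carFlow w a b (x - z)) := by
        simp only [hU]
        rw [hw.carFlow_carFlow hab hb.2]
      rw [e]
      have h3 := (hUL b hb.2).dist_le_mul (x + d - z) (carFlow w a b (x - z))
      rw [Real.dist_eq, dist_eq_norm] at h3
      refine h3.trans (mul_le_mul_of_nonneg_left ?_ L.2)
      have h4 := hw.norm_carFlow_sub_integral_le hab x (x - z)
      have e2 : ‖x + d - z - carFlow w a b (x - z)‖ = ‖carFlow w a b (x - z) - (x - z) - d‖ := by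
        rw [← norm_neg]; congr 1; abel
      rw [e2]
      refine h4.trans (mul_le_mul_of_nonneg_left ?_ (hMnn a b hab))
      rw [sub_sub_cancel_left, norm_neg]
      linarith
    have h5 : K * ‖d‖ ^ 2 ≤ K * (∫ r in a..b, m r) ^ 2 := by gcongr
    have e3 : mollify φ (U b) x - mollify φ (U a) x + fderiv ℝ (mollify φ (U b)) x d =
        (mollify φ (U b) (x + d) - mollify φ (U a) x) -
        (mollify φ (U b) (x + d) - mollify φ (U b) x - fderiv ℝ (mollify φ (U b)) x d) := by ring
    rw [e3]
    refine (abs_sub _ _).trans ?_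
    nlinarith
  -- The increment of this function bounds the factor in front of ∫ m in the second order terms. On
  -- short intervals it is below δ, which makes the whole estimate additive.
  have huc : UniformContinuousOn (fun s => (c * L + K + L) * Y * s + (L + K) * M s) (Icc 0 T) :=
    isCompact_Icc.uniformContinuousOn_of_continuous (by fun_prop)
  obtain ⟨h, hh, H⟩ := Metric.uniformContinuousOn_iff.1 huc δ hδ
  have hshort : ∀ a ∈ Icc 0 T, ∀ b ∈ Icc 0 T, a ≤ b → b - a < h → |G b - G a| ≤
      (c * Y * b + (L * φ.rOut + δ) * M b) - (c * Y * a + (L * φ.rOut + δ) * M a) := by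
    intro a ha b hb hab hlt
    refine (hstep a ha b hb hab).trans ?_
    have h1 := H b hb a ha (by rwa [Real.dist_eq, abs_of_nonneg (by linarith)])
    rw [Real.dist_eq] at h1
    have h2 := (le_abs_self _).trans h1.le
    have h3 := hMnn a b hab
    have h4 := hMadd a b
    rw [← h4] at h3 ⊢
    have h5 : ((c * L + K + L) * Y * (b - a) + (L + K) * (M b - M a)) * (M b - M a) ≤
        δ * (M b - M a) := by
      refine mul_le_mul_of_nonneg_right ?_ h3
      linarith
    nlinarith
  have r1 := sub_le_sub_of_forall_short (f := G)
    (g := fun t => c * Y * t + (L * φ.rOut + δ) * M t) hT0 hh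
    (fun s hs t ht hst hlt => (le_abs_self _).trans (hshort s hs t ht hst hlt))
  have r2 := sub_le_sub_of_forall_short (f := fun t => -G t)
    (g := fun t => c * Y * t + (L * φ.rOut + δ) * M t) hT0 hh
    (fun s hs t ht hst hlt => by
      have := (neg_le_abs _).trans (hshort s hs t ht hst hlt)
      linarith)
  have hM0 : M 0 = 0 := by simp [hM]
  rw [hM0] at r1 r2
  rw [abs_le]
  constructor
  · change _ ≤ G T - G 0
    linarith
  · change G T - G 0 ≤ _
    linarith

/-- Under the flow of a field that agrees with the conditional velocity on the support of a
cutoff, the law of the initial point is transported to that of the interpolation, up to an error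
controlled by the gradient of the cutoff. -/
theorem abs_transport_le (hv : IsVelocity ρ v) (hw : IsCaratheodory w m)
    (hχ : ContDiff ℝ 1 χ) (hχ1 : ∀ x, |χ x| ≤ 1) (hc : ∀ x, ‖fderiv ℝ χ x‖ ≤ c) {T : ℝ}
    (hT0 : 0 ≤ T) (hT1 : T ≤ 1)
    (hwv : ∀ᵐ t ∂(volume.restrict (Ioc 0 T)), ∀ x, χ x ≠ 0 → w t x = v t x)
    {ψ : E → ℝ} {L₀ : ℝ≥0} (hψ : LipschitzWith L₀ ψ) (hψ1 : ∀ x, |ψ x| ≤ 1) :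
    |∫ p, χ (interp T p) * ψ (interp T p) ∂ρ -
      ∫ p, χ (interp 0 p) * ψ (carFlow w 0 T (interp 0 p)) ∂ρ| ≤
      c * ∫ p, ‖p.2 - p.1‖ ∂ρ := by
  set Y := ∫ p, ‖p.2 - p.1‖ ∂ρ with hY
  have hY0 : 0 ≤ Y := integral_nonneg fun _ => norm_nonneg _
  have hc0 : 0 ≤ c := (norm_nonneg _).trans (hc 0)
  obtain ⟨L, hLdef⟩ : ∃ L, L = L₀ * (2 * Real.exp (2 * ∫ s, m s)).toNNReal := ⟨_, rfl⟩
  have hUL : ∀ s ≤ T, LipschitzWith L fun x => ψ (carFlow w s T x) := fun s hs =>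
    hLdef ▸ lipschitzWith_comp_carFlow hw hψ hs
  have hbd : ∀ {g : E → ℝ} (t : ℝ), Continuous g → (∀ x, |g x| ≤ 1) →
      Integrable (fun p => χ (interp t p) * g (interp t p)) ρ := fun {g} t hg hg1 => by
    refine Integrable.mono' (g := fun _ => 1) (integrable_const 1) ?_ (Eventually.of_forall fun p => ?_)
    · exact ((hχ.continuous.mul hg).comp (continuous_interp t)).aestronglyMeasurable
    · rw [Real.norm_eq_abs, abs_mul]
      calc _ ≤ (1 : ℝ) * 1 := mul_le_mul (hχ1 _) (hg1 _) (abs_nonneg _) zero_le_one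
        _ = 1 := one_mul 1
  have hmol : ∀ (φ : ContDiffBump (0 : E)), ∀ s ≤ T,
      |∫ p, χ (interp s p) * mollify φ (fun x => ψ (carFlow w s T x)) (interp s p) ∂ρ -
        ∫ p, χ (interp s p) * ψ (carFlow w s T (interp s p)) ∂ρ| ≤ L * φ.rOut := by
    intro φ s hs
    rw [← integral_sub (hbd s (lipschitzWith_mollify (hUL s hs)).continuous
      (abs_mollify_le (hUL s hs).continuous fun x => hψ1 _))
      (hbd s (hUL s hs).continuous fun x => hψ1 _), ← Real.norm_eq_abs]
    refine (norm_integral_le_of_norm_le (g := fun _ => L * φ.rOut) (integrable_const _)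
      (Eventually.of_forall fun p => ?_)).trans_eq (by simp)
    rw [← mul_sub, norm_mul]
    calc _ ≤ 1 * (L * φ.rOut) := mul_le_mul (hχ1 _) (abs_mollify_sub_self_le (hUL s hs) _)
          (abs_nonneg _) zero_le_one
      _ = _ := one_mul _
  have hM0 : 0 ≤ ∫ r in (0 : ℝ)..T, m r :=
    intervalIntegral.integral_nonneg hT0 (fun u _ => hw.nonneg u)
  -- Both the bump radius and δ are set to ε. Unmollifying at times 0 and T costs L ε each, and the
  -- flow from T to T is the identity.
  have key : ∀ ε > 0, |∫ p, χ (interp T p) * ψ (interp T p) ∂ρ -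
      ∫ p, χ (interp 0 p) * ψ (carFlow w 0 T (interp 0 p)) ∂ρ| ≤
      c * Y + ε * (2 * L + (L + 1) * ∫ r in (0 : ℝ)..T, m r) := by
    intro ε hε
    have h1 := abs_mollified_transport_le hv hw hχ hχ1 hc hT0 hT1 hwv hψ hψ1 hLdef
      ⟨ε / 2, ε, by linarith, by linarith⟩ hε
    have h2 := hmol ⟨ε / 2, ε, by linarith, by linarith⟩ T le_rfl
    have h3 := hmol ⟨ε / 2, ε, by linarith, by linarith⟩ 0 hT0
    have e : ∫ p, χ (interp T p) * ψ (carFlow w T T (interp T p)) ∂ρ =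
        ∫ p, χ (interp T p) * ψ (interp T p) ∂ρ := by
      simp_rw [hw.carFlow_self]
    rw [e] at h2
    have h4 : c * Y * T ≤ c * Y := mul_le_of_le_one_right (by positivity) hT1
    change _ ≤ L * ε at h2
    change _ ≤ L * ε at h3
    change _ ≤ c * Y * T + (L * ε + ε) * _ at h1
    rw [abs_le] at h1 h2 h3 ⊢
    constructor <;> nlinarith
  refine le_of_forall_pos_le_add fun η hη => ?_
  have hA : 0 ≤ 2 * L + (L + 1) * ∫ r in (0 : ℝ)..T, m r := by positivity
  refine (key (η / (2 * L + (L + 1) * (∫ r in (0 : ℝ)..T, m r) + 1)) (by positivity)).trans ?_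
  gcongr
  rw [div_mul_eq_mul_div, div_le_iff₀ (by positivity)]
  exact mul_le_mul_of_nonneg_left (by linarith) hη.le

end Transport

/-! ### Truncated fields and their flows -/

section Truncation

variable {E : Type*} [NormedAddCommGroup E] [NormedSpace ℝ E] [FiniteDimensional ℝ E]
  [HasContDiffBump E]

/-- A smooth cutoff equal to `1` on the ball of radius `R` and vanishing outside that of radius
`2 R`. -/
def cutoff (R : ℝ) (x : E) : ℝ :=
  (⟨1, 2, one_pos, one_lt_two⟩ : ContDiffBump (0 : E)) (R⁻¹ • x)

lemma contDiff_cutoff (R : ℝ) : ContDiff ℝ 1 (cutoff (E := E) R) :=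
  (ContDiffBump.contDiff _).comp (contDiff_const_smul _)

lemma cutoff_nonneg (R : ℝ) (x : E) : 0 ≤ cutoff R x := ContDiffBump.nonneg _

lemma cutoff_le_one (R : ℝ) (x : E) : cutoff R x ≤ 1 := ContDiffBump.le_one _

lemma abs_cutoff_le_one (R : ℝ) (x : E) : |cutoff R x| ≤ 1 := by
  rw [abs_of_nonneg (cutoff_nonneg R x)]; exact cutoff_le_one R x

lemma cutoff_eq_one {R : ℝ} (hR : 0 < R) {x : E} (hx : ‖x‖ ≤ R) : cutoff R x = 1 := by
  refine ContDiffBump.one_of_mem_closedBall _ ?_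
  rw [mem_closedBall_zero_iff, norm_smul, norm_inv, Real.norm_of_nonneg hR.le]
  rw [inv_mul_le_iff₀ hR]
  simpa using hx

lemma cutoff_eq_zero {R : ℝ} (hR : 0 < R) {x : E} (hx : 2 * R ≤ ‖x‖) : cutoff R x = 0 := by
  refine ContDiffBump.zero_of_le_dist _ ?_
  rw [dist_zero_right, norm_smul, norm_inv, Real.norm_of_nonneg hR.le]
  rw [le_inv_mul_iff₀ hR]
  linarith

/-- Scaling of one fixed bump. The decay in R is what makes the error of the transport estimate
vanish. -/
lemma exists_norm_fderiv_cutoff_le : ∃ c : ℝ, 0 ≤ c ∧ ∀ R > 0, ∀ x : E,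
    ‖fderiv ℝ (cutoff R) x‖ ≤ c / R := by
  set b : ContDiffBump (0 : E) := ⟨1, 2, one_pos, one_lt_two⟩ with hb
  obtain ⟨c, hc⟩ := (b.hasCompactSupport.fderiv ℝ).exists_bound_of_continuous
    ((b.contDiff (n := 1)).continuous_fderiv (by simp))
  refine ⟨c, (norm_nonneg _).trans (hc 0), fun R hR x => ?_⟩
  have h : fderiv ℝ (cutoff R) x = R⁻¹ • fderiv ℝ b (R⁻¹ • x) :=
    fderiv_comp_smul (f := b) (c := R⁻¹) (x := x)
  rw [h, norm_smul, norm_inv, Real.norm_of_nonneg hR.le, div_eq_inv_mul]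
  exact mul_le_mul_of_nonneg_left (hc _) (by positivity)

lemma tendsto_cutoff (x : E) : Tendsto (fun n : ℕ => cutoff ((n : ℝ) + 1) x) atTop (𝓝 1) := by
  refine tendsto_const_nhds.congr' ?_
  obtain ⟨N, hN⟩ := exists_nat_ge ‖x‖
  filter_upwards [eventually_ge_atTop N] with n hn
  have : (N : ℝ) ≤ n := by exact_mod_cast hn
  exact (cutoff_eq_one (by positivity) (by linarith)).symm

/-- Times increasing to `1`. -/
def truncTime (n : ℕ) : ℝ := 1 - 1 / ((n : ℝ) + 1)

lemma truncTime_nonneg (n : ℕ) : 0 ≤ truncTime n := by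
  have : 1 / ((n : ℝ) + 1) ≤ 1 := by
    rw [div_le_one (by positivity)]; linarith [Nat.cast_nonneg (α := ℝ) n]
  unfold truncTime; linarith

lemma truncTime_lt_one (n : ℕ) : truncTime n < 1 := by
  have : 0 < 1 / ((n : ℝ) + 1) := by positivity
  unfold truncTime; linarith

lemma truncTime_mono : Monotone truncTime := fun a b h => by
  unfold truncTime
  have : 1 / ((b : ℝ) + 1) ≤ 1 / ((a : ℝ) + 1) := by
    have : (a : ℝ) ≤ b := by exact_mod_cast h
    gcongr
  linarith

lemma tendsto_truncTime : Tendsto truncTime atTop (𝓝 1) := by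
  have := (tendsto_one_div_add_atTop_nhds_zero_nat (𝕜 := ℝ)).const_sub 1
  simpa only [sub_zero] using! this

/-- The field cut off outside a large ball and outside `(0, T)` for `T < 1`. -/
def truncField (v : ℝ → E → E) (n : ℕ) (t : ℝ) (x : E) : E :=
  (Ioo 0 (truncTime n)).indicator (fun s => cutoff (2 * ((n : ℝ) + 1)) x • v s x) t

lemma truncField_eq (v : ℝ → E → E) {n : ℕ} {t : ℝ} (ht : t ∈ Ioo 0 (truncTime n)) {x : E}
    (hx : ‖x‖ ≤ 2 * ((n : ℝ) + 1)) : truncField v n t x = v t x := by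
  rw [truncField, indicator_of_mem ht, cutoff_eq_one (by positivity) hx, one_smul]

/-- The flow, from time `0`, of the truncated field. -/
def truncFlow (v : ℝ → E → E) (n : ℕ) (t : ℝ) (x : E) : E := carFlow (truncField v n) 0 t x

/-- The flow line of the truncated field stays in the region where the spatial cutoff is inactive
up to time `s`. -/
def StaysIn (v : ℝ → E → E) (n : ℕ) (s : ℝ) (x : E) : Prop :=
  ∀ u ≤ s, ‖truncFlow v n u x‖ ≤ (n : ℝ) + 1

variable [MeasurableSpace E] [BorelSpace E] {v : ℝ → E → E}

/-- The local bounds hold only for almost every time, whereas a Carathéodory field needs them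
always. The field is therefore set to zero on a measurable null set of times, and the product rule
for cutoff times field gives the majorant (1 + c / R) m. -/
lemma exists_isCaratheodory (hv : Measurable (Function.uncurry v)) (hreg : IsLocallyRegular v)
    (n : ℕ) : ∃ w m, IsCaratheodory w m ∧ ∀ᵐ t, truncField v n t = w t := by
  -- The ball has radius 2 R with R = 2 (n + 1) because the cutoff of radius R vanishes only outside
  -- radius 2 R.
  obtain ⟨m, hm, hmv⟩ := hreg (truncTime n) (truncTime_lt_one n) (2 * (2 * ((n : ℝ) + 1)))
  obtain ⟨c, hc0, hc⟩ := exists_norm_fderiv_cutoff_le (E := E)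
  set R : ℝ := 2 * ((n : ℝ) + 1) with hR
  have hR0 : 0 < R := by positivity
  have hχ : ∀ x y : E, |cutoff R x - cutoff R y| ≤ c / R * ‖x - y‖ := fun x y =>
    Convex.norm_image_sub_le_of_norm_fderiv_le
      (fun z _ => (contDiff_cutoff R).differentiable (by simp) z)
      (fun z _ => hc R hR0 z) convex_univ (mem_univ y) (mem_univ x)
  rw [ae_restrict_iff' measurableSet_Ioo] at hmv
  set N : Set ℝ := toMeasurable volume {t | ¬ (t ∈ Ioo 0 (truncTime n) →
    (∀ x ∈ Metric.closedBall (0 : E) (2 * R), ‖v t x‖ ≤ m t) ∧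
      (∀ x ∈ Metric.closedBall (0 : E) (2 * R), ∀ y ∈ Metric.closedBall (0 : E) (2 * R),
        ‖v t x - v t y‖ ≤ m t * ‖x - y‖))} with hN
  have hN0 : volume N = 0 := by rw [hN, measure_toMeasurable]; exact hmv
  set S : Set ℝ := Ioo 0 (truncTime n) \ N with hS
  have hSm : MeasurableSet S := measurableSet_Ioo.diff (measurableSet_toMeasurable _ _)
  have hSP : ∀ t ∈ S, (∀ x ∈ Metric.closedBall (0 : E) (2 * R), ‖v t x‖ ≤ m t) ∧
      (∀ x ∈ Metric.closedBall (0 : E) (2 * R), ∀ y ∈ Metric.closedBall (0 : E) (2 * R),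
        ‖v t x - v t y‖ ≤ m t * ‖x - y‖) := fun t ht => by
    by_contra h
    exact ht.2 (subset_toMeasurable _ _ fun h' => h (h' ht.1))
  refine ⟨fun t x => S.indicator (fun s => cutoff R x • v s x) t,
    S.indicator fun t => (1 + c / R) * m t, ⟨?_, ?_, ?_, ?_⟩, ?_⟩
  · have h1 : Measurable fun q : ℝ × E => cutoff R q.2 • v q.1 q.2 :=
      ((contDiff_cutoff R).continuous.measurable.comp measurable_snd).smul hv
    exact h1.indicator (measurable_fst hSm)
  · rw [integrable_indicator_iff hSm]
    exact (hm.mono_set sdiff_subset).const_mul _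
  · intro t x
    by_cases ht : t ∈ S
    · simp only [indicator_of_mem ht]
      obtain ⟨h1, -⟩ := hSP t ht
      have hm0 : 0 ≤ m t := (norm_nonneg _).trans (h1 0 (Metric.mem_closedBall_self (by positivity)))
      rw [norm_smul]
      by_cases hx : ‖x‖ ≤ 2 * R
      · have h2 := h1 x (mem_closedBall_zero_iff.2 hx)
        have h3 : ‖cutoff R x‖ ≤ 1 := abs_cutoff_le_one R x
        have : 0 ≤ c / R * m t := by positivity
        nlinarith [norm_nonneg (v t x)]
      · rw [cutoff_eq_zero hR0 (le_of_not_ge hx), norm_zero, zero_mul]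
        positivity
    · simp [indicator_of_notMem ht]
  · intro t
    by_cases ht : t ∈ S
    swap
    · intro x y; simp [indicator_of_notMem ht]
    simp only [indicator_of_mem ht]
    obtain ⟨h1, h2⟩ := hSP t ht
    have hm0 : 0 ≤ m t := (norm_nonneg _).trans (h1 0 (Metric.mem_closedBall_self (by positivity)))
    -- It is enough that one point lies in the ball: if the other does not, its cutoff is zero and
    -- the Lipschitz bound of the cutoff suffices.
    have key : ∀ x y : E, ‖x‖ ≤ 2 * R →
        ‖cutoff R x • v t x - cutoff R y • v t y‖ ≤ (1 + c / R) * m t * ‖x - y‖ := by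
      intro x y hx
      have h3 := h1 x (mem_closedBall_zero_iff.2 hx)
      have h4 : ‖cutoff R x - cutoff R y‖ * ‖v t x‖ ≤ c / R * ‖x - y‖ * m t :=
        mul_le_mul (hχ x y) h3 (norm_nonneg _) (by positivity)
      by_cases hy : ‖y‖ ≤ 2 * R
      · have h5 : cutoff R x • v t x - cutoff R y • v t y =
            (cutoff R x - cutoff R y) • v t x + cutoff R y • (v t x - v t y) := by module
        rw [h5]
        refine (norm_add_le _ _).trans ?_
        rw [norm_smul, norm_smul]
        have h6 : ‖cutoff R y‖ * ‖v t x - v t y‖ ≤ 1 * (m t * ‖x - y‖) :=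
          mul_le_mul (abs_cutoff_le_one R y)
            (h2 x (mem_closedBall_zero_iff.2 hx) y (mem_closedBall_zero_iff.2 hy))
            (norm_nonneg _) zero_le_one
        linarith
      · have h5 : cutoff R y = 0 := cutoff_eq_zero hR0 (le_of_not_ge hy)
        have h6 : cutoff R x • v t x - cutoff R y • v t y = (cutoff R x - cutoff R y) • v t x := by
          rw [h5]; simp
        rw [h6, norm_smul]
        have : 0 ≤ m t * ‖x - y‖ := by positivity
        linarith
    intro x y
    by_cases hx : ‖x‖ ≤ 2 * R
    · exact key x y hx
    · by_cases hy : ‖y‖ ≤ 2 * R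
      · rw [norm_sub_rev, norm_sub_rev x y]
        exact key y x hy
      · rw [cutoff_eq_zero hR0 (le_of_not_ge hx), cutoff_eq_zero hR0 (le_of_not_ge hy)]
        simp only [zero_smul, sub_zero, norm_zero]
        positivity
  · have : ∀ᵐ t, t ∉ N := measure_eq_zero_iff_ae_notMem.1 hN0
    filter_upwards [this] with t ht
    funext x
    by_cases h : t ∈ Ioo 0 (truncTime n)
    · rw [truncField, indicator_of_mem h, indicator_of_mem (show t ∈ S from ⟨h, ht⟩)]
    · rw [truncField, indicator_of_notMem h, indicator_of_notMem (fun h' => h h'.1)]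

lemma truncFlow_eq_carFlow {n : ℕ} {w : ℝ → E → E} (h : ∀ᵐ t, truncField v n t = w t) :
    truncFlow v n = carFlow w 0 := by
  unfold truncFlow
  rw [carFlow_congr h]

lemma ae_mem_Ioo_of_mem_uIoc {T t : ℝ} (ht : t ∈ Icc 0 T) :
    ∀ᵐ r : ℝ, r ∈ uIoc 0 t → r ∈ Ioo 0 T := by
  have : ∀ᵐ r : ℝ, r ≠ T := by
    rw [ae_iff]; simp
  filter_upwards [this] with r hr hrt
  rw [uIoc_of_le ht.1] at hrt
  exact ⟨hrt.1, lt_of_le_of_ne (hrt.2.trans ht.2) hr⟩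

variable (hv : Measurable (Function.uncurry v)) (hreg : IsLocallyRegular v)
include hv hreg

lemma continuous_truncFlow_time (n : ℕ) (x : E) : Continuous fun t => truncFlow v n t x := by
  obtain ⟨w, m, hw, hae⟩ := exists_isCaratheodory hv hreg n
  rw [truncFlow_eq_carFlow hae]
  exact hw.continuous_carFlow_time 0 x

lemma continuous_truncFlow (n : ℕ) {t : ℝ} (ht : 0 ≤ t) : Continuous (truncFlow v n t) := by
  obtain ⟨w, m, hw, hae⟩ := exists_isCaratheodory hv hreg n
  rw [truncFlow_eq_carFlow hae]
  refine (LipschitzWith.of_dist_le_mul (K := (2 * Real.exp (2 * ∫ s, m s)).toNNReal)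
    fun x y => ?_).continuous
  rw [dist_eq_norm, dist_eq_norm, Real.coe_toNNReal _ (by positivity)]
  exact hw.norm_carFlow_sub_le ht x y

lemma truncFlow_of_nonpos (n : ℕ) {t : ℝ} (ht : t ≤ 0) (x : E) : truncFlow v n t x = x := by
  obtain ⟨w, m, hw, hae⟩ := exists_isCaratheodory hv hreg n
  rw [truncFlow_eq_carFlow hae, hw.carFlow_eq_max, max_eq_left ht]
  simp

lemma truncFlow_eq (n : ℕ) {t : ℝ} (ht : 0 ≤ t) (x : E) :
    truncFlow v n t x = x + ∫ r in (0 : ℝ)..t, truncField v n r (truncFlow v n r x) := by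
  obtain ⟨w, m, hw, hae⟩ := exists_isCaratheodory hv hreg n
  rw [truncFlow_eq_carFlow hae, hw.carFlow_eq ht]
  congr 1
  refine intervalIntegral.integral_congr_ae ?_
  filter_upwards [hae] with r hr _
  rw [hr]

lemma eq_truncFlow {n : ℕ} {b : ℝ} {γ : ℝ → E} {x : E} (hγ : ContinuousOn γ (Icc 0 b))
    (h : ∀ t ∈ Icc 0 b, γ t = x + ∫ r in (0 : ℝ)..t, truncField v n r (γ r)) {t : ℝ}
    (ht : t ∈ Icc 0 b) : γ t = truncFlow v n t x := by
  obtain ⟨w, m, hw, hae⟩ := exists_isCaratheodory hv hreg n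
  rw [truncFlow_eq_carFlow hae]
  refine hw.eq_carFlow hγ (fun s hs => ?_) ht
  rw [h s hs]
  congr 1
  refine intervalIntegral.integral_congr_ae ?_
  filter_upwards [hae] with r hr _
  rw [hr]

/-- A bounded integral curve of the field is a flow line of the truncated fields. -/
lemma eq_truncFlow_of_bounded {n : ℕ} {b : ℝ} (hb : b ≤ truncTime n) {γ : ℝ → E} {x : E}
    (hγ : ContinuousOn γ (Icc 0 b)) (hbd : ∀ t ∈ Icc 0 b, ‖γ t‖ ≤ 2 * ((n : ℝ) + 1))
    (h : ∀ t ∈ Icc 0 b, γ t = x + ∫ r in (0 : ℝ)..t, v r (γ r)) {t : ℝ}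
    (ht : t ∈ Icc 0 b) : γ t = truncFlow v n t x := by
  refine eq_truncFlow hv hreg hγ (fun s hs => ?_) ht
  rw [h s hs]
  congr 1
  refine intervalIntegral.integral_congr_ae ?_
  filter_upwards [ae_mem_Ioo_of_mem_uIoc hs] with r hr hr'
  have h1 := hr hr'
  rw [truncField_eq v ⟨h1.1, h1.2.trans_le hb⟩ (hbd r ⟨h1.1.le, h1.2.le⟩)]

lemma StaysIn.truncFlow_eq {n : ℕ} {s : ℝ} {x : E} (hs : s ≤ truncTime n)
    (h : StaysIn v n s x) {t : ℝ} (ht : t ∈ Icc 0 s) :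
    truncFlow v n t x = x + ∫ r in (0 : ℝ)..t, v r (truncFlow v n r x) := by
  rw [LatentCFM.truncFlow_eq hv hreg n ht.1]
  congr 1
  refine intervalIntegral.integral_congr_ae ?_
  filter_upwards [ae_mem_Ioo_of_mem_uIoc ht] with r hr hr'
  have h1 := hr hr'
  refine truncField_eq v ⟨h1.1, h1.2.trans_le hs⟩ ((h r h1.2.le).trans ?_)
  have : (0 : ℝ) ≤ n := Nat.cast_nonneg n
  linarith

/-- Until it leaves the ball, a truncated flow line solves the original equation, so uniqueness
identifies it with the flow lines of all larger truncations. The truncated flows thus glue to a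
maximal curve. -/
lemma StaysIn.truncFlow_eq_of_le {n N : ℕ} (hnN : n ≤ N) {s : ℝ} {x : E} (hs : s ≤ truncTime n)
    (h : StaysIn v n s x) {t : ℝ} (ht : t ≤ s) :
    truncFlow v N t x = truncFlow v n t x := by
  rcases le_or_gt t 0 with h0 | h0
  · rw [truncFlow_of_nonpos hv hreg N h0, truncFlow_of_nonpos hv hreg n h0]
  symm
  refine eq_truncFlow_of_bounded hv hreg (b := s) (γ := fun t => truncFlow v n t x)
    (hs.trans (truncTime_mono hnN)) (continuous_truncFlow_time hv hreg n x).continuousOn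
    (fun u hu => (h u hu.2).trans ?_) (fun u hu => h.truncFlow_eq hv hreg hs hu) ⟨h0.le, ht⟩
  have : (0 : ℝ) ≤ n := Nat.cast_nonneg n
  have : (n : ℝ) ≤ N := by exact_mod_cast hnN
  linarith

lemma StaysIn.mono {n N : ℕ} (hnN : n ≤ N) {s : ℝ} {x : E} (hs : s ≤ truncTime n)
    (h : StaysIn v n s x) : StaysIn v N s x := fun u hu => by
  rw [h.truncFlow_eq_of_le hv hreg hnN hs hu]
  refine (h u hu).trans ?_
  have : (n : ℝ) ≤ N := by exact_mod_cast hnN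
  linarith

end Truncation

/-! ### Curves of finite length: existence up to time 1 and uniqueness -/

section Pathwise

variable {E : Type*} [NormedAddCommGroup E] [NormedSpace ℝ E] [FiniteDimensional ℝ E]
  [HasContDiffBump E] [MeasurableSpace E] [BorelSpace E]

/-- Length of the part of the truncated flow line before it leaves the region where the cutoff is
inactive. -/
def truncLength (v : ℝ → E → E) (n : ℕ) (x : E) : ℝ≥0∞ :=
  ∫⁻ s in Ioo 0 (truncTime n),
    {s | StaysIn v n s x}.indicator (fun s => ‖v s (truncFlow v n s x)‖ₑ) s

/-- Total length of the maximal integral curve starting at `x`. -/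
def totalLength (v : ℝ → E → E) (x : E) : ℝ≥0∞ := ⨆ n, truncLength v n x

lemma eventually_le_truncTime {t : ℝ} (ht : t < 1) : ∀ᶠ n in atTop, t ≤ truncTime n :=
  (tendsto_truncTime.eventually_const_lt ht).mono fun _ h => h.le

variable {v : ℝ → E → E} (hv : Measurable (Function.uncurry v)) (hreg : IsLocallyRegular v)
include hv hreg

lemma monotone_truncLength (x : E) : Monotone fun n => truncLength v n x := by
  intro n N hnN
  refine (lintegral_mono' (Measure.restrict_mono
    (Ioo_subset_Ioo le_rfl (truncTime_mono hnN)) le_rfl) le_rfl).trans' ?_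
  refine setLIntegral_mono' measurableSet_Ioo fun s hs => ?_
  by_cases h : StaysIn v n s x
  · have h' := h.mono hv hreg hnN hs.2.le
    rw [indicator_of_mem (show s ∈ {s | StaysIn v n s x} from h),
      indicator_of_mem (show s ∈ {s | StaysIn v N s x} from h'),
      h.truncFlow_eq_of_le hv hreg hnN hs.2.le le_rfl]
  · rw [indicator_of_notMem (show s ∉ {s | StaysIn v n s x} from h)]
    exact bot_le

lemma StaysIn.truncField_eq {n : ℕ} {s t : ℝ} {x : E} (h : StaysIn v n s x)
    (ht : t ∈ Ioo 0 (truncTime n)) (hts : t ≤ s) :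
    truncField v n t (truncFlow v n t x) = v t (truncFlow v n t x) := by
  refine LatentCFM.truncField_eq v ht ((h t hts).trans ?_)
  have : (0 : ℝ) ≤ n := Nat.cast_nonneg n
  linarith

/-- A flow line whose length is smaller than the distance to the exit does not exit. -/
lemma staysIn_of_totalLength_lt {n : ℕ} {x : E} (hfin : totalLength v x ≠ ∞)
    (h : ‖x‖ + (totalLength v x).toReal < (n : ℝ) + 1) : StaysIn v n (truncTime n) x := by
  have hc := continuous_truncFlow_time hv hreg n x
  by_contra hcon
  unfold StaysIn at hcon
  push Not at hcon
  obtain ⟨u, hu, hun⟩ := hcon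
  have hx : ‖x‖ < (n : ℝ) + 1 := by linarith [ENNReal.toReal_nonneg (a := totalLength v x)]
  have hu0 : 0 ≤ u := by
    by_contra hneg
    rw [truncFlow_of_nonpos hv hreg n (le_of_not_ge hneg)] at hun
    linarith
  -- The least element of S is the first exit time. Before it the truncated field along the curve
  -- equals v, so the displacement up to exit is at most the total length, too short to reach radius
  -- n + 1.
  set S : Set ℝ := Icc 0 (truncTime n) ∩ {s | (n : ℝ) + 1 ≤ ‖truncFlow v n s x‖} with hS
  have hScomp : IsCompact S :=
    isCompact_Icc.inter_right (isClosed_le continuous_const hc.norm)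
  obtain ⟨t, ⟨ht, hexit⟩, hleast⟩ := hScomp.exists_isLeast ⟨u, ⟨hu0, hu⟩, hun.le⟩
  have hstay : ∀ s < t, StaysIn v n s x := by
    intro s hst r hrs
    by_contra hr
    push Not at hr
    have hr0 : 0 ≤ r := by
      by_contra hneg
      rw [truncFlow_of_nonpos hv hreg n (le_of_not_ge hneg)] at hr
      linarith
    have := hleast ⟨⟨hr0, (hrs.trans hst.le).trans ht.2⟩, hr.le⟩
    linarith
  have h1 : ‖∫ r in (0 : ℝ)..t, truncField v n r (truncFlow v n r x)‖ₑ ≤ totalLength v x := by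
    rw [intervalIntegral.integral_of_le ht.1, integral_Ioc_eq_integral_Ioo]
    refine (enorm_integral_le_lintegral_enorm _).trans ?_
    refine le_trans ?_ (le_iSup (fun n => truncLength v n x) n)
    refine (lintegral_mono' (Measure.restrict_mono
      (Ioo_subset_Ioo le_rfl ht.2) le_rfl) le_rfl).trans' ?_
    refine setLIntegral_mono' measurableSet_Ioo fun s hs => ?_
    have h := hstay s hs.2
    rw [indicator_of_mem (show s ∈ {s | StaysIn v n s x} from h),
      h.truncField_eq hv hreg ⟨hs.1, hs.2.trans_le ht.2⟩ le_rfl]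
  have h2 := truncFlow_eq hv hreg n ht.1 x
  have h3 : ‖∫ r in (0 : ℝ)..t, truncField v n r (truncFlow v n r x)‖ ≤
      (totalLength v x).toReal := by
    rw [← toReal_enorm]
    exact ENNReal.toReal_mono hfin h1
  have h4 := norm_add_le x (∫ r in (0 : ℝ)..t, truncField v n r (truncFlow v n r x))
  rw [← h2] at h4
  have h5 : (n : ℝ) + 1 ≤ ‖truncFlow v n t x‖ := hexit
  linarith

lemma eventually_staysIn {x : E} (hfin : totalLength v x ≠ ∞) :
    ∀ᶠ n in atTop, StaysIn v n (truncTime n) x := by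
  obtain ⟨N, hN⟩ := exists_nat_gt (‖x‖ + (totalLength v x).toReal)
  filter_upwards [eventually_ge_atTop N] with n hn
  refine staysIn_of_totalLength_lt hv hreg hfin ?_
  have : (N : ℝ) ≤ n := by exact_mod_cast hn
  linarith

/-- A solution coincides with the flow lines of all but finitely many truncated fields. -/
lemma IsSolution.eventually_eq_truncFlow {x : E} {γ : ℝ → E} (hγ : IsSolution v x γ) :
    ∀ᶠ n in atTop, ∀ t ∈ Icc 0 (truncTime n), γ t = truncFlow v n t x := by
  obtain ⟨hc, -, heq⟩ := hγ
  obtain ⟨C, hC⟩ := isCompact_Icc.exists_bound_of_continuousOn hc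
  obtain ⟨N, hN⟩ := exists_nat_ge C
  filter_upwards [eventually_ge_atTop N] with n hn t ht
  have hnN : (N : ℝ) ≤ n := by exact_mod_cast hn
  have hsub : Icc 0 (truncTime n) ⊆ Icc (0 : ℝ) 1 := Icc_subset_Icc le_rfl (truncTime_lt_one n).le
  have hn0 : (0 : ℝ) ≤ n := Nat.cast_nonneg n
  exact eq_truncFlow_of_bounded hv hreg le_rfl (hc.mono hsub)
    (fun s hs => (hC s (hsub hs)).trans (by linarith)) (fun s hs => heq s (hsub hs)) ht

/-- A solution is bounded by compactness, so before time 1 it is a flow line of a large truncation.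
Nothing is assumed about the field at time 1, where agreement comes from continuity. -/
lemma IsSolution.unique {x : E} {γ γ' : ℝ → E} (hγ : IsSolution v x γ) (hγ' : IsSolution v x γ') :
    EqOn γ γ' (Icc 0 1) := by
  have h : EqOn γ γ' (Ico 0 1) := fun t ht => by
    obtain ⟨n, h1, h2, h3⟩ := ((hγ.eventually_eq_truncFlow hv hreg).and
      ((hγ'.eventually_eq_truncFlow hv hreg).and (eventually_le_truncTime ht.2))).exists
    rw [h1 t ⟨ht.1, h3⟩, h2 t ⟨ht.1, h3⟩]
  refine h.of_subset_closure hγ.1 hγ'.1 Ico_subset_Icc_self ?_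
  rw [closure_Ico (by norm_num)]

/-- Finite length keeps the curve in a fixed ball and makes the velocity integrable up to time 1, so
its primitive extends the curve to the endpoint. -/
lemma exists_isSolution {x : E} (hfin : totalLength v x ≠ ∞) : ∃ γ, IsSolution v x γ := by
  obtain ⟨N, hN⟩ := eventually_atTop.1 (eventually_staysIn hv hreg hfin)
  set g : ℝ → E := fun t => limUnder atTop fun n => truncFlow v n t x with hg
  have hgn : ∀ n ≥ N, ∀ t ≤ truncTime n, g t = truncFlow v n t x := by
    intro n hn t ht
    refine Tendsto.limUnder_eq (tendsto_const_nhds.congr' ?_)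
    filter_upwards [eventually_ge_atTop n] with k hk
    exact ((hN n hn).truncFlow_eq_of_le hv hreg hk le_rfl ht).symm
  have hlt : ∀ t < 1, ∃ n ≥ N, t ≤ truncTime n := fun t ht => by
    obtain ⟨n, h1, h2⟩ := ((eventually_ge_atTop N).and (eventually_le_truncTime ht)).exists
    exact ⟨n, h1, h2⟩
  have hgm : AEMeasurable g (volume.restrict (Ioo (0 : ℝ) 1)) := by
    refine aemeasurable_of_tendsto_metrizable_ae atTop
      (fun n => (continuous_truncFlow_time hv hreg n x).measurable.aemeasurable) ?_
    filter_upwards [ae_restrict_mem measurableSet_Ioo] with t ht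
    obtain ⟨n, hn, htn⟩ := hlt t ht.2
    refine tendsto_const_nhds.congr' ?_
    filter_upwards [eventually_ge_atTop n] with k hk
    exact hgn k (hn.trans hk) t (htn.trans (truncTime_mono hk))
  have hU : (⋃ n, Ioo 0 (truncTime n)) = Ioo (0 : ℝ) 1 := by
    ext t
    simp only [mem_iUnion]
    constructor
    · rintro ⟨n, hn⟩
      exact ⟨hn.1, hn.2.trans (truncTime_lt_one n)⟩
    · intro ht
      obtain ⟨n, hn⟩ := (tendsto_truncTime.eventually_const_lt ht.2).exists
      exact ⟨n, ht.1, hn⟩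
  have hle : ∀ n ≥ N, ∫⁻ s in Ioo 0 (truncTime n), ‖v s (g s)‖ₑ ≤ totalLength v x := by
    intro n hn
    refine le_trans ?_ (le_iSup (fun n => truncLength v n x) n)
    refine setLIntegral_mono' measurableSet_Ioo fun s hs => ?_
    have h : StaysIn v n s x := fun u hu => hN n hn u (hu.trans hs.2.le)
    rw [indicator_of_mem (show s ∈ {s | StaysIn v n s x} from h), hgn n hn s hs.2.le]
  have hint : IntegrableOn (fun s => v s (g s)) (Ioo 0 1) := by
    refine ⟨(hv.comp_aemeasurable (aemeasurable_id.prodMk hgm)).aestronglyMeasurable, ?_⟩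
    unfold HasFiniteIntegral
    rw [← hU, setLIntegral_iUnion_of_directed _ (directed_of_isDirected_le fun a b hab =>
      Ioo_subset_Ioo le_rfl (truncTime_mono hab))]
    refine lt_of_le_of_lt (iSup_le fun n => ?_) (lt_top_iff_ne_top.2 hfin)
    refine le_trans ?_ (hle (max n N) (le_max_right _ _))
    exact lintegral_mono' (Measure.restrict_mono
      (Ioo_subset_Ioo le_rfl (truncTime_mono (le_max_left _ _))) le_rfl) le_rfl
  have hII : IntervalIntegrable (fun s => v s (g s)) volume 0 1 := by
    rwa [intervalIntegrable_iff_integrableOn_Ioo_of_le zero_le_one]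
  -- The glued curve g is controlled only for t < 1. The primitive agrees with it there and supplies
  -- the right value at 1.
  set γ : ℝ → E := fun t => x + ∫ s in (0 : ℝ)..t, v s (g s) with hγ
  have hγg : ∀ t ∈ Ico (0 : ℝ) 1, γ t = g t := by
    intro t ht
    obtain ⟨n, hn, htn⟩ := hlt t ht.2
    rw [hgn n hn t htn, (hN n hn).truncFlow_eq hv hreg le_rfl ⟨ht.1, htn⟩]
    simp only [hγ]
    congr 1
    refine intervalIntegral.integral_congr fun s hs => ?_
    rw [uIcc_of_le ht.1] at hs
    rw [hgn n hn s (hs.2.trans htn)]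
  have hae : ∀ t ∈ Icc (0 : ℝ) 1, ∀ᵐ s, s ∈ uIoc 0 t → v s (g s) = v s (γ s) := fun t ht => by
    filter_upwards [ae_mem_Ioo_of_mem_uIoc ht] with s hs hs'
    rw [hγg s ⟨(hs hs').1.le, (hs hs').2⟩]
  refine ⟨γ, ?_, ?_, fun t ht => ?_⟩
  · have := intervalIntegral.continuousOn_primitive_interval' hII left_mem_uIcc
    rw [uIcc_of_le zero_le_one] at this
    exact continuousOn_const.add this
  · refine hII.congr_ae ?_
    rw [EventuallyEq, ae_restrict_iff' measurableSet_uIoc]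
    exact hae 1 ⟨zero_le_one, le_rfl⟩
  · simp only [hγ]
    congr 1
    exact intervalIntegral.integral_congr_ae (hae t ht)

lemma isSolution_flow {x : E} (hfin : totalLength v x ≠ ∞) :
    IsSolution v x fun t => flow v t x := by
  have h := exists_isSolution hv hreg hfin
  simp only [flow, dif_pos h]
  exact h.choose_spec

lemma flowWellDefinedAt {x : E} (hfin : totalLength v x ≠ ∞) : FlowWellDefinedAt v x :=
  ⟨isSolution_flow hv hreg hfin, fun _ hγ _ ht =>
    hγ.unique hv hreg (isSolution_flow hv hreg hfin) ht⟩

/-- Times are capped at `truncTime n`, up to which the truncated flow line is the true one. This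
includes t = 1 and exhibits the flow, defined by choice, as a limit of continuous maps of the
starting point. -/
lemma tendsto_truncFlow {x : E} (hfin : totalLength v x ≠ ∞) {t : ℝ} (ht : t ∈ Icc (0 : ℝ) 1) :
    Tendsto (fun n => truncFlow v n (min t (truncTime n)) x) atTop (𝓝 (flow v t x)) := by
  have hs := isSolution_flow hv hreg hfin
  have h1 : Tendsto (fun n => min t (truncTime n)) atTop (𝓝[Icc 0 1] t) := by
    refine tendsto_nhdsWithin_iff.2 ⟨?_, Eventually.of_forall fun n =>
      ⟨le_min ht.1 (truncTime_nonneg n), (min_le_left _ _).trans ht.2⟩⟩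
    have := (tendsto_const_nhds (x := t)).min tendsto_truncTime
    rwa [min_eq_left ht.2] at this
  refine ((hs.1 t ht).tendsto.comp h1).congr' ?_
  filter_upwards [hs.eventually_eq_truncFlow hv hreg] with n hn
  exact hn _ ⟨le_min ht.1 (truncTime_nonneg n), min_le_right _ _⟩

end Pathwise

/-! ### Joint measurability in the parameter, the time and the starting point -/

section JointMeasurability

variable {S : Type*} [MeasurableSpace S] {E : Type*} [NormedAddCommGroup E] [NormedSpace ℝ E]
  [FiniteDimensional ℝ E] [HasContDiffBump E] [MeasurableSpace E] [BorelSpace E]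

lemma measurable_picard {w : S → ℝ → E → E}
    (hw : Measurable fun z : S × ℝ × E => w z.1 z.2.1 z.2.2) (k : ℕ) :
    Measurable fun z : S × ℝ × E => picard (w z.1) 0 z.2.2 k z.2.1 := by
  induction k with
  | zero => exact measurable_snd.comp measurable_snd
  | succ k ih =>
    simp only [picard]
    refine (measurable_snd.comp measurable_snd).add ?_
    -- The integral with a moving endpoint becomes an integral over the whole line of a jointly
    -- measurable indicator.
    have h1 : ∀ z : S × ℝ × E, ∫ r in (0 : ℝ)..max 0 z.2.1, w z.1 r (picard (w z.1) 0 z.2.2 k r) =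
        ∫ r, {q : (S × ℝ × E) × ℝ | 0 < q.2 ∧ q.2 ≤ max 0 q.1.2.1}.indicator
          (fun q => w q.1.1 q.2 (picard (w q.1.1) 0 q.1.2.2 k q.2)) (z, r) := by
      intro z
      rw [intervalIntegral.integral_of_le (le_max_left _ _), ← integral_indicator measurableSet_Ioc]
      rfl
    simp_rw [h1]
    refine StronglyMeasurable.measurable ?_
    refine StronglyMeasurable.integral_prod_right ?_
    refine Measurable.stronglyMeasurable ?_
    have h2 : Measurable fun q : (S × ℝ × E) × ℝ => picard (w q.1.1) 0 q.1.2.2 k q.2 :=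
      ih.comp ((measurable_fst.comp measurable_fst).prodMk
        (measurable_snd.prodMk (measurable_snd.comp (measurable_snd.comp measurable_fst))))
    refine Measurable.indicator ?_ ?_
    · exact hw.comp ((measurable_fst.comp measurable_fst).prodMk (measurable_snd.prodMk h2))
    · refine (measurableSet_lt measurable_const measurable_snd).inter
        (measurableSet_le measurable_snd ?_)
      exact measurable_const.max (measurable_fst.comp (measurable_snd.comp measurable_fst))

variable {v : S → ℝ → E → E} (hv : Measurable fun z : S × ℝ × E => v z.1 z.2.1 z.2.2)
include hv

lemma measurable_truncField_joint (n : ℕ) :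
    Measurable fun z : S × ℝ × E => truncField (v z.1) n z.2.1 z.2.2 := by
  have h1 : Measurable fun z : S × ℝ × E => cutoff (2 * ((n : ℝ) + 1)) z.2.2 • v z.1 z.2.1 z.2.2 :=
    ((contDiff_cutoff _).continuous.measurable.comp (measurable_snd.comp measurable_snd)).smul hv
  exact h1.indicator ((measurable_fst.comp measurable_snd) measurableSet_Ioo)

lemma measurable_uncurry_of_joint (f : S) : Measurable (Function.uncurry (v f)) :=
  hv.comp measurable_prodMk_left

variable (hreg : ∀ f, IsLocallyRegular (v f))
include hreg

lemma measurable_truncFlow_joint (n : ℕ) :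
    Measurable fun z : S × ℝ × E => truncFlow (v z.1) n z.2.1 z.2.2 := by
  refine measurable_of_tendsto_metrizable
    (measurable_picard (w := fun f => truncField (v f) n) (measurable_truncField_joint hv n))
    (tendsto_pi_nhds.2 fun z => ?_)
  obtain ⟨w, m, hw, hae⟩ := exists_isCaratheodory (measurable_uncurry_of_joint hv z.1) (hreg z.1) n
  rw [truncFlow_eq_carFlow hae]
  simp only [picard_congr hae]
  exact hw.tendsto_picard 0 z.2.1 z.2.2

/-- By continuity in time, the uncountably many constraints reduce to rational times capped at s. -/
lemma measurableSet_staysIn (n : ℕ) :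
    MeasurableSet {z : S × ℝ × E | StaysIn (v z.1) n z.2.1 z.2.2} := by
  have h : {z : S × ℝ × E | StaysIn (v z.1) n z.2.1 z.2.2} =
      ⋂ q : ℚ, {z : S × ℝ × E | ‖truncFlow (v z.1) n (min q z.2.1) z.2.2‖ ≤ (n : ℝ) + 1} := by
    ext z
    simp only [mem_ofPred_eq, mem_iInter]
    constructor
    · intro h q
      exact h _ (min_le_right _ _)
    · intro h u hu
      have hc := continuous_truncFlow_time (measurable_uncurry_of_joint hv z.1) (hreg z.1) n z.2.2
      have hcl : IsClosed {r : ℝ | ‖truncFlow (v z.1) n (min r z.2.1) z.2.2‖ ≤ (n : ℝ) + 1} :=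
        isClosed_le (hc.comp (continuous_id.min continuous_const)).norm continuous_const
      have hall : ∀ r : ℝ, ‖truncFlow (v z.1) n (min r z.2.1) z.2.2‖ ≤ (n : ℝ) + 1 := fun r =>
        Rat.denseRange_cast.induction_on r hcl h
      have := hall u
      rwa [min_eq_left hu] at this
  rw [h]
  refine MeasurableSet.iInter fun q => measurableSet_le (Measurable.norm ?_) measurable_const
  exact (measurable_truncFlow_joint hv hreg n).comp (measurable_fst.prodMk
    ((measurable_const.min (measurable_fst.comp measurable_snd)).prodMk
      (measurable_snd.comp measurable_snd)))

lemma measurable_truncLength_integrand (n : ℕ) : Measurable fun z : S × ℝ × E =>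
    {s | StaysIn (v z.1) n s z.2.2}.indicator
      (fun s => ‖v z.1 s (truncFlow (v z.1) n s z.2.2)‖ₑ) z.2.1 := by
  have h1 : Measurable fun z : S × ℝ × E => ‖v z.1 z.2.1 (truncFlow (v z.1) n z.2.1 z.2.2)‖ₑ :=
    (hv.comp (measurable_fst.prodMk ((measurable_fst.comp measurable_snd).prodMk
      (measurable_truncFlow_joint hv hreg n)))).enorm
  exact h1.indicator (measurableSet_staysIn hv hreg n)

lemma measurable_truncLength_joint (n : ℕ) :
    Measurable fun z : S × E => truncLength (v z.1) n z.2 := by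
  have h : Measurable fun q : (S × E) × ℝ => {s | StaysIn (v q.1.1) n s q.1.2}.indicator
      (fun s => ‖v q.1.1 s (truncFlow (v q.1.1) n s q.1.2)‖ₑ) q.2 :=
    (measurable_truncLength_integrand hv hreg n).comp
      (g := fun z : S × ℝ × E => {s | StaysIn (v z.1) n s z.2.2}.indicator
        (fun s => ‖v z.1 s (truncFlow (v z.1) n s z.2.2)‖ₑ) z.2.1)
      (f := fun q : (S × E) × ℝ => (q.1.1, q.2, q.1.2))
      ((measurable_fst.comp measurable_fst).prodMk
        (measurable_snd.prodMk (measurable_snd.comp measurable_fst)))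
  exact h.lintegral_prod_right'

lemma measurable_totalLength_joint :
    Measurable fun z : S × E => totalLength (v z.1) z.2 :=
  Measurable.iSup fun n => measurable_truncLength_joint hv hreg n

/-- The flow at a fixed time is jointly measurable in the parameter and the initial point, up to
initial points from which the flow line may have infinite length. -/
lemma aemeasurable_flow_joint {μ : Measure (S × E)}
    (hfin : ∀ᵐ z ∂μ, totalLength (v z.1) z.2 ≠ ∞) {t : ℝ} (ht : t ∈ Icc (0 : ℝ) 1) :
    AEMeasurable (fun z : S × E => flow (v z.1) t z.2) μ := by
  refine aemeasurable_of_tendsto_metrizable_ae atTop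
    (f := fun n z => truncFlow (v z.1) n (min t (truncTime n)) z.2) (fun n => ?_) ?_
  · exact ((measurable_truncFlow_joint hv hreg n).comp (measurable_fst.prodMk
      (measurable_const.prodMk measurable_snd))).aemeasurable
  · filter_upwards [hfin] with z hz
    exact tendsto_truncFlow (measurable_uncurry_of_joint hv z.1) (hreg z.1) hz ht

end JointMeasurability

/-! ### Measurability for a single field -/

section FixedField

variable {E : Type*} [NormedAddCommGroup E] [NormedSpace ℝ E]
  [FiniteDimensional ℝ E] [HasContDiffBump E] [MeasurableSpace E] [BorelSpace E]
  {v : ℝ → E → E} (hv : Measurable (Function.uncurry v)) (hreg : IsLocallyRegular v)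
include hv hreg

lemma measurable_const_param {S : Type*} [MeasurableSpace S] :
    Measurable fun z : S × ℝ × E => (fun _ : S => v) z.1 z.2.1 z.2.2 :=
  hv.comp (f := fun z : S × ℝ × E => z.2) measurable_snd

lemma measurable_totalLength : Measurable (totalLength v) := by
  have h := (measurable_totalLength_joint (v := fun _ : Unit => v)
    (measurable_const_param hv hreg) fun _ => hreg).comp (measurable_prodMk_left (x := ()))
  simpa only [Function.comp_def] using h

lemma measurable_truncLength (n : ℕ) : Measurable (truncLength v n) := by
  have h := (measurable_truncLength_joint (v := fun _ : Unit => v)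
    (measurable_const_param hv hreg) (fun _ => hreg) n).comp (measurable_prodMk_left (x := ()))
  simpa only [Function.comp_def] using h

lemma measurable_truncLength_integrand_uncurry (n : ℕ) : Measurable fun z : ℝ × E =>
    {s | StaysIn v n s z.2}.indicator (fun s => ‖v s (truncFlow v n s z.2)‖ₑ) z.1 := by
  have h := (measurable_truncLength_integrand (v := fun _ : Unit => v)
    (measurable_const_param hv hreg) (fun _ => hreg) n).comp (measurable_prodMk_left (x := ()))
  simpa only [Function.comp_def] using h

lemma measurableSet_staysIn_slice (n : ℕ) (s : ℝ) : MeasurableSet {x : E | StaysIn v n s x} :=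
  measurableSet_preimage (f := fun x : E => ((), s, x))
    (measurable_const.prodMk (measurable_const.prodMk measurable_id))
    (measurableSet_staysIn (v := fun _ : Unit => v) (measurable_const_param hv hreg (S := Unit)) (fun _ => hreg) n)

lemma aemeasurable_flow {μ : Measure E} (hfin : ∀ᵐ x ∂μ, totalLength v x ≠ ∞) {t : ℝ}
    (ht : t ∈ Icc (0 : ℝ) 1) : AEMeasurable (flow v t) μ := by
  refine aemeasurable_of_tendsto_metrizable_ae atTop
    (f := fun n x => truncFlow v n (min t (truncTime n)) x) (fun n => ?_) ?_
  · exact (continuous_truncFlow hv hreg n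
      (le_min ht.1 (truncTime_nonneg n))).measurable.aemeasurable
  · filter_upwards [hfin] with x hx
    exact tendsto_truncFlow hv hreg hx ht

end FixedField

/-! ### Comparing measures by Lipschitz test functions -/

section LipschitzTest

variable {X : Type*} [PseudoMetricSpace X] [MeasurableSpace X] [BorelSpace X]

/-- Two finite measures compare if their integrals of Lipschitz functions with values in `[0, 1]`
do. -/
lemma measure_le_of_forall_lipschitz {μ ν : Measure X} [IsFiniteMeasure μ] [IsFiniteMeasure ν]
    (h : ∀ (L : ℝ≥0) (ψ : X → ℝ), LipschitzWith L ψ → (∀ x, 0 ≤ ψ x) → (∀ x, ψ x ≤ 1) →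
      ∫ x, ψ x ∂μ ≤ ∫ x, ψ x ∂ν) : μ ≤ ν := by
  -- Thickened indicators of a closed set are Lipschitz and converge to its indicator. Inner
  -- regularity by closed sets then covers all Borel sets.
  have hclosed : ∀ F : Set X, IsClosed F → μ F ≤ ν F := by
    intro F hF
    have hδ : ∀ n : ℕ, (0 : ℝ) < 1 / ((n : ℝ) + 1) := fun n => by positivity
    have hlim := tendsto_one_div_add_atTop_nhds_zero_nat (𝕜 := ℝ)
    have h1 := tendsto_integral_thickenedIndicator_of_isClosed μ hF hδ hlim
    have h2 := tendsto_integral_thickenedIndicator_of_isClosed ν hF hδ hlim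
    have h3 : μ.real F ≤ ν.real F := by
      refine le_of_tendsto_of_tendsto' h1 h2 fun n => ?_
      refine h _ (fun x => (thickenedIndicator (hδ n) F x : ℝ))
        (isometry_subtype_coe.lipschitz.comp (lipschitzWith_thickenedIndicator (hδ n) F))
        (fun x => NNReal.coe_nonneg _) (fun x => ?_)
      exact_mod_cast thickenedIndicator_le_one (hδ n) F x
    exact (ENNReal.toReal_le_toReal (measure_ne_top _ _) (measure_ne_top _ _)).1 h3
  refine Measure.le_iff.2 fun A hA => ?_
  rw [hA.measure_eq_iSup_isClosed_of_ne_top (measure_ne_top μ A)]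
  exact iSup_le fun F => iSup_le fun hFA => iSup_le fun hF =>
    (hclosed F hF).trans (measure_mono hFA)

lemma measure_eq_of_forall_lipschitz {μ ν : Measure X} [IsFiniteMeasure μ] [IsFiniteMeasure ν]
    (h : ∀ (L : ℝ≥0) (ψ : X → ℝ), LipschitzWith L ψ → (∀ x, 0 ≤ ψ x) → (∀ x, ψ x ≤ 1) →
      ∫ x, ψ x ∂μ = ∫ x, ψ x ∂ν) : μ = ν :=
  le_antisymm (measure_le_of_forall_lipschitz fun L ψ h1 h2 h3 => (h L ψ h1 h2 h3).le)
    (measure_le_of_forall_lipschitz fun L ψ h1 h2 h3 => (h L ψ h1 h2 h3).ge)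

end LipschitzTest

/-! ### Non-explosion and the law of the flow -/

section Law

variable {E : Type*} [NormedAddCommGroup E] [NormedSpace ℝ E]
  [FiniteDimensional ℝ E] [HasContDiffBump E] [MeasurableSpace E] [BorelSpace E]
  {ρ : Measure (E × E)} [IsProbabilityMeasure ρ] {v : ℝ → E → E}

lemma interp_zero (p : E × E) : interp 0 p = p.1 := by simp [interp]

lemma interp_one (p : E × E) : interp 1 p = p.2 := by simp [interp]

/-- The flows of the truncated fields asymptotically transport the law of the initial point. -/
lemma exists_abs_truncFlow_transport_le (hvel : IsVelocity ρ v) (hreg : IsLocallyRegular v) :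
    ∃ C : ℝ, ∀ (n : ℕ), ∀ t ∈ Icc 0 (truncTime n), ∀ (L : ℝ≥0) (ψ : E → ℝ), LipschitzWith L ψ →
      (∀ x, |ψ x| ≤ 1) →
      |∫ p, cutoff ((n : ℝ) + 1) (interp t p) * ψ (interp t p) ∂ρ -
        ∫ p, cutoff ((n : ℝ) + 1) p.1 * ψ (truncFlow v n t p.1) ∂ρ| ≤ C / ((n : ℝ) + 1) := by
  obtain ⟨c, -, hc⟩ := exists_norm_fderiv_cutoff_le (E := E)
  refine ⟨c * ∫ p, ‖p.2 - p.1‖ ∂ρ, fun n t ht L ψ hψ hψ1 => ?_⟩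
  obtain ⟨w, m, hw, hae⟩ := exists_isCaratheodory hvel.measurable hreg n
  rw [truncFlow_eq_carFlow hae]
  have hR : (0 : ℝ) < (n : ℝ) + 1 := by positivity
  have h := abs_transport_le hvel hw (contDiff_cutoff ((n : ℝ) + 1))
    (abs_cutoff_le_one ((n : ℝ) + 1)) (hc _ hR) ht.1 (ht.2.trans (truncTime_lt_one n).le) ?_ hψ hψ1
  · simp_rw [interp_zero] at h
    rw [mul_div_right_comm]
    exact h
  · rw [ae_restrict_iff' measurableSet_Ioc]
    filter_upwards [hae, ae_mem_Ioo_of_mem_uIoc ht] with r hr hr' hr2 x hx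
    rw [uIoc_of_le ht.1] at hr'
    -- The test cutoff of radius n + 1 vanishes beyond 2 (n + 1), and the truncated field still
    -- equals v up to that radius.
    rw [← hr, truncField_eq v (hr' hr2)]
    by_contra hcon
    exact hx (cutoff_eq_zero hR (le_of_not_ge hcon))

lemma integrable_cutoff_mul {R : ℝ} {g g' : E × E → E} {ψ : E → ℝ} (hg : Measurable g)
    (hg' : Measurable g') (hψ : Measurable ψ) (hψ1 : ∀ x, |ψ x| ≤ 1) :
    Integrable (fun p => cutoff R (g p) * ψ (g' p)) ρ := by
  refine Integrable.mono' (integrable_const (1 : ℝ)) ?_ (Eventually.of_forall fun p => ?_)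
  · exact (((contDiff_cutoff R).continuous.measurable.comp hg).mul (hψ.comp hg')).aestronglyMeasurable
  · rw [Real.norm_eq_abs, abs_mul]
    calc _ ≤ (1 : ℝ) * 1 := mul_le_mul (abs_cutoff_le_one _ _) (hψ1 _) (abs_nonneg _) zero_le_one
      _ = 1 := one_mul 1

/-- Before leaving the region where the cutoff is inactive, the flow transports the law of the
initial point to a measure dominated by the law of the interpolation. -/
lemma map_truncFlow_restrict_le (hvel : IsVelocity ρ v) (hreg : IsLocallyRegular v) {n : ℕ} {s : ℝ}
    (hs : s ∈ Icc 0 (truncTime n)) :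
    ((ρ.map Prod.fst).restrict {x | StaysIn v n s x}).map (truncFlow v n s) ≤ ρ.map (interp s) := by
  have hv := hvel.measurable
  have hc := continuous_truncFlow hv hreg n hs.1
  have hm := measurableSet_staysIn_slice hv hreg n s
  have : IsProbabilityMeasure (ρ.map (interp s)) :=
    Measure.isProbabilityMeasure_map (continuous_interp s).measurable.aemeasurable
  have : IsProbabilityMeasure (ρ.map Prod.fst) :=
    Measure.isProbabilityMeasure_map measurable_fst.aemeasurable
  refine measure_le_of_forall_lipschitz fun L ψ hψ hψ0 hψ1 => ?_
  have hψabs : ∀ x, |ψ x| ≤ 1 := fun x => by rw [abs_of_nonneg (hψ0 x)]; exact hψ1 x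
  rw [integral_map hc.measurable.aemeasurable hψ.continuous.aestronglyMeasurable,
    integral_map (continuous_interp s).measurable.aemeasurable hψ.continuous.aestronglyMeasurable,
    ← integral_indicator hm]
  set g : E → ℝ := {x | StaysIn v n s x}.indicator fun x => ψ (truncFlow v n s x) with hg
  have hgm : Measurable g := (hψ.continuous.measurable.comp hc.measurable).indicator hm
  rw [integral_map measurable_fst.aemeasurable hgm.aestronglyMeasurable]
  obtain ⟨C, hC⟩ := exists_abs_truncFlow_transport_le hvel hreg
  have hg0 : ∀ x, 0 ≤ g x := fun x => indicator_nonneg (fun _ _ => hψ0 _) x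
  have hg1 : ∀ x, |g x| ≤ 1 := fun x => by
    rw [abs_of_nonneg (hg0 x)]
    exact indicator_le' (fun _ _ => hψ1 _) (fun _ _ => zero_le_one) x
  have hψint : Integrable (fun p => ψ (interp s p)) ρ := by
    refine Integrable.mono' (integrable_const (1 : ℝ)) ?_ (Eventually.of_forall fun p => hψabs _)
    exact (hψ.continuous.comp (continuous_interp s)).aestronglyMeasurable
  have hlim1 : Tendsto (fun N : ℕ => ∫ p, cutoff ((N : ℝ) + 1) p.1 * g p.1 ∂ρ) atTop
      (𝓝 (∫ p, g p.1 ∂ρ)) := by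
    refine tendsto_integral_of_dominated_convergence (fun _ => 1)
      (fun N => (integrable_cutoff_mul measurable_fst measurable_fst hgm hg1).1)
      (integrable_const 1) (fun N => Eventually.of_forall fun p => ?_)
      (Eventually.of_forall fun p => ?_)
    · rw [Real.norm_eq_abs, abs_mul]
      calc _ ≤ (1 : ℝ) * 1 := mul_le_mul (abs_cutoff_le_one _ _) (hg1 _) (abs_nonneg _) zero_le_one
        _ = 1 := one_mul 1
    · simpa using (tendsto_cutoff p.1).mul_const (g p.1)
  have hlim2 : Tendsto (fun N : ℕ => ∫ p, ψ (interp s p) ∂ρ + C / ((N : ℝ) + 1)) atTop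
      (𝓝 (∫ p, ψ (interp s p) ∂ρ)) := by
    have := (tendsto_one_div_add_atTop_nhds_zero_nat (𝕜 := ℝ)).const_mul C
    simp only [mul_one_div, mul_zero] at this
    simpa using this.const_add (∫ p, ψ (interp s p) ∂ρ)
  -- The stay event belongs to the fixed n, but on it the flows of all N ≥ n coincide. The transport
  -- estimate can thus be used with N → ∞, where both the cutoff and the error C / (N + 1)
  -- disappear.
  refine le_of_tendsto_of_tendsto hlim1 hlim2 ?_
  filter_upwards [eventually_ge_atTop n] with N hN
  have hsN : s ∈ Icc 0 (truncTime N) := ⟨hs.1, hs.2.trans (truncTime_mono hN)⟩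
  have h1 := (abs_le.1 (hC N s hsN L ψ hψ hψabs)).1
  have h2 : ∫ p, cutoff ((N : ℝ) + 1) p.1 * g p.1 ∂ρ ≤
      ∫ p, cutoff ((N : ℝ) + 1) p.1 * ψ (truncFlow v N s p.1) ∂ρ := by
    refine integral_mono (integrable_cutoff_mul measurable_fst measurable_fst hgm hg1)
      (integrable_cutoff_mul measurable_fst
        ((continuous_truncFlow hv hreg N hs.1).measurable.comp measurable_fst)
        hψ.continuous.measurable hψabs) fun p => ?_
    refine mul_le_mul_of_nonneg_left ?_ (cutoff_nonneg _ _)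
    simp only [hg]
    by_cases h : StaysIn v n s p.1
    · rw [indicator_of_mem (show p.1 ∈ {x | StaysIn v n s x} from h),
        h.truncFlow_eq_of_le hv hreg hN hs.2 le_rfl]
    · rw [indicator_of_notMem (show p.1 ∉ {x | StaysIn v n s x} from h)]
      exact hψ0 _
  have h3 : ∫ p, cutoff ((N : ℝ) + 1) (interp s p) * ψ (interp s p) ∂ρ ≤ ∫ p, ψ (interp s p) ∂ρ := by
    refine integral_mono (integrable_cutoff_mul (continuous_interp s).measurable
      (continuous_interp s).measurable hψ.continuous.measurable hψabs) hψint fun p => ?_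
    exact mul_le_of_le_one_left (hψ0 _) (cutoff_le_one _ _)
  linarith

/-- Almost every integral curve has finite length. -/
lemma ae_totalLength_ne_top (hvel : IsVelocity ρ v) (hreg : IsLocallyRegular v) :
    ∀ᵐ x ∂(ρ.map Prod.fst), totalLength v x ≠ ∞ := by
  have hv := hvel.measurable
  have : IsProbabilityMeasure (ρ.map Prod.fst) :=
    Measure.isProbabilityMeasure_map measurable_fst.aemeasurable
  set V : ℝ≥0∞ := ENNReal.ofReal (∫ p, ‖p.2 - p.1‖ ∂ρ) with hV
  -- By Tonelli the expected length is an integral over time. At each time, domination by the law of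
  -- the interpolation and the L¹ bound on the velocity give at most V, and the time interval has
  -- length at most 1.
  have hn : ∀ n, ∫⁻ x, truncLength v n x ∂(ρ.map Prod.fst) ≤ V := by
    intro n
    unfold truncLength
    have hmeas := measurable_truncLength_integrand_uncurry hv hreg n
    rw [lintegral_lintegral_swap (f := fun x s => {s | StaysIn v n s x}.indicator
      (fun s => ‖v s (truncFlow v n s x)‖ₑ) s) (hmeas.comp measurable_swap).aemeasurable]
    have hsub : Ioo 0 (truncTime n) ⊆ Icc (0 : ℝ) 1 := fun s hs =>
      ⟨hs.1.le, hs.2.le.trans (truncTime_lt_one n).le⟩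
    have hle : ∀ᵐ s ∂(volume.restrict (Ioo 0 (truncTime n))),
        ∫⁻ x, {s | StaysIn v n s x}.indicator (fun s => ‖v s (truncFlow v n s x)‖ₑ) s
          ∂(ρ.map Prod.fst) ≤ V := by
      filter_upwards [ae_restrict_of_ae_restrict_of_subset hsub hvel.integral_norm_le,
        ae_restrict_mem measurableSet_Ioo] with s hs hs'
      have hsI : s ∈ Icc 0 (truncTime n) := ⟨hs'.1.le, hs'.2.le⟩
      have hvs : Measurable (v s) := hv.comp measurable_prodMk_left
      have hm := measurableSet_staysIn_slice hv hreg n s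
      have e : ∀ x, {s | StaysIn v n s x}.indicator (fun s => ‖v s (truncFlow v n s x)‖ₑ) s =
          {x | StaysIn v n s x}.indicator (fun x => ‖v s (truncFlow v n s x)‖ₑ) x := fun x => rfl
      simp_rw [e]
      rw [lintegral_indicator hm, ← lintegral_map (f := fun y => ‖v s y‖ₑ) hvs.enorm
        (continuous_truncFlow hv hreg n hs'.1.le).measurable]
      refine (lintegral_mono' (map_truncFlow_restrict_le hvel hreg hsI) le_rfl).trans ?_
      rw [lintegral_map hvs.enorm (continuous_interp s).measurable,
        ← ofReal_integral_norm_eq_lintegral_enorm hs.1]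
      exact ENNReal.ofReal_le_ofReal hs.2
    refine (lintegral_mono_ae hle).trans ?_
    rw [setLIntegral_const, Real.volume_Ioo, sub_zero]
    refine mul_le_of_le_one_right' ?_
    rw [ENNReal.ofReal_le_one]
    exact (truncTime_lt_one n).le
  have hsup : ∫⁻ x, totalLength v x ∂(ρ.map Prod.fst) ≤ V := by
    unfold totalLength
    rw [lintegral_iSup (measurable_truncLength hv hreg)
      (fun a b hab x => monotone_truncLength hv hreg x hab)]
    exact iSup_le hn
  have := ae_lt_top (measurable_totalLength hv hreg)
    (ne_top_of_le_ne_top ENNReal.ofReal_ne_top hsup)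
  exact this.mono fun x hx => hx.ne

/-- The flow of the conditional velocity transports the law of the initial point along the laws of
the interpolation. -/
theorem map_flow_eq (hvel : IsVelocity ρ v) (hreg : IsLocallyRegular v) {t : ℝ}
    (ht : t ∈ Icc (0 : ℝ) 1) : (ρ.map Prod.fst).map (flow v t) = ρ.map (interp t) := by
  have hv := hvel.measurable
  have hfin := ae_totalLength_ne_top hvel hreg
  have hfm := aemeasurable_flow hv hreg hfin ht
  have : IsProbabilityMeasure (ρ.map (interp t)) :=
    Measure.isProbabilityMeasure_map (continuous_interp t).measurable.aemeasurable
  have : IsProbabilityMeasure (ρ.map Prod.fst) :=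
    Measure.isProbabilityMeasure_map measurable_fst.aemeasurable
  have : IsProbabilityMeasure ((ρ.map Prod.fst).map (flow v t)) :=
    Measure.isProbabilityMeasure_map hfm
  refine measure_eq_of_forall_lipschitz fun L ψ hψ hψ0 hψ1 => ?_
  have hψabs : ∀ x, |ψ x| ≤ 1 := fun x => by rw [abs_of_nonneg (hψ0 x)]; exact hψ1 x
  have hψflow : AEStronglyMeasurable (fun x => ψ (flow v t x)) (ρ.map Prod.fst) :=
    (hψ.continuous.measurable.comp_aemeasurable hfm).aestronglyMeasurable
  rw [integral_map hfm hψ.continuous.aestronglyMeasurable,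
    integral_map (continuous_interp t).measurable.aemeasurable hψ.continuous.aestronglyMeasurable,
    integral_map measurable_fst.aemeasurable hψflow]
  obtain ⟨C, hC⟩ := exists_abs_truncFlow_transport_le hvel hreg
  have htn : ∀ n, min t (truncTime n) ∈ Icc 0 (truncTime n) := fun n =>
    ⟨le_min ht.1 (truncTime_nonneg n), min_le_right _ _⟩
  have htlim : Tendsto (fun n => min t (truncTime n)) atTop (𝓝 t) := by
    have := (tendsto_const_nhds (x := t)).min tendsto_truncTime
    rwa [min_eq_left ht.2] at this
  have hbound : ∀ (n : ℕ) (x y : E), ‖cutoff ((n : ℝ) + 1) x * ψ y‖ ≤ 1 := fun n x y => by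
    rw [Real.norm_eq_abs, abs_mul]
    calc _ ≤ (1 : ℝ) * 1 := mul_le_mul (abs_cutoff_le_one _ _) (hψabs _) (abs_nonneg _) zero_le_one
      _ = 1 := one_mul 1
  have hlim1 : Tendsto (fun n : ℕ => ∫ p, cutoff ((n : ℝ) + 1) p.1 *
      ψ (truncFlow v n (min t (truncTime n)) p.1) ∂ρ) atTop (𝓝 (∫ p, ψ (flow v t p.1) ∂ρ)) := by
    refine tendsto_integral_of_dominated_convergence (fun _ => 1)
      (fun n => (integrable_cutoff_mul measurable_fst
        ((continuous_truncFlow hv hreg n (htn n).1).measurable.comp measurable_fst)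
        hψ.continuous.measurable hψabs).1)
      (integrable_const 1) (fun n => Eventually.of_forall fun p => hbound _ _ _) ?_
    filter_upwards [ae_of_ae_map measurable_fst.aemeasurable hfin] with p hp
    have := (tendsto_cutoff p.1).mul ((hψ.continuous.tendsto _).comp
      (tendsto_truncFlow hv hreg hp ht))
    simpa using this
  have hlim2 : Tendsto (fun n : ℕ => ∫ p, cutoff ((n : ℝ) + 1) (interp (min t (truncTime n)) p) *
      ψ (interp (min t (truncTime n)) p) ∂ρ) atTop (𝓝 (∫ p, ψ (interp t p) ∂ρ)) := by
    refine tendsto_integral_of_dominated_convergence (fun _ => 1)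
      (fun n => (integrable_cutoff_mul (continuous_interp _).measurable
        (continuous_interp _).measurable hψ.continuous.measurable hψabs).1)
      (integrable_const 1) (fun n => Eventually.of_forall fun p => hbound _ _ _)
      (Eventually.of_forall fun p => ?_)
    have hX : Tendsto (fun n => interp (min t (truncTime n)) p) atTop (𝓝 (interp t p)) :=
      ((continuous_interp_uncurry.comp (Continuous.prodMk_left p)).tendsto t).comp htlim
    -- The interpolated points converge, hence stay bounded, so the cutoff is eventually equal to 1
    -- although its argument moves with n.
    have h1 : Tendsto (fun n : ℕ => cutoff ((n : ℝ) + 1) (interp (min t (truncTime n)) p)) atTop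
        (𝓝 1) := by
      refine tendsto_const_nhds.congr' ?_
      obtain ⟨N, hN⟩ := exists_nat_gt ‖interp t p‖
      filter_upwards [eventually_ge_atTop N, hX.norm.eventually_lt_const hN] with n hn hn'
      have : (N : ℝ) ≤ n := by exact_mod_cast hn
      exact (cutoff_eq_one (by positivity) (by linarith)).symm
    simpa using h1.mul ((hψ.continuous.tendsto _).comp hX)
  have hlim3 : Tendsto (fun n : ℕ => C / ((n : ℝ) + 1)) atTop (𝓝 0) := by
    have := (tendsto_one_div_add_atTop_nhds_zero_nat (𝕜 := ℝ)).const_mul C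
    simpa only [mul_one_div, mul_zero] using this
  have h := le_of_tendsto_of_tendsto' (hlim2.sub hlim1).abs hlim3
    (fun n => hC n _ (htn n) L ψ hψ hψabs)
  exact (sub_eq_zero.1 (abs_nonpos_iff.1 h)).symm

end Law

/-! ### Conditional expectations on slices -/

section Slices

variable {S T W V : Type*} [MeasurableSpace S] [MeasurableSpace T] [MeasurableSpace W]
  [NormedAddCommGroup V] [NormedSpace ℝ V] [CompleteSpace V]

/-- A countable π-system that generates the σ-algebra. -/
def finInterGenerators (W : Type*) [MeasurableSpace W] [MeasurableSpace.CountablyGenerated W] :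
    Set (Set W) :=
  range fun s : Finset ℕ => ⋂ i ∈ s, MeasurableSpace.natGeneratingSequence W i

variable [MeasurableSpace.CountablyGenerated W]

lemma countable_finInterGenerators : (finInterGenerators W).Countable := countable_range _

lemma measurableSet_of_mem_finInterGenerators {A : Set W} (hA : A ∈ finInterGenerators W) :
    MeasurableSet A := by
  obtain ⟨s, rfl⟩ := hA
  exact Finset.measurableSet_biInter s fun i _ =>
    MeasurableSpace.measurableSet_natGeneratingSequence i

lemma isPiSystem_finInterGenerators : IsPiSystem (finInterGenerators W) := by
  classical
  rintro _ ⟨s, rfl⟩ _ ⟨t, rfl⟩ _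
  exact ⟨s ∪ t, Set.ext fun x => by
    simp only [mem_iInter, mem_inter_iff, Finset.mem_union, or_imp, forall_and]⟩

lemma generateFrom_finInterGenerators (W : Type*) [m : MeasurableSpace W]
    [MeasurableSpace.CountablyGenerated W] :
    m = MeasurableSpace.generateFrom (finInterGenerators W) := by
  refine le_antisymm ?_ (MeasurableSpace.generateFrom_le fun A hA =>
    measurableSet_of_mem_finInterGenerators hA)
  conv_lhs => rw [← MeasurableSpace.generateFrom_natGeneratingSequence W]
  refine MeasurableSpace.generateFrom_mono ?_
  rintro _ ⟨n, rfl⟩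
  exact ⟨{n}, by simp⟩

/-- Dynkin's argument. The empty intersection puts the whole space among the generators, and that
case gives closure under complements. -/
lemma setIntegral_eq_zero_of_finInterGenerators {μ : Measure T} {Z : T → V} (hZ : Integrable Z μ)
    {g : T → W} (hg : Measurable g)
    (h : ∀ A ∈ finInterGenerators W, ∫ ω in g ⁻¹' A, Z ω ∂μ = 0) (A : Set W)
    (hA : MeasurableSet A) : ∫ ω in g ⁻¹' A, Z ω ∂μ = 0 := by
  have huniv : ∫ ω, Z ω ∂μ = 0 := by
    simpa using h univ ⟨∅, by simp⟩
  induction A, hA using MeasurableSpace.induction_on_inter (generateFrom_finInterGenerators W)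
    isPiSystem_finInterGenerators with
  | empty => simp
  | basic A hA => exact h A hA
  | compl A hA ih =>
    have := integral_add_compl (hg hA) hZ
    rw [ih, zero_add, huniv] at this
    exact this
  | iUnion f hd hf ih =>
    rw [preimage_iUnion, integral_iUnion (fun i => hg (hf i))
      (fun i j hij => (hd hij).preimage g) hZ.integrableOn]
    simp [ih]

/-- If the conditional expectation of `Z` given the first variable and `g` vanishes, then on almost
every slice the conditional expectation of `Z` given `g` vanishes. -/
lemma ae_setIntegral_slice_eq_zero {ν : Measure S} [IsFiniteMeasure ν] {κ : Kernel S T}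
    [IsFiniteKernel κ] {Z : S × T → V} (hZ : Integrable Z (ν ⊗ₘ κ)) {g : S × T → W}
    (hg : Measurable g)
    (h : ∀ B : Set (S × W), MeasurableSet B →
      ∫ p in (fun p => (p.1, g p)) ⁻¹' B, Z p ∂(ν ⊗ₘ κ) = 0) :
    ∀ᵐ s ∂ν, Integrable (fun ω => Z (s, ω)) (κ s) ∧
      ∀ A : Set W, MeasurableSet A → ∫ ω in (fun ω => g (s, ω)) ⁻¹' A, Z (s, ω) ∂κ s = 0 := by
  have h1 := ((Measure.integrable_compProd_iff hZ.1).1 hZ).1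
  -- For a fixed A, the rectangles U × A show that the slice integral has zero mean over every U, so
  -- it vanishes almost everywhere. Countably many generators give a common null set.
  have key : ∀ A ∈ finInterGenerators W, ∀ᵐ s ∂ν,
      ∫ ω in (fun ω => g (s, ω)) ⁻¹' A, Z (s, ω) ∂κ s = 0 := by
    intro A hA
    have hA' := measurableSet_of_mem_finInterGenerators hA
    have hD : MeasurableSet (g ⁻¹' A) := hg hA'
    have hI : Integrable ((g ⁻¹' A).indicator Z) (ν ⊗ₘ κ) := hZ.indicator hD
    have hI2 : Integrable (fun s => ∫ ω, (g ⁻¹' A).indicator Z (s, ω) ∂κ s) ν := by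
      simpa only [Kernel.prodMkLeft_apply, Kernel.const_apply] using
        Integrable.integral_compProd (κ := Kernel.const Unit ν) (η := Kernel.prodMkLeft Unit κ)
          (a := ()) hI
    have h0 : ∀ᵐ s ∂ν, ∫ ω, (g ⁻¹' A).indicator Z (s, ω) ∂κ s = 0 := by
      refine hI2.ae_eq_zero_of_forall_setIntegral_eq_zero fun U hU _ => ?_
      have e := Measure.setIntegral_compProd (μ := ν) (κ := κ) hU MeasurableSet.univ
        (f := (g ⁻¹' A).indicator Z) hI.integrableOn
      simp only [Measure.restrict_univ] at e
      rw [← e, setIntegral_indicator hD, ← h (U ×ˢ A) (hU.prod hA')]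
      congr 2
      ext p; simp
    filter_upwards [h0] with s hs
    have hgs : Measurable fun ω => g (s, ω) := hg.comp measurable_prodMk_left
    rw [← integral_indicator (hgs hA'), ← hs]
    rfl
  filter_upwards [h1, (ae_ball_iff countable_finInterGenerators).2 key] with s hs1 hs2
  exact ⟨hs1, setIntegral_eq_zero_of_finInterGenerators hs1 (hg.comp measurable_prodMk_left) hs2⟩

end Slices

/-! ### From the conditional velocity to almost every latent value -/

section ConditionalVelocity

variable {Ω : Type*} [MeasurableSpace Ω] {P : Measure Ω} [IsProbabilityMeasure P] {d k : ℕ}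
  {X₀ X₁ : Ω → EuclideanSpace ℝ (Fin d)} {F : Ω → EuclideanSpace ℝ (Fin k)}

/-- Lebesgue measure on the unit interval. -/
abbrev unitTime : Measure ℝ := volume.restrict (Icc (0 : ℝ) 1)

/-- The joint law of `((F, t), (X₀, X₁))` with `t` uniform on the unit interval. -/
lemma map_latent_time_pair (hX₀ : Measurable X₀) (hX₁ : Measurable X₁) (hF : Measurable F) :
    (P.prod unitTime).map (fun z => ((F z.1, z.2), (X₀ z.1, X₁ z.1))) =
      ((P.map F).prod unitTime) ⊗ₘ
        Kernel.prodMkRight ℝ (condDistrib (fun ω => (X₀ ω, X₁ ω)) F P) := by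
  refine Measure.ext_of_lintegral _ fun g hg => ?_
  rw [lintegral_map hg (by fun_prop), Measure.lintegral_compProd hg,
    lintegral_prod_symm _ (by fun_prop),
    lintegral_prod_symm _ (Measurable.lintegral_kernel_prod_right' hg).aemeasurable]
  refine lintegral_congr fun t => ?_
  simp only [Kernel.prodMkRight_apply]
  rw [← Measure.lintegral_compProd (μ := P.map F)
    (κ := condDistrib (fun ω => (X₀ ω, X₁ ω)) F P) (f := fun q => g ((q.1, t), q.2)) (by fun_prop),
    compProd_map_condDistrib (by fun_prop), lintegral_map (by fun_prop) (by fun_prop)]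

lemma Field.IsMeasurable.comp {v : Field d k} (hv : v.IsMeasurable) {S : Type*} [MeasurableSpace S]
    {a : S → ℝ} {b : S → EuclideanSpace ℝ (Fin k)} {c : S → EuclideanSpace ℝ (Fin d)}
    (ha : Measurable a) (hb : Measurable b) (hc : Measurable c) :
    Measurable fun s => v (a s) (b s) (c s) :=
  Measurable.comp (g := fun p : ℝ × EuclideanSpace ℝ (Fin k) × EuclideanSpace ℝ (Fin d) =>
    v p.1 p.2.1 p.2.2) hv (ha.prodMk (hb.prodMk hc))

lemma measurable_interp_comp {S : Type*} [MeasurableSpace S] {a : S → ℝ}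
    {b c : S → EuclideanSpace ℝ (Fin d)} (ha : Measurable a) (hb : Measurable b)
    (hc : Measurable c) : Measurable fun s => interp (a s) (b s, c s) :=
  continuous_interp_uncurry.measurable.comp (ha.prodMk (hb.prodMk hc))

/-- The difference between a field along the interpolation and the displacement. -/
def residual (X₀ X₁ : Ω → EuclideanSpace ℝ (Fin d)) (F : Ω → EuclideanSpace ℝ (Fin k))
    (v : Field d k) (t : ℝ) (ω : Ω) : EuclideanSpace ℝ (Fin d) :=
  v t (F ω) (interp t (X₀ ω, X₁ ω)) - (X₁ ω - X₀ ω)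

lemma measurable_residual (hX₀ : Measurable X₀) (hX₁ : Measurable X₁) (hF : Measurable F)
    {v : Field d k} (hv : v.IsMeasurable) :
    Measurable fun z : Ω × ℝ => residual X₀ X₁ F v z.2 z.1 := by
  have h0 : Measurable fun z : Ω × ℝ => X₀ z.1 := hX₀.comp measurable_fst
  have h1 : Measurable fun z : Ω × ℝ => X₁ z.1 := hX₁.comp measurable_fst
  exact (hv.comp measurable_snd (hF.comp measurable_fst)
    (measurable_interp_comp measurable_snd h0 h1)).sub (h1.sub h0)

lemma measurable_observation (hX₀ : Measurable X₀) (hX₁ : Measurable X₁) (hF : Measurable F) :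
    Measurable fun z : Ω × ℝ => ((F z.1, z.2), interp z.2 (X₀ z.1, X₁ z.1)) :=
  ((hF.comp measurable_fst).prodMk measurable_snd).prodMk
    (measurable_interp_comp measurable_snd (hX₀.comp measurable_fst) (hX₁.comp measurable_fst))

namespace IsConditionalVelocity

variable {v : Field d k}

lemma ae_setIntegral_residual (h : IsConditionalVelocity P X₀ X₁ F v)
    (hX₀ : Measurable X₀) (hX₁ : Measurable X₁) (hF : Measurable F)
    (hint : Integrable (fun ω => X₁ ω - X₀ ω) P) :
    ∀ᵐ t ∂unitTime, Integrable (residual X₀ X₁ F v t) P ∧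
      ∫ ω, ‖residual X₀ X₁ F v t ω‖ ∂P ≤ 2 * ∫ ω, ‖X₁ ω - X₀ ω‖ ∂P ∧
      ∀ A : Set (EuclideanSpace ℝ (Fin d) × EuclideanSpace ℝ (Fin k)), MeasurableSet A →
        ∫ ω in (fun ω => (interp t (X₀ ω, X₁ ω), F ω)) ⁻¹' A, residual X₀ X₁ F v t ω ∂P = 0 := by
  filter_upwards [h] with t ht
  have hI : Integrable (fun ω => v t (F ω) (interp t (X₀ ω, X₁ ω))) P :=
    integrable_condExp.congr ht.symm
  have hm : Measurable fun ω => (interp t (X₀ ω, X₁ ω), F ω) :=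
    (measurable_interp_comp measurable_const hX₀ hX₁).prodMk hF
  refine ⟨hI.sub hint, ?_, fun A hA => ?_⟩
  · calc ∫ ω, ‖residual X₀ X₁ F v t ω‖ ∂P
        ≤ ∫ ω, (‖v t (F ω) (interp t (X₀ ω, X₁ ω))‖ + ‖X₁ ω - X₀ ω‖) ∂P :=
          integral_mono (hI.sub hint).norm (hI.norm.add hint.norm) fun ω => norm_sub_le _ _
      _ = ∫ ω, ‖v t (F ω) (interp t (X₀ ω, X₁ ω))‖ ∂P + ∫ ω, ‖X₁ ω - X₀ ω‖ ∂P :=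
          integral_add hI.norm hint.norm
      _ ≤ _ := by
          rw [two_mul, integral_congr_ae (ht.mono fun ω hω => congrArg norm hω)]
          exact add_le_add_left (integral_norm_condExp_le fun ω => X₁ ω - X₀ ω) _
  · change ∫ ω in _, (v t (F ω) (interp t (X₀ ω, X₁ ω)) - (X₁ ω - X₀ ω)) ∂P = 0
    rw [integral_sub hI.integrableOn hint.integrableOn, sub_eq_zero,
      setIntegral_congr_ae (hm hA) (ht.mono fun ω hω _ => hω),
      setIntegral_condExp hm.comap_le hint ⟨A, hA, rfl⟩]

lemma integrable_residual (h : IsConditionalVelocity P X₀ X₁ F v) (hv : v.IsMeasurable)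
    (hX₀ : Measurable X₀) (hX₁ : Measurable X₁) (hF : Measurable F)
    (hint : Integrable (fun ω => X₁ ω - X₀ ω) P) :
    Integrable (fun z : Ω × ℝ => residual X₀ X₁ F v z.2 z.1) (P.prod unitTime) := by
  have hm := measurable_residual hX₀ hX₁ hF hv
  have key := h.ae_setIntegral_residual hX₀ hX₁ hF hint
  refine (integrable_prod_iff' hm.aestronglyMeasurable).2 ⟨key.mono fun t ht => ht.1, ?_⟩
  refine Integrable.of_bound (C := 2 * ∫ ω, ‖X₁ ω - X₀ ω‖ ∂P) ?_ ?_
  · exact (hm.norm.comp measurable_swap).stronglyMeasurable.integral_prod_right'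
      |>.aestronglyMeasurable
  · filter_upwards [key] with t ht
    rw [Real.norm_of_nonneg (integral_nonneg fun _ => norm_nonneg _)]
    exact ht.2.1

/-- The slice of B at time t is an event of (X_t, F), on which the residual has zero integral for
almost every t. This joint form is what both the loss and the slicing in f use. -/
lemma setIntegral_residual_eq_zero (h : IsConditionalVelocity P X₀ X₁ F v) (hv : v.IsMeasurable)
    (hX₀ : Measurable X₀) (hX₁ : Measurable X₁) (hF : Measurable F)
    (hint : Integrable (fun ω => X₁ ω - X₀ ω) P)
    {B : Set ((EuclideanSpace ℝ (Fin k) × ℝ) × EuclideanSpace ℝ (Fin d))} (hB : MeasurableSet B) :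
    ∫ z in (fun z : Ω × ℝ => ((F z.1, z.2), interp z.2 (X₀ z.1, X₁ z.1))) ⁻¹' B,
      residual X₀ X₁ F v z.2 z.1 ∂(P.prod unitTime) = 0 := by
  have hg := measurable_observation hX₀ hX₁ hF
  rw [← integral_indicator (hg hB), integral_prod_symm _
    ((h.integrable_residual hv hX₀ hX₁ hF hint).indicator (hg hB))]
  refine integral_eq_zero_of_ae ?_
  filter_upwards [h.ae_setIntegral_residual hX₀ hX₁ hF hint] with t ht
  have hA : MeasurableSet ((fun q : EuclideanSpace ℝ (Fin d) × EuclideanSpace ℝ (Fin k) =>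
      ((q.2, t), q.1)) ⁻¹' B) := by
    have : Measurable fun q : EuclideanSpace ℝ (Fin d) × EuclideanSpace ℝ (Fin k) =>
      ((q.2, t), q.1) := by fun_prop
    exact this hB
  have hm : Measurable fun ω => (interp t (X₀ ω, X₁ ω), F ω) :=
    (measurable_interp_comp measurable_const hX₀ hX₁).prodMk hF
  have := ht.2.2 _ hA
  rw [← integral_indicator (hm hA)] at this
  exact this

/-- A conditional velocity restricts to a velocity of the conditional law of the pair. -/
lemma ae_isVelocity (h : IsConditionalVelocity P X₀ X₁ F v) (hv : v.IsMeasurable)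
    (hX₀ : Measurable X₀) (hX₁ : Measurable X₁) (hF : Measurable F)
    (hint : Integrable (fun ω => X₁ ω - X₀ ω) P) :
    ∀ᵐ f ∂(P.map F), IsVelocity (pairLaw P X₀ X₁ F f) (fun t => v t f) := by
  set Φ : Ω × ℝ → (EuclideanSpace ℝ (Fin k) × ℝ) ×
    (EuclideanSpace ℝ (Fin d) × EuclideanSpace ℝ (Fin d)) :=
    fun z => ((F z.1, z.2), (X₀ z.1, X₁ z.1)) with hΦ
  have hΦm : Measurable Φ := by fun_prop
  set Z : (EuclideanSpace ℝ (Fin k) × ℝ) ×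
    (EuclideanSpace ℝ (Fin d) × EuclideanSpace ℝ (Fin d)) → EuclideanSpace ℝ (Fin d) :=
    fun q => v q.1.2 q.1.1 (interp q.1.2 q.2) - (q.2.2 - q.2.1) with hZ
  have hgm : Measurable fun q : (EuclideanSpace ℝ (Fin k) × ℝ) ×
      (EuclideanSpace ℝ (Fin d) × EuclideanSpace ℝ (Fin d)) => interp q.1.2 q.2 :=
    measurable_interp_comp (by fun_prop) (by fun_prop) (by fun_prop)
  have hZm : Measurable Z := (hv.comp (by fun_prop) (by fun_prop) hgm).sub (by fun_prop)
  have hmap := map_latent_time_pair (P := P) hX₀ hX₁ hF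
  have hres := h.integrable_residual hv hX₀ hX₁ hF hint
  have hZi : Integrable Z (((P.map F).prod unitTime) ⊗ₘ
      Kernel.prodMkRight ℝ (condDistrib (fun ω => (X₀ ω, X₁ ω)) F P)) := by
    rw [← hmap, integrable_map_measure hZm.aestronglyMeasurable hΦm.aemeasurable]
    exact hres
  have hYi : ∀ᵐ f ∂(P.map F), Integrable (fun p : EuclideanSpace ℝ (Fin d) ×
      EuclideanSpace ℝ (Fin d) => p.2 - p.1) (pairLaw P X₀ X₁ F f) := by
    have hY : Integrable (fun q : EuclideanSpace ℝ (Fin k) × EuclideanSpace ℝ (Fin d) ×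
        EuclideanSpace ℝ (Fin d) => q.2.2 - q.2.1)
        (P.map fun ω => (F ω, (X₀ ω, X₁ ω))) := by
      rw [integrable_map_measure (Measurable.aestronglyMeasurable (by fun_prop)) (by fun_prop)]
      exact hint
    exact hY.condDistrib_ae_map (by fun_prop)
  -- The base variable is (f, t) and the kernel ignores t. Fubini on the product then gives, for
  -- almost every f, the statement for almost every t with one and the same law of the pair.
  have slices := ae_setIntegral_slice_eq_zero hZi hgm fun B hB => by
    have hBm : MeasurableSet ((fun q : (EuclideanSpace ℝ (Fin k) × ℝ) ×
      (EuclideanSpace ℝ (Fin d) × EuclideanSpace ℝ (Fin d)) => (q.1, interp q.1.2 q.2)) ⁻¹' B) :=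
      (measurable_fst.prodMk hgm) hB
    rw [← hmap, setIntegral_map hBm hZm.aestronglyMeasurable hΦm.aemeasurable]
    exact h.setIntegral_residual_eq_zero hv hX₀ hX₁ hF hint hB
  filter_upwards [hYi, Measure.ae_ae_of_ae_prod slices] with f hf hs
  refine ⟨hv.comp measurable_fst measurable_const measurable_snd, hf, ?_⟩
  filter_upwards [hs] with t ht
  have hI : Integrable (fun p => v t f (interp t p)) (pairLaw P X₀ X₁ F f) := by
    exact (ht.1.add hf).congr (ae_of_all _ fun p => sub_add_cancel _ _)
  refine ⟨hI, fun A hA => ?_⟩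
  have := ht.2 A hA
  change ∫ p in interp t ⁻¹' A, (v t f (interp t p) - (p.2 - p.1)) ∂(pairLaw P X₀ X₁ F f) = 0 at this
  rwa [integral_sub hI.integrableOn hf.integrableOn, sub_eq_zero] at this

/-- A field whose residual is orthogonal to the observation of `(F, t, X_t)` is a conditional
velocity. -/
lemma of_setIntegral_residual (hv : v.IsMeasurable)
    (hX₀ : Measurable X₀) (hX₁ : Measurable X₁) (hF : Measurable F)
    (hint : Integrable (fun ω => X₁ ω - X₀ ω) P)
    (hres : Integrable (fun z : Ω × ℝ => residual X₀ X₁ F v z.2 z.1) (P.prod unitTime))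
    (h : ∀ B : Set ((EuclideanSpace ℝ (Fin k) × ℝ) × EuclideanSpace ℝ (Fin d)), MeasurableSet B →
      ∫ z in (fun z : Ω × ℝ => ((F z.1, z.2), interp z.2 (X₀ z.1, X₁ z.1))) ⁻¹' B,
        residual X₀ X₁ F v z.2 z.1 ∂(P.prod unitTime) = 0) :
    IsConditionalVelocity P X₀ X₁ F v := by
  have hgm : Measurable fun z : ℝ × Ω => (interp z.1 (X₀ z.2, X₁ z.2), F z.2) :=
    (measurable_interp_comp measurable_fst (hX₀.comp measurable_snd)
      (hX₁.comp measurable_snd)).prodMk (hF.comp measurable_snd)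
  have hswap : unitTime ⊗ₘ Kernel.const ℝ P = (P.prod unitTime).map Prod.swap := by
    rw [Measure.compProd_const, Measure.prod_swap]
  have hZm : Measurable fun z : ℝ × Ω => residual X₀ X₁ F v z.1 z.2 :=
    (measurable_residual hX₀ hX₁ hF hv).comp measurable_swap
  have hZ : Integrable (fun z : ℝ × Ω => residual X₀ X₁ F v z.1 z.2)
      (unitTime ⊗ₘ Kernel.const ℝ P) := by
    rw [hswap, integrable_map_measure hZm.aestronglyMeasurable measurable_swap.aemeasurable]
    exact hres
  -- Now the base variable is time alone and the kernel is constantly P.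
  have slices := ae_setIntegral_slice_eq_zero hZ hgm fun B hB => by
    have hBm := (measurable_fst.prodMk hgm) hB
    rw [hswap, setIntegral_map hBm hZm.aestronglyMeasurable measurable_swap.aemeasurable]
    have hψ : Measurable fun q : (EuclideanSpace ℝ (Fin k) × ℝ) × EuclideanSpace ℝ (Fin d) =>
      (q.1.2, (q.2, q.1.1)) := by fun_prop
    exact h _ (hψ hB)
  filter_upwards [slices] with t ht
  simp only [Kernel.const_apply] at ht
  have hm : Measurable fun ω => (interp t (X₀ ω, X₁ ω), F ω) :=
    (measurable_interp_comp measurable_const hX₀ hX₁).prodMk hF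
  have hI : Integrable (fun ω => v t (F ω) (interp t (X₀ ω, X₁ ω))) P :=
    (ht.1.add hint).congr (ae_of_all _ fun ω => sub_add_cancel _ _)
  refine ae_eq_condExp_of_forall_setIntegral_eq hm.comap_le hint
    (fun s _ _ => hI.integrableOn) ?_ ?_
  · rintro s ⟨A, hA, rfl⟩ _
    have := ht.2 A hA
    change ∫ ω in _, (v t (F ω) (interp t (X₀ ω, X₁ ω)) - (X₁ ω - X₀ ω)) ∂P = 0 at this
    rwa [integral_sub hI.integrableOn hint.integrableOn, sub_eq_zero] at this
  · have hφ : Measurable fun q : EuclideanSpace ℝ (Fin d) × EuclideanSpace ℝ (Fin k) =>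
        v t q.2 q.1 := hv.comp measurable_const measurable_snd measurable_fst
    exact (hφ.comp (comap_measurable _)).stronglyMeasurable.aestronglyMeasurable

end IsConditionalVelocity

end ConditionalVelocity

/-! ### Flows conditioned on the latent variable -/

section ConditionalFlow

variable {Ω : Type*} [MeasurableSpace Ω] {P : Measure Ω} [IsProbabilityMeasure P] {d k : ℕ}
  {X₀ X₁ : Ω → EuclideanSpace ℝ (Fin d)} {F : Ω → EuclideanSpace ℝ (Fin k)}

instance (f : EuclideanSpace ℝ (Fin k)) : IsProbabilityMeasure (pairLaw P X₀ X₁ F f) :=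
  inferInstanceAs (IsProbabilityMeasure (condDistrib (fun ω => (X₀ ω, X₁ ω)) F P f))

lemma ae_map_fst_pairLaw (hX₀ : Measurable X₀) (hX₁ : Measurable X₁) :
    ∀ᵐ f ∂(P.map F), (pairLaw P X₀ X₁ F f).map Prod.fst = condDistrib X₀ F P f := by
  filter_upwards [condDistrib_comp (μ := P) F (Y := fun ω => (X₀ ω, X₁ ω)) (f := Prod.fst)
    (by fun_prop) measurable_fst] with f hf
  rw [Kernel.map_apply _ measurable_fst] at hf
  exact hf.symm

lemma ae_map_snd_pairLaw (hX₀ : Measurable X₀) (hX₁ : Measurable X₁) :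
    ∀ᵐ f ∂(P.map F), (pairLaw P X₀ X₁ F f).map Prod.snd = condDistrib X₁ F P f := by
  filter_upwards [condDistrib_comp (μ := P) F (Y := fun ω => (X₀ ω, X₁ ω)) (f := Prod.snd)
    (by fun_prop) measurable_snd] with f hf
  rw [Kernel.map_apply _ measurable_snd] at hf
  exact hf.symm

/-- Under independence the joint law is a product, so the constant kernel disintegrates it, and
disintegrations are almost everywhere unique. -/
lemma ae_condDistrib_eq_of_indepFun (hX₀ : Measurable X₀) (hF : Measurable F)
    (h : IndepFun X₀ F P) : ∀ᵐ f ∂(P.map F), condDistrib X₀ F P f = P.map X₀ := by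
  have := condDistrib_ae_eq_of_measure_eq_compProd (μ := P) F hX₀.aemeasurable
    (κ := Kernel.const _ (P.map X₀)) (by
      rw [Measure.compProd_const]
      exact (indepFun_iff_map_prod_eq_prod_map_map hF.aemeasurable hX₀.aemeasurable).1 h.symm)
  filter_upwards [this] with f hf
  rw [hf, Kernel.const_apply]

lemma interp_one_eq_snd : (interp 1 : EuclideanSpace ℝ (Fin d) × EuclideanSpace ℝ (Fin d) → _) =
    Prod.snd :=
  funext interp_one

variable {v : Field d k}

/-- For almost every latent value, the flow of a conditional velocity is defined almost everywhere
and transports the conditional law of the source along the conditional marginal path. -/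
lemma IsConditionalVelocity.ae_flow (h : IsConditionalVelocity P X₀ X₁ F v) (hv : v.IsMeasurable)
    (hX₀ : Measurable X₀) (hX₁ : Measurable X₁) (hF : Measurable F)
    (hint : Integrable (fun ω => X₁ ω - X₀ ω) P)
    (hreg : ∀ᵐ f ∂(P.map F), IsLocallyRegular (fun t => v t f)) :
    ∀ᵐ f ∂(P.map F), IsLocallyRegular (fun t => v t f) ∧
      (∀ᵐ x ∂(condDistrib X₀ F P f), totalLength (fun t => v t f) x ≠ ∞) ∧
      (∀ t ∈ Icc (0 : ℝ) 1, (condDistrib X₀ F P f).map (flow (fun s => v s f) t) =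
        marginalPath P X₀ X₁ F f t) ∧
      (condDistrib X₀ F P f).map (flow (fun s => v s f) 1) = condDistrib X₁ F P f := by
  filter_upwards [h.ae_isVelocity hv hX₀ hX₁ hF hint, hreg, ae_map_fst_pairLaw hX₀ hX₁,
    ae_map_snd_pairLaw hX₀ hX₁] with f hvel hf h0 h1
  have hflow : ∀ t ∈ Icc (0 : ℝ) 1, (condDistrib X₀ F P f).map (flow (fun s => v s f) t) =
      marginalPath P X₀ X₁ F f t := fun t ht => h0 ▸ map_flow_eq hvel hf ht
  refine ⟨hf, h0 ▸ ae_totalLength_ne_top hvel hf, hflow, ?_⟩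
  rw [hflow 1 (right_mem_Icc.2 zero_le_one), ← h1, marginalPath, interp_one_eq_snd]

lemma measurable_slice (hv : v.IsMeasurable) (f : EuclideanSpace ℝ (Fin k)) :
    Measurable (Function.uncurry fun t => v t f) :=
  hv.comp measurable_fst measurable_const measurable_snd

/-- The law of the endpoint of the latent flow, started from the source, is that of the target. -/
lemma map_flow_latent_eq (hv : v.IsMeasurable) (hX₀ : Measurable X₀) (hX₁ : Measurable X₁)
    (hF : Measurable F)
    (h : ∀ᵐ f ∂(P.map F), IsLocallyRegular (fun t => v t f) ∧
      (∀ᵐ x ∂(condDistrib X₀ F P f), totalLength (fun t => v t f) x ≠ ∞) ∧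
      (condDistrib X₀ F P f).map (flow (fun s => v s f) 1) = condDistrib X₁ F P f) :
    P.map (fun ω => flow (fun s => v s (F ω)) 1 (X₀ ω)) = P.map X₁ := by
  classical
  -- The joint measurability results ask for regularity at every f. The field is set to zero on a
  -- measurable null set containing the bad latent values.
  obtain ⟨N, hN, hNm, hN0⟩ := exists_measurable_superset_of_null (ae_iff.1 h)
  have hgood : ∀ f ∉ N, _ := fun f hf => not_not.1 fun h' => hf (hN h')
  have hNae : ∀ᵐ f ∂(P.map F), f ∉ N := measure_eq_zero_iff_ae_notMem.1 hN0
  set w : EuclideanSpace ℝ (Fin k) → ℝ → EuclideanSpace ℝ (Fin d) → EuclideanSpace ℝ (Fin d) :=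
    fun f t x => if f ∈ N then 0 else v t f x with hw
  have hwm : Measurable fun z : EuclideanSpace ℝ (Fin k) × ℝ × EuclideanSpace ℝ (Fin d) =>
      w z.1 z.2.1 z.2.2 :=
    Measurable.ite (measurable_fst hNm) measurable_const
      (hv.comp (by fun_prop) (by fun_prop) (by fun_prop))
  have hwv : ∀ f ∉ N, w f = fun t => v t f := fun f hf => by
    funext t x; simp [hw, hf]
  have hwreg : ∀ f, IsLocallyRegular (w f) := fun f => by
    by_cases hf : f ∈ N
    · refine fun T _ R => ⟨0, integrableOn_zero, ae_of_all _ fun t => ⟨fun x _ => ?_,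
        fun x _ y _ => ?_⟩⟩ <;> simp [hw, hf]
    · rw [hwv f hf]; exact (hgood f hf).1
  have hjoint : P.map (fun ω => (F ω, X₀ ω)) = (P.map F) ⊗ₘ condDistrib X₀ F P :=
    (compProd_map_condDistrib hX₀.aemeasurable).symm
  have hfin : ∀ᵐ z ∂((P.map F) ⊗ₘ condDistrib X₀ F P), totalLength (w z.1) z.2 ≠ ∞ := by
    refine Measure.ae_compProd_of_ae_ae
      ((measurable_totalLength_joint hwm hwreg) (measurableSet_singleton _).compl) ?_
    filter_upwards [hNae] with f hf
    rw [hwv f hf]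
    exact (hgood f hf).2.1
  have hflow : AEMeasurable (fun z : EuclideanSpace ℝ (Fin k) × EuclideanSpace ℝ (Fin d) =>
      flow (w z.1) 1 z.2) ((P.map F) ⊗ₘ condDistrib X₀ F P) :=
    aemeasurable_flow_joint (v := w) hwm hwreg hfin (right_mem_Icc.2 zero_le_one)
  have hwF : (fun ω => flow (fun s => v s (F ω)) 1 (X₀ ω)) =ᵐ[P]
      fun ω => flow (w (F ω)) 1 (X₀ ω) := by
    filter_upwards [ae_of_ae_map hF.aemeasurable hNae] with ω hω
    rw [hwv _ hω]
  have hcomp : P.map (fun ω => flow (w (F ω)) 1 (X₀ ω)) =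
      ((P.map F) ⊗ₘ condDistrib X₀ F P).map (hflow.mk _) := by
    rw [← Measure.map_congr hflow.ae_eq_mk, ← hjoint,
      AEMeasurable.map_map_of_aemeasurable (hjoint ▸ hflow) (by fun_prop)]
    rfl
  rw [Measure.map_congr hwF, hcomp, ← condDistrib_comp_map (X := F) hF.aemeasurable
    hX₁.aemeasurable]
  ext A hA
  rw [Measure.map_apply hflow.measurable_mk hA,
    Measure.compProd_apply (hflow.measurable_mk hA), Measure.bind_apply hA (by fun_prop)]
  -- Both laws are mixtures over the law of F, and for almost every f the flow carries one
  -- conditional law to the other. The flow is only almost everywhere measurable, hence the passage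
  -- through `hflow.mk`.
  refine lintegral_congr_ae ?_
  filter_upwards [hNae, Measure.ae_ae_of_ae_compProd hflow.ae_eq_mk] with f hf hmk
  have hmkm : Measurable fun x => hflow.mk _ (f, x) := hflow.measurable_mk.comp measurable_prodMk_left
  rw [← (hgood f hf).2.2, ← hwv f hf, Measure.map_congr hmk, Measure.map_apply hmkm hA]
  rfl

end ConditionalFlow

/-! ### Square integrable functions and orthogonality -/

section SquareIntegrals

variable {T H : Type*} [MeasurableSpace T] {μ : Measure T} [NormedAddCommGroup H]
  [InnerProductSpace ℝ H]

lemma memLp_two_of_lintegral_lt_top {R : T → H} (hR : AEStronglyMeasurable R μ)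
    (h : ∫⁻ z, ‖R z‖ₑ ^ 2 ∂μ < ∞) : MemLp R 2 μ := by
  refine ⟨hR, (eLpNorm_lt_top_iff_lintegral_rpow_enorm_lt_top (by simp) (by simp)).2 ?_⟩
  simpa using h

lemma integrable_norm_sq_of_memLp {R : T → H} (hR : MemLp R 2 μ) :
    Integrable (fun z => ‖R z‖ ^ 2) μ :=
  (memLp_two_iff_integrable_sq_norm hR.1).1 hR

lemma lintegral_enorm_sq_eq {R : T → H} (hR : MemLp R 2 μ) :
    ∫⁻ z, ‖R z‖ₑ ^ 2 ∂μ = ENNReal.ofReal (∫ z, ‖R z‖ ^ 2 ∂μ) := by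
  rw [ofReal_integral_eq_lintegral_ofReal (integrable_norm_sq_of_memLp hR)
    (ae_of_all _ fun z => sq_nonneg _)]
  refine lintegral_congr fun z => ?_
  rw [ENNReal.ofReal_pow (norm_nonneg _), ofReal_norm]

lemma integrable_inner_of_memLp {R D : T → H} (hR : MemLp R 2 μ) (hD : MemLp D 2 μ) :
    Integrable (fun z => inner ℝ (R z) (D z)) μ := by
  refine ((integrable_norm_sq_of_memLp hR).add (integrable_norm_sq_of_memLp hD)).mono' (hR.1.inner hD.1)
    (ae_of_all _ fun z => ?_)
  refine (norm_inner_le_norm _ _).trans ?_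
  simp only [Pi.add_apply]
  nlinarith [sq_nonneg (‖R z‖ - ‖D z‖), sq_nonneg ‖R z‖, sq_nonneg ‖D z‖]

lemma integral_norm_add_sq {R D : T → H} (hR : MemLp R 2 μ) (hD : MemLp D 2 μ) :
    ∫ z, ‖R z + D z‖ ^ 2 ∂μ =
      ∫ z, ‖R z‖ ^ 2 ∂μ + 2 * ∫ z, inner ℝ (R z) (D z) ∂μ + ∫ z, ‖D z‖ ^ 2 ∂μ := by
  simp_rw [norm_add_sq_real]
  have h1 := (integrable_norm_sq_of_memLp hR)
  have h2 := (integrable_inner_of_memLp hR hD).const_mul 2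
  have h3 : Integrable (fun z => ‖R z‖ ^ 2 + 2 * inner ℝ (R z) (D z)) μ := h1.add h2
  rw [integral_add h3 (integrable_norm_sq_of_memLp hD), integral_add h1 h2, integral_const_mul]

end SquareIntegrals

section Orthogonality

variable {T W H : Type*} [MeasurableSpace T] [MeasurableSpace W] {μ : Measure T} [IsFiniteMeasure μ]
  [NormedAddCommGroup H] [InnerProductSpace ℝ H] [CompleteSpace H] [MeasurableSpace H]
  [BorelSpace H] [SecondCountableTopology H]

/-- If all set integrals of `R` over events observed through `g` vanish, then `R` is orthogonal to
the square integrable functions of `g`. -/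
lemma integral_inner_eq_zero_of_setIntegral {R : T → H} (hR : MemLp R 2 μ) {g : T → W}
    (hg : Measurable g) (h : ∀ B : Set W, MeasurableSet B → ∫ z in g ⁻¹' B, R z ∂μ = 0)
    {u : W → H} (hu : Measurable u) (hD : MemLp (fun z => u (g z)) 2 μ) :
    ∫ z, inner ℝ (R z) (u (g z)) ∂μ = 0 := by
  have hRi : Integrable R μ := hR.integrable (by norm_num)
  have hce : (0 : T → H) =ᵐ[μ] μ[R | MeasurableSpace.comap g inferInstance] := by
    refine ae_eq_condExp_of_forall_setIntegral_eq hg.comap_le hRi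
      (fun s _ _ => integrableOn_zero) ?_ aestronglyMeasurable_zero
    rintro s ⟨B, hB, rfl⟩ _
    rw [h B hB]; simp
  have hum : StronglyMeasurable[MeasurableSpace.comap g inferInstance] fun z => u (g z) :=
    (hu.comp (comap_measurable _)).stronglyMeasurable
  have key := condExp_bilin_of_stronglyMeasurable_left (μ := μ)
    (innerSL ℝ : H →L[ℝ] H →L[ℝ] ℝ) hum (integrable_inner_of_memLp hD hR) hRi
  have e : ∫ z, inner ℝ (R z) (u (g z)) ∂μ = ∫ z, inner ℝ (u (g z)) (R z) ∂μ :=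
    integral_congr_ae (ae_of_all _ fun z => real_inner_comm _ _)
  rw [e, ← integral_condExp hg.comap_le]
  refine (integral_congr_ae key).trans (integral_eq_zero_of_ae ?_)
  filter_upwards [hce] with z hz
  rw [← hz]
  simp

end Orthogonality

/-! ### Minimizers of the loss -/

section Loss

variable {Ω : Type*} [MeasurableSpace Ω] {P : Measure Ω} [IsProbabilityMeasure P] {d k : ℕ}
  {X₀ X₁ : Ω → EuclideanSpace ℝ (Fin d)} {F : Ω → EuclideanSpace ℝ (Fin k)} {v : Field d k}

/-- The Kullback-Leibler part of the loss. -/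
def klLoss (P : Measure Ω) [IsFiniteMeasure P] (X₀ X₁ : Ω → EuclideanSpace ℝ (Fin d))
    (F : Ω → EuclideanSpace ℝ (Fin k)) (β : ℝ≥0) : ℝ≥0∞ :=
  ∫⁻ p, β * InformationTheory.klDiv (encoder P X₀ X₁ F p)
    (stdGaussian (EuclideanSpace ℝ (Fin k))) ∂(P.map fun ω => (X₀ ω, X₁ ω))

instance : IsMarkovKernel (encoder P X₀ X₁ F) :=
  inferInstanceAs (IsMarkovKernel (condDistrib F (fun ω => (X₀ ω, X₁ ω)) P))

/-- Tonelli. The second summand c needs no measurability because the first one is measurable, so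
none has to be proved for the Kullback-Leibler term. -/
lemma lintegral_time_latent {S L : Type*} [MeasurableSpace S] [MeasurableSpace L] {lam : Measure S}
    [SFinite lam] {τ : Measure ℝ} [SFinite τ] {η : Kernel S L} [IsSFiniteKernel η]
    {G : S → ℝ → L → ℝ≥0∞} (hG : Measurable fun q : (S × ℝ) × L => G q.1.1 q.1.2 q.2)
    {c : S → ℝ≥0∞} :
    ∫⁻ p, ((∫⁻ t, ∫⁻ f, G p t f ∂(η p) ∂τ) + c p) ∂lam =
      ∫⁻ t, ∫⁻ q, G q.1 t q.2 ∂(lam ⊗ₘ η) ∂τ + ∫⁻ p, c p ∂lam := by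
  have hI : Measurable fun q : S × ℝ => ∫⁻ f, G q.1 q.2 f ∂(η q.1) :=
    Measurable.lintegral_kernel_prod_right' (κ := Kernel.prodMkRight ℝ η) hG
  rw [lintegral_add_left hI.lintegral_prod_right', lintegral_lintegral_swap hI.aemeasurable]
  refine congrArg (· + _) (lintegral_congr fun t => ?_)
  have hGt : Measurable fun q : S × L => G q.1 t q.2 :=
    hG.comp (f := fun q : S × L => ((q.1, t), q.2)) (by fun_prop)
  exact (Measure.lintegral_compProd hGt).symm

/-- The encoder is the conditional law of F given the pair, so averaging it over the law of the pair
returns the joint law under P. The Kullback-Leibler part does not involve the field. -/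
lemma loss_eq (hX₀ : Measurable X₀) (hX₁ : Measurable X₁) (hF : Measurable F)
    (hv : v.IsMeasurable) (β : ℝ≥0) :
    loss P X₀ X₁ F β v =
      ∫⁻ z, ‖residual X₀ X₁ F v z.2 z.1‖ₑ ^ 2 ∂(P.prod unitTime) + klLoss P X₀ X₁ F β := by
  have hG : Measurable fun q : ((EuclideanSpace ℝ (Fin d) × EuclideanSpace ℝ (Fin d)) × ℝ) ×
      EuclideanSpace ℝ (Fin k) =>
      ‖v q.1.2 q.2 (interp q.1.2 q.1.1) - (q.1.1.2 - q.1.1.1)‖ₑ ^ 2 := by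
    refine Measurable.pow_const (Measurable.enorm (Measurable.sub ?_ (by fun_prop))) _
    exact hv.comp (by fun_prop) (by fun_prop)
      (measurable_interp_comp (by fun_prop) (by fun_prop) (by fun_prop))
  refine (lintegral_time_latent (η := encoder P X₀ X₁ F)
    (G := fun p t f => ‖v t f (interp t p) - (p.2 - p.1)‖ₑ ^ 2) hG).trans ?_
  refine congrArg (· + klLoss P X₀ X₁ F β) ?_
  have hR : Measurable fun z : Ω × ℝ => ‖residual X₀ X₁ F v z.2 z.1‖ₑ ^ 2 :=
    (measurable_residual hX₀ hX₁ hF hv).enorm.pow_const 2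
  refine Eq.trans ?_ (lintegral_prod_symm _ hR.aemeasurable).symm
  refine lintegral_congr fun t => ?_
  have hGt : Measurable fun q : (EuclideanSpace ℝ (Fin d) × EuclideanSpace ℝ (Fin d)) ×
      EuclideanSpace ℝ (Fin k) => ‖v t q.2 (interp t q.1) - (q.1.2 - q.1.1)‖ₑ ^ 2 := by
    refine Measurable.pow_const (Measurable.enorm (Measurable.sub ?_ (by fun_prop))) _
    exact hv.comp (by fun_prop) (by fun_prop)
      (measurable_interp_comp (by fun_prop) (by fun_prop) (by fun_prop))
  have e : (P.map fun ω => (X₀ ω, X₁ ω)) ⊗ₘ encoder P X₀ X₁ F =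
    P.map fun ω => ((X₀ ω, X₁ ω), F ω) := compProd_map_condDistrib hF.aemeasurable
  rw [e, lintegral_map hGt (by fun_prop)]
  rfl

lemma memLp_residual (hX₀ : Measurable X₀) (hX₁ : Measurable X₁) (hF : Measurable F)
    (hv : v.IsMeasurable) {β : ℝ≥0} (h : loss P X₀ X₁ F β v < ∞) :
    MemLp (fun z : Ω × ℝ => residual X₀ X₁ F v z.2 z.1) 2 (P.prod unitTime) := by
  rw [loss_eq hX₀ hX₁ hF hv] at h
  exact memLp_two_of_lintegral_lt_top (measurable_residual hX₀ hX₁ hF hv).aestronglyMeasurable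
    (lt_of_le_of_lt le_self_add h)

instance : IsProbabilityMeasure unitTime := ⟨by simp [unitTime]⟩

/-- Pythagoras: the difference of two fields of finite loss is a square integrable function of (F,
t, X_t), hence orthogonal to the residual of the conditional velocity. -/
lemma IsConditionalVelocity.isLossMinimizer (h : IsConditionalVelocity P X₀ X₁ F v)
    (hv : v.IsMeasurable) (hX₀ : Measurable X₀) (hX₁ : Measurable X₁) (hF : Measurable F)
    (hint : Integrable (fun ω => X₁ ω - X₀ ω) P) {β : ℝ≥0} (hfin : loss P X₀ X₁ F β v < ∞) :
    IsLossMinimizer P X₀ X₁ F β v := by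
  refine ⟨hfin, fun w hw => ?_⟩
  by_cases hwfin : loss P X₀ X₁ F β w < ∞
  swap
  · rw [not_lt, top_le_iff] at hwfin
    rw [hwfin]; exact le_top
  have hRv := memLp_residual hX₀ hX₁ hF hv hfin
  have hRw := memLp_residual hX₀ hX₁ hF hw hwfin
  set g : Ω × ℝ → (EuclideanSpace ℝ (Fin k) × ℝ) × EuclideanSpace ℝ (Fin d) :=
    fun z => ((F z.1, z.2), interp z.2 (X₀ z.1, X₁ z.1)) with hg
  set u : (EuclideanSpace ℝ (Fin k) × ℝ) × EuclideanSpace ℝ (Fin d) → EuclideanSpace ℝ (Fin d) :=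
    fun q => w q.1.2 q.1.1 q.2 - v q.1.2 q.1.1 q.2 with hu
  have hum : Measurable u := (hw.comp (by fun_prop) (by fun_prop) (by fun_prop)).sub
    (hv.comp (by fun_prop) (by fun_prop) (by fun_prop))
  have hD : MemLp (fun z => u (g z)) 2 (P.prod unitTime) := by
    refine (hRw.sub hRv).ae_eq (ae_of_all _ fun z => ?_)
    simp only [Pi.sub_apply, residual, hu, hg]
    abel
  have hsum : ∀ z : Ω × ℝ, residual X₀ X₁ F w z.2 z.1 =
      residual X₀ X₁ F v z.2 z.1 + u (g z) := fun z => by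
    simp only [residual, hu, hg]
    abel
  have horth := integral_inner_eq_zero_of_setIntegral hRv (measurable_observation hX₀ hX₁ hF)
    (fun B hB => h.setIntegral_residual_eq_zero hv hX₀ hX₁ hF hint hB) hum hD
  rw [loss_eq hX₀ hX₁ hF hv, loss_eq hX₀ hX₁ hF hw, lintegral_enorm_sq_eq hRv,
    lintegral_enorm_sq_eq hRw]
  refine add_le_add (ENNReal.ofReal_le_ofReal ?_) le_rfl
  simp_rw [hsum]
  rw [integral_norm_add_sq hRv hD, horth, mul_zero, add_zero]
  exact le_add_of_nonneg_right (integral_nonneg fun z => sq_nonneg _)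

lemma IsLossMinimizer.isConditionalVelocity {β : ℝ≥0} (h : IsLossMinimizer P X₀ X₁ F β v)
    (hv : v.IsMeasurable) (hX₀ : Measurable X₀) (hX₁ : Measurable X₁) (hF : Measurable F)
    (hint : Integrable (fun ω => X₁ ω - X₀ ω) P) : IsConditionalVelocity P X₀ X₁ F v := by
  classical
  have hR := memLp_residual hX₀ hX₁ hF hv h.1
  refine IsConditionalVelocity.of_setIntegral_residual hv hX₀ hX₁ hF hint
    (hR.integrable (by norm_num)) fun B hB => ?_
  set g : Ω × ℝ → (EuclideanSpace ℝ (Fin k) × ℝ) × EuclideanSpace ℝ (Fin d) :=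
    fun z => ((F z.1, z.2), interp z.2 (X₀ z.1, X₁ z.1)) with hg
  have hgB : MeasurableSet (g ⁻¹' B) := measurable_observation hX₀ hX₁ hF hB
  set e := ∫ z in g ⁻¹' B, residual X₀ X₁ F v z.2 z.1 ∂(P.prod unitTime) with he
  set D : Ω × ℝ → EuclideanSpace ℝ (Fin d) := (g ⁻¹' B).indicator fun _ => -e with hDdef
  have hD : MemLp D 2 (P.prod unitTime) := (memLp_const (-e)).indicator hgB
  -- The competitor shifts v on B by minus the integral e of the residual over that event. The cross
  -- term of the square is -2 ‖e‖² and the quadratic term at most ‖e‖², the measure being a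
  -- probability, so minimality forces e = 0.
  set w : Field d k := fun t f x => v t f x + B.indicator (fun _ => -e) ((f, t), x) with hw
  have hwm : w.IsMeasurable := by
    refine Measurable.add hv ?_
    exact (measurable_const.indicator hB).comp
      (f := fun p : ℝ × EuclideanSpace ℝ (Fin k) × EuclideanSpace ℝ (Fin d) =>
        ((p.2.1, p.1), p.2.2)) (by fun_prop)
  have hsum : ∀ z : Ω × ℝ, residual X₀ X₁ F w z.2 z.1 = residual X₀ X₁ F v z.2 z.1 + D z :=
    fun z => by
      have : D z = B.indicator (fun _ => -e) (g z) := rfl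
      simp only [residual, hw, this, hg]
      abel
  have hRw : MemLp (fun z : Ω × ℝ => residual X₀ X₁ F w z.2 z.1) 2 (P.prod unitTime) :=
    (hR.add hD).ae_eq (ae_of_all _ fun z => (hsum z).symm)
  -- Finiteness is needed to cancel this term from the inequality in `ℝ≥0∞`.
  have hkl : klLoss P X₀ X₁ F β ≠ ∞ := by
    have := h.1
    rw [loss_eq hX₀ hX₁ hF hv] at this
    exact (lt_of_le_of_lt le_add_self this).ne
  have hle := h.2 w hwm
  rw [loss_eq hX₀ hX₁ hF hv, loss_eq hX₀ hX₁ hF hwm, ENNReal.add_le_add_iff_right hkl,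
    lintegral_enorm_sq_eq hR, lintegral_enorm_sq_eq hRw,
    ENNReal.ofReal_le_ofReal_iff (integral_nonneg fun z => sq_nonneg _)] at hle
  simp_rw [hsum] at hle
  rw [integral_norm_add_sq hR hD] at hle
  have h1 : ∫ z, inner ℝ (residual X₀ X₁ F v z.2 z.1) (D z) ∂(P.prod unitTime) = -‖e‖ ^ 2 := by
    have : ∀ z : Ω × ℝ, inner ℝ (residual X₀ X₁ F v z.2 z.1) (D z) =
        (g ⁻¹' B).indicator (fun z => inner ℝ (-e) (residual X₀ X₁ F v z.2 z.1)) z := fun z => by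
      by_cases hz : z ∈ g ⁻¹' B
      · simp only [hDdef, indicator_of_mem hz]; exact real_inner_comm _ _
      · simp only [hDdef, indicator_of_notMem hz, inner_zero_right]
    simp_rw [this]
    rw [integral_indicator hgB, integral_inner (hR.integrable (by norm_num)).integrableOn, ← he,
      inner_neg_left, real_inner_self_eq_norm_sq]
  have h2 : ∫ z, ‖D z‖ ^ 2 ∂(P.prod unitTime) ≤ ‖e‖ ^ 2 := by
    calc ∫ z, ‖D z‖ ^ 2 ∂(P.prod unitTime) ≤ ∫ _, ‖e‖ ^ 2 ∂(P.prod unitTime) := by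
          refine integral_mono (integrable_norm_sq_of_memLp hD) (integrable_const _) fun z => ?_
          have : ‖D z‖ ≤ ‖e‖ := by
            by_cases hz : z ∈ g ⁻¹' B
            · simp only [hDdef, indicator_of_mem hz, norm_neg, le_refl]
            · simp only [hDdef, indicator_of_notMem hz, norm_zero, norm_nonneg]
          exact pow_le_pow_left₀ (norm_nonneg _) this 2
      _ = ‖e‖ ^ 2 := by simp
  have h3 : ‖e‖ ^ 2 ≤ 0 := by linarith
  exact norm_eq_zero.1 (pow_eq_zero_iff two_ne_zero |>.1 (le_antisymm h3 (sq_nonneg _)))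

end Loss

end LatentCFM

end

/-! ### The main theorem -/

theorem proposition1 {Ω : Type*} [MeasurableSpace Ω] (P : Measure Ω) [IsProbabilityMeasure P]
    {d k : ℕ} (X₀ X₁ : Ω → EuclideanSpace ℝ (Fin d)) (F : Ω → EuclideanSpace ℝ (Fin k))
    (hX₀ : Measurable X₀) (hX₁ : Measurable X₁) (hF : Measurable F)
    (hint : Integrable (fun ω => X₁ ω - X₀ ω) P) :
    -- the minimizers of the loss are the versions of the conditional velocity of finite loss
    (∀ (β : ℝ≥0) (v : LatentCFM.Field d k), v.IsMeasurable →
      (LatentCFM.IsLossMinimizer P X₀ X₁ F β v ↔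
        LatentCFM.IsConditionalVelocity P X₀ X₁ F v ∧ LatentCFM.loss P X₀ X₁ F β v < ∞)) ∧
    -- the flow of the conditional velocity reproduces the conditional marginal path
    (∀ v : LatentCFM.Field d k, v.IsMeasurable →
      LatentCFM.IsConditionalVelocity P X₀ X₁ F v →
      (∀ᵐ f ∂(P.map F), LatentCFM.IsLocallyRegular (fun t => v t f)) →
      (∀ᵐ f ∂(P.map F),
        (∀ᵐ x ∂(condDistrib X₀ F P f), LatentCFM.FlowWellDefinedAt (fun t => v t f) x) ∧
        (∀ t ∈ Icc (0 : ℝ) 1,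
          (condDistrib X₀ F P f).map (LatentCFM.flow (fun s => v s f) t) =
            LatentCFM.marginalPath P X₀ X₁ F f t) ∧
        (condDistrib X₀ F P f).map (LatentCFM.flow (fun s => v s f) 1) =
          condDistrib X₁ F P f) ∧
      -- if the source does not depend on the latent variable, its unconditional law may be used
      (IndepFun X₀ F P → ∀ᵐ f ∂(P.map F),
        (∀ t ∈ Icc (0 : ℝ) 1,
          P.map (fun ω => LatentCFM.flow (fun s => v s f) t (X₀ ω)) =
            LatentCFM.marginalPath P X₀ X₁ F f t) ∧
        P.map (fun ω => LatentCFM.flow (fun s => v s f) 1 (X₀ ω)) = condDistrib X₁ F P f) ∧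
      P.map (fun ω => LatentCFM.flow (fun s => v s (F ω)) 1 (X₀ ω)) = P.map X₁) := by
  refine ⟨fun β v hv => ⟨fun h => ⟨h.isConditionalVelocity hv hX₀ hX₁ hF hint, h.1⟩,
    fun h => h.1.isLossMinimizer hv hX₀ hX₁ hF hint h.2⟩, fun v hv h hreg => ?_⟩
  have hflow := h.ae_flow hv hX₀ hX₁ hF hint hreg
  refine ⟨?_, fun hind => ?_, ?_⟩
  · filter_upwards [hflow] with f hf
    exact ⟨hf.2.1.mono fun x hx =>
      LatentCFM.flowWellDefinedAt (LatentCFM.measurable_slice hv f) hf.1 hx, hf.2.2⟩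
  · filter_upwards [hflow, LatentCFM.ae_condDistrib_eq_of_indepFun hX₀ hF hind] with f hf hlaw
    rw [hlaw] at hf
    have hmap : ∀ t ∈ Icc (0 : ℝ) 1,
        P.map (fun ω => LatentCFM.flow (fun s => v s f) t (X₀ ω)) =
          (P.map X₀).map (LatentCFM.flow (fun s => v s f) t) := fun t ht =>
      (AEMeasurable.map_map_of_aemeasurable
        (LatentCFM.aemeasurable_flow (LatentCFM.measurable_slice hv f) hf.1 hf.2.1 ht)
        hX₀.aemeasurable).symm
    exact ⟨fun t ht => (hmap t ht).trans (hf.2.2.1 t ht),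
      (hmap 1 (right_mem_Icc.2 zero_le_one)).trans hf.2.2.2⟩
  · exact LatentCFM.map_flow_latent_eq hv hX₀ hX₁ hF
      (hflow.mono fun f hf => ⟨hf.1, hf.2.1, hf.2.2.2⟩)
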